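/- Let $M$ be a closed (compact, without boundary) connected smooth manifold and let $L:TM\times\mathbb R\to\mathbb R$ be a $C^\infty$ Lagrangian which is (i) convex: the restriction of $L(\cdot,\cdot,t)$ to each $T_xM$ has positive definite Hessian; (ii) superlinear: for some Riemannian metric, $L(x,v,t)/|v|\to\infty$ as $|v|\to\infty$, uniformly in $(x,t)$; (iii) periodic: $L(x,v,t+1)=L(x,v,t)$; (iv) complete: every maximal solution of the Euler–Lagrange equation is defined on all of $\mathbb R$. Let $\mathbb S^1=\mathbb R/\mathbb Z$, and let $[t]\in\mathbb S^1$ be the class of $t\in\mathbb R$. For $k\in\mathbb R$ and an absolutely continuous curve $\gamma:[a,b]\to M$ ($a\le b$) put $A_{L+k}(\gamma)=\int_a^b \big(L(\gamma(\tau),\dot\gamma(\tau),\tau)+k\big)\,d\tau\in(-\infty,+\infty]$. For $(x,[s]),(y,[t])\in M\times\mathbb S^1$ and an integer $n\ge0$ let $\Phi^n_k((x,[s]),(y,[t]))$ be the infimum of $A_{L+k}(\gamma)$ over all absolutely continuous $\gamma:[a,b]\to M$ with $\gamma(a)=x$, $\gamma(b)=y$, $[a]=[s]$, $[b]=[t]$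 and $\lfloor b-a\rfloor=n$ (with $\inf\emptyset=+\infty$), and let $$\Phi_k=\inf_{n\ge0}\Phi^n_k,\qquad h_k=\liminf_{n\to\infty}\Phi^n_k .$$ Let $c=c(L)$ be the least $k$ such that $A_{L+k}(\gamma)\ge0$ for every absolutely continuous closed curve $\gamma$, that is, $\gamma:[a,b]\to M$ with $\gamma(a)=\gamma(b)$ and $b-a\in\mathbb Z$. A function $u:M\times\mathbb S^1\to\mathbb R$ is dominated if $u(y,[t])-u(x,[s])\le\Phi_c((x,[s]),(y,[t]))$ for all $(x,[s]),(y,[t])\in M\times\mathbb S^1$. It is a forward weak KAM solution if it is dominated and for every $(x,s)\in M\times\mathbb R$ there is a locally absolutely continuous curve $\gamma:[s,\infty)\to M$ with $\gamma(s)=x$ and $u(\gamma(t),[t])-u(x,[s])=A_{L+c}(\gamma|_{[s,t]})$ for all $t\ge s$. It is a backward weak KAM solution if it is dominated and for every $(x,s)\in M\times\mathbb R$ there is a locally absolutely continuous curve $\gamma:(-\infty,s]\to M$ with $\gamma(s)=x$ and $u(x,[s])-u(\gamma(t),[t])=A_{L+c}(\gamma|_{[t,s]})$ for all $t\le s$.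 **Lemma.** The function $h_c$ is finite everywhere on $(M\times\mathbb S^1)^2$, and for every $(z,[\sigma])\in M\times\mathbb S^1$ the function $$u(x,[t]):=h_c\big((z,[\sigma]),(x,[t])\big)$$ is a backward weak KAM solution and $$v(x,[t]):=-h_c\big((x,[t]),(z,[\sigma])\big)$$ is a forward weak KAM solution. In particular, backward and forward weak KAM solutions exist. -/

import Mathlib

open scoped Manifold ContDiff Topology

noncomputable section

namespace WeakKAM

variable {E : Type*} [NormedAddCommGroup E] [NormedSpace ℝ E]
  {M : Type*} [TopologicalSpace M] [ChartedSpace E M]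

/-- The velocity `(γ(t), γ'(t))` of a curve `γ` at time `t`, as a point of `TM`. -/
def velocity (E : Type*) [NormedAddCommGroup E] [NormedSpace ℝ E]
    {M : Type*} [TopologicalSpace M] [ChartedSpace E M] [IsManifold 𝓘(ℝ, E) ∞ M]
    (γ : ℝ → M) (t : ℝ) : TangentBundle 𝓘(ℝ, E) M :=
  ⟨γ t, mfderiv 𝓘(ℝ, ℝ) 𝓘(ℝ, E) γ t (1 : ℝ)⟩

/-- The Lagrangian read in the chart around `x₀`: position `q`, velocity `w`, time `t`. -/
def chartLagrangian [IsManifold 𝓘(ℝ, E) ∞ M] (L : TangentBundle 𝓘(ℝ, E) M → ℝ → ℝ)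
    (x₀ : M) (q w : E) (t : ℝ) : ℝ :=
  L ⟨(extChartAt 𝓘(ℝ, E) x₀).symm q,
    mfderiv 𝓘(ℝ, E) 𝓘(ℝ, E) (extChartAt 𝓘(ℝ, E) x₀).symm q w⟩ t

/-- `γ : ℝ → M` is a (global, `C^2`) solution of the Euler-Lagrange equation
`d/dt (∂L/∂v) = ∂L/∂x`, which is required to hold in every chart. -/
def IsEulerLagrangeSolution [IsManifold 𝓘(ℝ, E) ∞ M]
    (L : TangentBundle 𝓘(ℝ, E) M → ℝ → ℝ) (γ : ℝ → M) : Prop :=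
  ContMDiff 𝓘(ℝ, ℝ) 𝓘(ℝ, E) 2 γ ∧
  ∀ (x₀ : M) (t : ℝ), γ t ∈ (chartAt E x₀).source →
    HasDerivAt
      (fun τ : ℝ =>
        fderiv ℝ
          (fun w : E => chartLagrangian L x₀ (extChartAt 𝓘(ℝ, E) x₀ (γ τ)) w τ)
          (deriv (fun r : ℝ => extChartAt 𝓘(ℝ, E) x₀ (γ r)) τ))
      (fderiv ℝ
        (fun q : E =>
          chartLagrangian L x₀ q (deriv (fun r : ℝ => extChartAt 𝓘(ℝ, E) x₀ (γ r)) t) t)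
        (extChartAt 𝓘(ℝ, E) x₀ (γ t)))
      t

/-- Smooth time-periodic Lagrangians satisfying Mather's hypotheses. -/
structure IsPeriodicTonelli [IsManifold 𝓘(ℝ, E) ∞ M]
    (L : TangentBundle 𝓘(ℝ, E) M → ℝ → ℝ) : Prop where
  smooth : ContMDiff (𝓘(ℝ, E).tangent.prod 𝓘(ℝ, ℝ)) 𝓘(ℝ, ℝ) ∞
    (fun p : TangentBundle 𝓘(ℝ, E) M × ℝ => L p.1 p.2)
  /-- The Hessian of `L` restricted to each `T_xM` (which is `E` as a vector space) is
  positive definite. -/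
  convex : ∀ (x : M) (t : ℝ) (v w : E), w ≠ 0 →
    0 < fderiv ℝ (fderiv ℝ (fun v' : E => L ⟨x, v'⟩ t)) v w w
  /-- For some Riemannian metric, `L(x,v,t)/|v| → ∞` as `|v| → ∞`, uniformly in `x, t`. -/
  superlinear : ∃ g : Bundle.ContMDiffRiemannianMetric 𝓘(ℝ, E) ∞ E
      (fun x : M => TangentSpace 𝓘(ℝ, E) x),
    ∀ K : ℝ, ∃ R : ℝ, ∀ (x : M) (v : TangentSpace 𝓘(ℝ, E) x) (t : ℝ),
      R ≤ √(g.inner x v v) → K * √(g.inner x v v) ≤ L ⟨x, v⟩ t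
  periodic : ∀ (p : TangentBundle 𝓘(ℝ, E) M) (t : ℝ), L p (t + 1) = L p t
  /-- Every initial condition is the initial condition of a solution defined for all times. -/
  complete : ∀ (p : TangentBundle 𝓘(ℝ, E) M) (s : ℝ),
    ∃ γ : ℝ → M, IsEulerLagrangeSolution L γ ∧ velocity E γ s = p

/-- Absolutely continuous curves `[a,b] → M` (only the values of `γ` on `[a,b]` matter):
continuous, and absolutely continuous in every chart. -/
def IsACCurve (E : Type*) [NormedAddCommGroup E] [NormedSpace ℝ E]
    {M : Type*} [TopologicalSpace M] [ChartedSpace E M] (γ : ℝ → M) (a b : ℝ) : Prop :=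
  ContinuousOn γ (Set.Icc a b) ∧
  ∀ (x₀ : M) (c d : ℝ), a ≤ c → c ≤ d → d ≤ b →
    Set.MapsTo γ (Set.Icc c d) (chartAt E x₀).source →
    AbsolutelyContinuousOnInterval (fun τ => extChartAt 𝓘(ℝ, E) x₀ (γ τ)) c d

open Classical in
/-- The `(L+k)`-action of `γ` on `[a,b]`. A superlinear Lagrangian is bounded below,
so that a non-integrable integrand has integral `+∞`. -/
def action [IsManifold 𝓘(ℝ, E) ∞ M] (L : TangentBundle 𝓘(ℝ, E) M → ℝ → ℝ)
    (k : ℝ) (γ : ℝ → M) (a b : ℝ) : EReal :=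
  if IntervalIntegrable (fun τ => L (velocity E γ τ) τ + k) MeasureTheory.volume a b then
    ((∫ τ in a..b, (L (velocity E γ τ) τ + k) : ℝ) : EReal)
  else ⊤

/-- `γ : [a,b] → M` is an absolutely continuous curve from `P` to `Q` in `M × 𝕊¹`, and the
integer part of `b - a` is `n`. -/
def Joins (E : Type*) [NormedAddCommGroup E] [NormedSpace ℝ E]
    {M : Type*} [TopologicalSpace M] [ChartedSpace E M]
    (P Q : M × UnitAddCircle) (n : ℕ) (γ : ℝ → M) (a b : ℝ) : Prop :=
  a ≤ b ∧ IsACCurve E γ a b ∧ γ a = P.1 ∧ γ b = Q.1 ∧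
    (a : UnitAddCircle) = P.2 ∧ (b : UnitAddCircle) = Q.2 ∧ ⌊b - a⌋ = (n : ℤ)

/-- `Φ^n_k(P,Q)`, the least action of curves from `P` to `Q` with integer part of the
duration equal to `n`. -/
def actionPotentialN [IsManifold 𝓘(ℝ, E) ∞ M] (L : TangentBundle 𝓘(ℝ, E) M → ℝ → ℝ)
    (k : ℝ) (n : ℕ) (P Q : M × UnitAddCircle) : EReal :=
  sInf {A : EReal | ∃ (γ : ℝ → M) (a b : ℝ), Joins E P Q n γ a b ∧ action L k γ a b = A}

/-- The action functional `Φ_k = inf_n Φ^n_k`. -/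
def actionPotential [IsManifold 𝓘(ℝ, E) ∞ M] (L : TangentBundle 𝓘(ℝ, E) M → ℝ → ℝ)
    (k : ℝ) (P Q : M × UnitAddCircle) : EReal :=
  ⨅ n : ℕ, actionPotentialN L k n P Q

/-- The extended Peierls barrier `h_k = liminf_n Φ^n_k`. -/
def peierlsBarrier [IsManifold 𝓘(ℝ, E) ∞ M] (L : TangentBundle 𝓘(ℝ, E) M → ℝ → ℝ)
    (k : ℝ) (P Q : M × UnitAddCircle) : EReal :=
  Filter.liminf (fun n : ℕ => actionPotentialN L k n P Q) Filter.atTop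

/-- `γ : [a,b] → M` is an absolutely continuous closed curve: `γ(a) = γ(b)`, `b - a ∈ ℤ`. -/
def IsClosedCurve (E : Type*) [NormedAddCommGroup E] [NormedSpace ℝ E]
    {M : Type*} [TopologicalSpace M] [ChartedSpace E M] (γ : ℝ → M) (a b : ℝ) : Prop :=
  a ≤ b ∧ IsACCurve E γ a b ∧ γ a = γ b ∧ ∃ m : ℤ, b - a = (m : ℝ)

/-- The critical value `c(L)`: the least `k` such that the `(L+k)`-action of every closed
curve is nonnegative. -/
def criticalValue [IsManifold 𝓘(ℝ, E) ∞ M] (L : TangentBundle 𝓘(ℝ, E) M → ℝ → ℝ) : ℝ :=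
  sInf {k : ℝ | ∀ (γ : ℝ → M) (a b : ℝ), IsClosedCurve E γ a b → 0 ≤ action L k γ a b}

/-- `u ≺ L + c`. -/
def IsDominated [IsManifold 𝓘(ℝ, E) ∞ M] (L : TangentBundle 𝓘(ℝ, E) M → ℝ → ℝ)
    (u : M × UnitAddCircle → ℝ) : Prop :=
  ∀ P Q : M × UnitAddCircle,
    ((u Q - u P : ℝ) : EReal) ≤ actionPotential L (criticalValue L) P Q

/-- Forward weak KAM solutions, the set `𝒮⁺`. -/
def IsForwardWeakKAM [IsManifold 𝓘(ℝ, E) ∞ M] (L : TangentBundle 𝓘(ℝ, E) M → ℝ → ℝ)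
    (u : M × UnitAddCircle → ℝ) : Prop :=
  IsDominated L u ∧
  ∀ (x : M) (s : ℝ), ∃ γ : ℝ → M, γ s = x ∧ ∀ t : ℝ, s ≤ t →
    IsACCurve E γ s t ∧
    ((u (γ t, (t : UnitAddCircle)) - u (x, (s : UnitAddCircle)) : ℝ) : EReal) =
      action L (criticalValue L) γ s t

/-- Backward weak KAM solutions, the set `𝒮⁻`. -/
def IsBackwardWeakKAM [IsManifold 𝓘(ℝ, E) ∞ M] (L : TangentBundle 𝓘(ℝ, E) M → ℝ → ℝ)
    (u : M × UnitAddCircle → ℝ) : Prop :=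
  IsDominated L u ∧
  ∀ (x : M) (s : ℝ), ∃ γ : ℝ → M, γ s = x ∧ ∀ t : ℝ, t ≤ s →
    IsACCurve E γ t s ∧
    ((u (x, (s : UnitAddCircle)) - u (γ t, (t : UnitAddCircle)) : ℝ) : EReal) =
      action L (criticalValue L) γ t s

end WeakKAM

end

/-! Two facts carry the theorem: critical actions are bounded on both sides, and the action is lower
semicontinuous (Tonelli).

Finiteness of the barrier. On a compact connected manifold any two points are joined with uniformly
bounded action for durations in a compact subset of `(0, ∞)` (`uniformlyConnected`). Closing an
arbitrary curve up by such an arc shows that its `(L+c)`-action is bounded below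
(`exists_critical_lower_bound`). Conversely, for each `n ≥ 1` some curve of duration `n` has
`(L+c)`-action at most `1`: otherwise, cutting iterated closed curves into pieces of length `n`
would show that `c - 1/n` is still an admissible level. Attaching an arc at each end bounds the
action between arbitrary endpoints from above (`exists_critical_upper_bound`).

Domination. Adding a fixed curve before or after long almost minimizing curves gives the triangle
inequalities `barrier_sub_le_right` and `barrier_sub_le_left`.

Calibration. Almost minimizing curves from `(z, σ - m)` to `(x, s)` with `m → ∞` have bounded action
on each `[t, s]`, and an ultrafilter limit of them is an absolutely continuous curve `γ` on `(-∞,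
s]`. Let `t` be a time at which `γ` is differentiable. The initial part of an approximating curve,
stopped at `t - δ` and led to `γ t` at cost `O(δ)`, has `(L+c)`-action at least about `h((z, σ), (γ
t, t))`. The rest therefore has little action, and lower semicontinuity
(`IsBoundedLimit.admissible`) transfers this to `γ`. Together with domination this forces equality,
first at times of differentiability and then at all times. The forward case is symmetric.

Lower semicontinuity. Convexity supplies affine minorants of `L` that are stable under small changes
of position and time (`exists_affine_minorant`). Integrated over short intervals, they bound the
Lagrangian along the limit curve by the derivative of the limit of the actions. That limit is a
monotone function of time, so the integral of its derivative is at most its increment. -/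

noncomputable section

namespace WeakKAM

open MeasureTheory Set Filter AbsolutelyContinuousOnInterval

/-! ### Absolutely continuous functions on intervals -/

section AbsolutelyContinuous

variable {X Y : Type*} [PseudoMetricSpace X] [PseudoMetricSpace Y]

/-- A function whose increments are dominated by those of an absolutely continuous function is
absolutely continuous. -/
theorem ac_of_dist_le {f : ℝ → X} {g : ℝ → Y} {a b C : ℝ}
    (hf : AbsolutelyContinuousOnInterval f a b)
    (h : ∀ s ∈ uIcc a b, ∀ t ∈ uIcc a b, dist (g s) (g t) ≤ C * dist (f s) (f t)) :
    AbsolutelyContinuousOnInterval g a b := by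
  have h1 : Tendsto (fun E : ℕ × (ℕ → ℝ × ℝ) ↦
      C * ∑ i ∈ Finset.range E.1, dist (f (E.2 i).1) (f (E.2 i).2))
      (totalLengthFilter ⊓ 𝓟 (disjWithin a b)) (𝓝 0) := by
    rw [← mul_zero C]
    exact Filter.Tendsto.const_mul C hf
  refine squeeze_zero' (Eventually.of_forall fun E => Finset.sum_nonneg fun _ _ => dist_nonneg)
    ?_ h1
  have : ∀ᶠ E in totalLengthFilter ⊓ 𝓟 (disjWithin a b), E ∈ disjWithin a b :=
    eventually_inf_principal.mpr (by simp)
  filter_upwards [this] with E hE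
  rw [Finset.mul_sum]
  exact Finset.sum_le_sum fun i hi => h _ (hE.1 i hi).1 _ (hE.1 i hi).2

/-- Absolute continuity on adjacent intervals gives absolute continuity on their union. -/
theorem ac_union {f : ℝ → X} {a b c : ℝ} (hab : a ≤ b) (hbc : b ≤ c)
    (h1 : AbsolutelyContinuousOnInterval f a b) (h2 : AbsolutelyContinuousOnInterval f b c) :
    AbsolutelyContinuousOnInterval f a c := by
  rw [absolutelyContinuousOnInterval_iff] at *
  intro ε hε
  obtain ⟨δ₁, hδ₁, H1⟩ := h1 (ε / 2) (by positivity)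
  obtain ⟨δ₂, hδ₂, H2⟩ := h2 (ε / 2) (by positivity)
  refine ⟨min δ₁ δ₂, by positivity, fun E hE hlt => ?_⟩
  obtain ⟨hE1, hE2⟩ := hE
  rw [uIcc_of_le (hab.trans hbc)] at hE1
  -- Each interval of the family is cut at `b` by truncating its endpoints with `min · b` and `max ·
  -- b`. The pieces lie inside the original intervals, so disjointness survives, and truncation does
  -- not increase lengths.
  have hmin : ∀ x y : ℝ, uIoc (min x b) (min y b) ⊆ uIoc x y := by
    intro x y z hz
    simp only [uIoc, mem_Ioc] at hz ⊢
    grind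
  have hmax : ∀ x y : ℝ, uIoc (max x b) (max y b) ⊆ uIoc x y := by
    intro x y z hz
    simp only [uIoc, mem_Ioc] at hz ⊢
    grind
  have e1 := H1 (E.1, fun i => (min (E.2 i).1 b, min (E.2 i).2 b)) ⟨fun i hi => by
      have := hE1 i hi
      rw [uIcc_of_le hab]
      simp only [mem_Icc] at this ⊢
      grind, fun i hi j hj hij => (hE2 hi hj hij).mono (hmin _ _) (hmin _ _)⟩
    (lt_of_le_of_lt (Finset.sum_le_sum fun i hi => by
      simp only [Real.dist_eq]
      exact abs_inf_sub_inf_le_abs _ _ _) (hlt.trans_le (min_le_left _ _)))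
  have e2 := H2 (E.1, fun i => (max (E.2 i).1 b, max (E.2 i).2 b)) ⟨fun i hi => by
      have := hE1 i hi
      rw [uIcc_of_le hbc]
      simp only [mem_Icc] at this ⊢
      grind, fun i hi j hj hij => (hE2 hi hj hij).mono (hmax _ _) (hmax _ _)⟩
    (lt_of_le_of_lt (Finset.sum_le_sum fun i hi => by
      simp only [Real.dist_eq]
      exact abs_max_sub_max_le_abs _ _ _) (hlt.trans_le (min_le_right _ _)))
  calc ∑ i ∈ Finset.range E.1, dist (f (E.2 i).1) (f (E.2 i).2)
      ≤ ∑ i ∈ Finset.range E.1, (dist (f (min (E.2 i).1 b)) (f (min (E.2 i).2 b)) +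
          dist (f (max (E.2 i).1 b)) (f (max (E.2 i).2 b))) := by
        refine Finset.sum_le_sum fun i _ => ?_
        rcases le_total (E.2 i).1 b with h | h <;> rcases le_total (E.2 i).2 b with h' | h' <;>
          simp only [min_eq_left, min_eq_right, max_eq_left, max_eq_right, h, h', dist_self,
            add_zero, zero_add, le_refl]
        · exact dist_triangle _ _ _
        · rw [add_comm]; exact dist_triangle _ _ _
    _ < ε := by
        rw [Finset.sum_add_distrib]
        simp only at e1 e2
        linarith

theorem ac_comp_sub {f : ℝ → X} {a b : ℝ} (r : ℝ) (hf : AbsolutelyContinuousOnInterval f a b) :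
    AbsolutelyContinuousOnInterval (fun t => f (t - r)) (a + r) (b + r) := by
  rw [absolutelyContinuousOnInterval_iff] at *
  intro ε hε
  obtain ⟨δ, hδ, H⟩ := hf ε hε
  refine ⟨δ, hδ, fun E hE hlt => ?_⟩
  refine H (E.1, fun i => ((E.2 i).1 - r, (E.2 i).2 - r)) ⟨fun i hi => ?_, ?_⟩ (by simpa using hlt)
  · have := hE.1 i hi
    simp only [mem_uIcc] at this ⊢
    grind
  · intro i hi j hj hij
    have := hE.2 hi hj hij
    simp only [Function.onFun, Set.disjoint_left, uIoc, mem_Ioc] at this ⊢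
    intro x hx hx'
    apply @this (x + r)
    · grind
    · grind

/-- The intervals are disjoint and `g` is nonnegative, so the sum is the integral of `g` over a
subset of `(a, b]`. -/
theorem sum_abs_integral_le {g : ℝ → ℝ} {a b : ℝ} (hab : a ≤ b)
    (hg : IntervalIntegrable g volume a b) (h0 : ∀ t ∈ Ioc a b, 0 ≤ g t)
    {E : ℕ × (ℕ → ℝ × ℝ)} (hE : E ∈ disjWithin a b) :
    ∑ i ∈ Finset.range E.1, |∫ t in (E.2 i).1..(E.2 i).2, g t| ≤ ∫ t in a..b, g t := by
  have hsub : ∀ i ∈ Finset.range E.1, uIoc (E.2 i).1 (E.2 i).2 ⊆ Ioc a b := fun i hi => by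
    rw [← uIoc_of_le hab]
    exact uIoc_subset_of_mem_disjWithin (n := E.1) (I := E.2) hE (Finset.mem_range.1 hi)
  have hint : IntegrableOn g (Ioc a b) := (intervalIntegrable_iff_integrableOn_Ioc_of_le hab).1 hg
  have h1 : ∀ i ∈ Finset.range E.1, |∫ t in (E.2 i).1..(E.2 i).2, g t| =
      ∫ t in uIoc (E.2 i).1 (E.2 i).2, g t := fun i hi => by
    rw [intervalIntegral.abs_intervalIntegral_eq, abs_of_nonneg]
    exact setIntegral_nonneg measurableSet_uIoc fun t ht => h0 t (hsub i hi ht)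
  rw [Finset.sum_congr rfl h1, ← integral_biUnion_finset _ (by simp [uIoc]) hE.2
    (fun i hi => hint.mono_set (hsub i hi)), intervalIntegral.integral_of_le hab]
  refine setIntegral_mono_set hint ?_ ?_
  · exact (ae_restrict_iff' measurableSet_Ioc).2 (Eventually.of_forall h0)
  · exact (iUnion₂_subset hsub).eventuallyLE

/-- A pointwise limit of curves with equi-integrable increments is absolutely continuous. -/
theorem ac_of_tendsto {ι : Type*} {U : Filter ι} [U.NeBot] {fs : ι → ℝ → X} {f : ℝ → X}
    {gs : ι → ℝ → ℝ} {a b A : ℝ} (hab : a ≤ b)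
    (hlim : ∀ t ∈ Icc a b, Tendsto (fun i => fs i t) U (𝓝 (f t)))
    (hint : ∀ᶠ i in U, IntervalIntegrable (gs i) volume a b)
    (h0 : ∀ᶠ i in U, ∀ t ∈ Ioc a b, 0 ≤ gs i t)
    (hA : ∀ᶠ i in U, ∫ t in a..b, gs i t ≤ A)
    (hK : ∀ K > 0, ∃ R > 0, ∀ᶠ i in U, ∀ s ∈ Icc a b, ∀ t ∈ Icc a b, s ≤ t →
      K * dist (fs i s) (fs i t) ≤ (∫ r in s..t, gs i r) + R * (t - s)) :
    AbsolutelyContinuousOnInterval f a b := by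
  rw [absolutelyContinuousOnInterval_iff]
  intro ε hε
  -- With this `K` and total length below `(|A| + 1) / (2 * R)`, `K` times the sum of increments is
  -- at most `|A| + (|A| + 1) / 2`, which is less than `2 * (|A| + 1) = K * ε`. The bound concerns
  -- finitely many points, so it passes to the pointwise limit.
  obtain ⟨R, hR, hR'⟩ := hK (2 * (|A| + 1) / ε) (by positivity)
  set K := 2 * (|A| + 1) / ε with hKdef
  have hKpos : 0 < K := by positivity
  refine ⟨(|A| + 1) / (2 * R), by positivity, fun E hE hlt => ?_⟩
  have hmem : ∀ i ∈ Finset.range E.1, (E.2 i).1 ∈ Icc a b ∧ (E.2 i).2 ∈ Icc a b := by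
    simpa only [uIcc_of_le hab] using hE.1
  have hsum : ∀ᶠ j in U, K * ∑ i ∈ Finset.range E.1, dist (fs j (E.2 i).1) (fs j (E.2 i).2) ≤
      A + R * ∑ i ∈ Finset.range E.1, dist (E.2 i).1 (E.2 i).2 := by
    filter_upwards [hint, h0, hA, hR'] with j j1 j2 j3 j4
    have := sum_abs_integral_le hab j1 j2 hE
    calc _ ≤ ∑ i ∈ Finset.range E.1, (|∫ t in (E.2 i).1..(E.2 i).2, gs j t| +
          R * dist (E.2 i).1 (E.2 i).2) := by
          rw [Finset.mul_sum]
          refine Finset.sum_le_sum fun i hi => ?_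
          obtain ⟨m1, m2⟩ := hmem i hi
          rcases le_total (E.2 i).1 (E.2 i).2 with h | h
          · refine (j4 _ m1 _ m2 h).trans (add_le_add (le_abs_self _) ?_)
            rw [dist_comm, Real.dist_eq, abs_of_nonneg (sub_nonneg.2 h)]
          · rw [dist_comm (fs j _), intervalIntegral.integral_symm, abs_neg]
            refine (j4 _ m2 _ m1 h).trans (add_le_add (le_abs_self _) ?_)
            rw [Real.dist_eq, abs_of_nonneg (sub_nonneg.2 h)]
      _ ≤ _ := by
          rw [Finset.sum_add_distrib, ← Finset.mul_sum]
          linarith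
  have htend : Tendsto (fun j => K * ∑ i ∈ Finset.range E.1,
      dist (fs j (E.2 i).1) (fs j (E.2 i).2)) U
      (𝓝 (K * ∑ i ∈ Finset.range E.1, dist (f (E.2 i).1) (f (E.2 i).2))) :=
    (tendsto_finsetSum _ fun i hi =>
      (hlim _ (hmem i hi).1).dist (hlim _ (hmem i hi).2)).const_mul K
  have hle := le_of_tendsto htend hsum
  have h3 : R * ∑ i ∈ Finset.range E.1, dist (E.2 i).1 (E.2 i).2 < (|A| + 1) / 2 := by
    calc _ < R * ((|A| + 1) / (2 * R)) := by gcongr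
      _ = _ := by field_simp
  have h4 : K * ∑ i ∈ Finset.range E.1, dist (f (E.2 i).1) (f (E.2 i).2) < K * ε := by
    have : K * ε = 2 * (|A| + 1) := by rw [hKdef]; field_simp
    rw [this]
    have := le_abs_self A
    have := abs_nonneg A
    linarith
  exact lt_of_mul_lt_mul_left h4 hKpos.le

end AbsolutelyContinuous

/-! ### Vector-valued absolutely continuous functions -/

section Vector

variable {E : Type*} [NormedAddCommGroup E] [NormedSpace ℝ E]

theorem ac_ae_differentiableAt [FiniteDimensional ℝ E] {f : ℝ → E} {a b : ℝ}
    (hf : AbsolutelyContinuousOnInterval f a b) :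
    ∀ᵐ t : ℝ, t ∈ uIcc a b → DifferentiableAt ℝ f t :=
  hf.boundedVariationOn.ae_differentiableAt_of_mem_uIcc

theorem ac_clm_comp {f : ℝ → E} {a b : ℝ} (hf : AbsolutelyContinuousOnInterval f a b)
    (p : E →L[ℝ] ℝ) : AbsolutelyContinuousOnInterval (fun t => p (f t)) a b :=
  ac_of_dist_le (C := ‖p‖) hf fun s _ t _ => by
    rw [dist_eq_norm, dist_eq_norm, ← map_sub]
    exact p.le_opNorm _

theorem ac_clm_deriv [FiniteDimensional ℝ E] {f : ℝ → E} {a b : ℝ}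
    (hf : AbsolutelyContinuousOnInterval f a b) (p : E →L[ℝ] ℝ) :
    IntervalIntegrable (fun t => p (deriv f t)) volume a b ∧
      ∫ t in a..b, p (deriv f t) = p (f b - f a) := by
  have hae : ∀ᵐ t : ℝ, t ∈ uIoc a b → deriv (fun t => p (f t)) t = p (deriv f t) := by
    filter_upwards [ac_ae_differentiableAt hf] with t ht hmem
    exact (p.hasFDerivAt.comp_hasDerivAt t (ht (uIoc_subset_uIcc hmem)).hasDerivAt).deriv
  constructor
  · refine (ac_clm_comp hf p).intervalIntegrable_deriv.congr_ae ?_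
    exact (ae_restrict_iff' measurableSet_uIoc).2 hae
  · rw [map_sub, ← (ac_clm_comp hf p).integral_deriv_eq_sub]
    exact (intervalIntegral.integral_congr_ae hae).symm

/-- A functional of norm at most one that norms `f b - f a` reduces the estimate to the scalar
fundamental theorem of calculus. The bound on the derivative is asked only in the open interval,
because values of a curve outside `[a, b]` affect its derivative at the endpoints. -/
theorem ac_norm_sub_le [FiniteDimensional ℝ E] {f : ℝ → E} {g : ℝ → ℝ} {a b : ℝ} (hab : a ≤ b)
    (hf : AbsolutelyContinuousOnInterval f a b) (hg : IntervalIntegrable g volume a b)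
    (h : ∀ t ∈ Ioo a b, ‖deriv f t‖ ≤ g t) :
    ‖f b - f a‖ ≤ ∫ t in a..b, g t := by
  obtain ⟨p, hp, hp'⟩ := exists_dual_vector'' ℝ (f b - f a)
  obtain ⟨h1, h2⟩ := ac_clm_deriv hf p
  have : ‖f b - f a‖ = p (f b - f a) := by simpa using hp'.symm
  rw [this, ← h2]
  refine intervalIntegral.integral_mono_on_of_le_Ioo hab h1 hg fun t ht => ?_
  refine (le_abs_self _).trans ((p.le_opNorm _).trans ?_)
  calc ‖p‖ * ‖deriv f t‖ ≤ 1 * ‖deriv f t‖ := by gcongr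
    _ ≤ g t := by rw [one_mul]; exact h t ht

end Vector

end WeakKAM

end

noncomputable section

namespace WeakKAM

set_option linter.unusedSectionVars false

open MeasureTheory Set Filter

/-! ### The Lagrangian in charts: continuity, convexity, affine minorants -/

section Chart

variable {E : Type*} [NormedAddCommGroup E] [NormedSpace ℝ E]
  {M : Type*} [TopologicalSpace M] [ChartedSpace E M] [IsManifold 𝓘(ℝ, E) ∞ M]
  {L : TangentBundle 𝓘(ℝ, E) M → ℝ → ℝ}

/-- The derivative of the inverse of the chart around `x₀`, as an endomorphism of `E`. -/
def chartDeriv (x₀ : M) (q : E) : E →L[ℝ] E :=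
  mfderiv 𝓘(ℝ, E) 𝓘(ℝ, E) (extChartAt 𝓘(ℝ, E) x₀).symm q

/-- The Lagrangian on the fibre over `x` at time `t`. -/
def fiberLagrangian (L : TangentBundle 𝓘(ℝ, E) M → ℝ → ℝ) (x : M) (t : ℝ) (v : E) : ℝ :=
  L ⟨x, v⟩ t

theorem chartLagrangian_eq_fiber (x₀ : M) (q w : E) (t : ℝ) :
    chartLagrangian L x₀ q w t =
      fiberLagrangian L ((extChartAt 𝓘(ℝ, E) x₀).symm q) t (chartDeriv x₀ q w) := rfl

theorem tangent_ext {x y : M} (h : x = y) (v w : E) (hvw : v = w) :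
    (⟨x, v⟩ : TangentBundle 𝓘(ℝ, E) M) = ⟨y, w⟩ := by
  subst h; subst hvw; rfl

/-- The tangent vector with coordinates `(q, w)` in the chart around `x₀`. -/
def chartVec (x₀ : M) (q w : E) : TangentBundle 𝓘(ℝ, E) M :=
  ⟨(extChartAt 𝓘(ℝ, E) x₀).symm q,
    mfderiv 𝓘(ℝ, E) 𝓘(ℝ, E) (extChartAt 𝓘(ℝ, E) x₀).symm q w⟩

theorem chartLagrangian_eq (x₀ : M) (q w : E) (t : ℝ) :
    chartLagrangian L x₀ q w t = L (chartVec x₀ q w) t := rfl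

theorem isOpen_chart_target (x₀ : M) : IsOpen (extChartAt 𝓘(ℝ, E) x₀).target :=
  isOpen_extChartAt_target x₀

theorem mdifferentiableAt_chart_symm {x₀ : M} {q : E} (hq : q ∈ (extChartAt 𝓘(ℝ, E) x₀).target) :
    MDifferentiableAt 𝓘(ℝ, E) 𝓘(ℝ, E) (extChartAt 𝓘(ℝ, E) x₀).symm q :=
  ((contMDiffOn_extChartAt_symm (n := ∞) x₀).contMDiffAt
    ((isOpen_chart_target x₀).mem_nhds hq)).mdifferentiableAt (by simp)

theorem chart_symm_mem {x₀ : M} {q : E} (hq : q ∈ (extChartAt 𝓘(ℝ, E) x₀).target) :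
    (extChartAt 𝓘(ℝ, E) x₀).symm q ∈ (chartAt E x₀).source := by
  have := (extChartAt 𝓘(ℝ, E) x₀).map_target hq
  rwa [extChartAt_source] at this

/-- The map is the inverse of the trivialization of `TM` at `x₀`, precomposed with the inverse chart
on base points. -/
theorem continuousOn_chartVec (x₀ : M) :
    ContinuousOn (fun p : E × E => chartVec x₀ p.1 p.2)
      ((extChartAt 𝓘(ℝ, E) x₀).target ×ˢ univ) := by
  have h1 := (trivializationAt E (TangentSpace 𝓘(ℝ, E) (M := M)) x₀).continuousOn_symm
  have h2 : ContinuousOn (fun p : E × E => ((extChartAt 𝓘(ℝ, E) x₀).symm p.1, p.2))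
      ((extChartAt 𝓘(ℝ, E) x₀).target ×ˢ univ) :=
    ((continuousOn_extChartAt_symm x₀).comp continuousOn_fst fun p hp => hp.1).prodMk
      continuousOn_snd
  refine (h1.comp h2 fun p hp => ⟨?_, mem_univ _⟩).congr fun p hp => ?_
  · exact chart_symm_mem hp.1
  · have hb := chart_symm_mem hp.1
    have h3 := TangentBundle.symmL_trivializationAt (I := 𝓘(ℝ, E)) (𝕜 := ℝ) hb
    rw [(extChartAt 𝓘(ℝ, E) x₀).right_inv hp.1] at h3
    simp only [modelWithCornersSelf_coe, range_id, mfderivWithin_univ] at h3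
    have h4 := (trivializationAt E (TangentSpace 𝓘(ℝ, E) (M := M)) x₀).symmL_apply
      (R := ℝ) (b := (extChartAt 𝓘(ℝ, E) x₀).symm p.1) hb p.2
    simp only [chartVec, Function.comp]
    refine tangent_ext rfl _ _ ?_
    exact (DFunLike.congr_fun h3 p.2).symm.trans h4

theorem bijective_chartDeriv {x₀ : M} {q : E} (hq : q ∈ (extChartAt 𝓘(ℝ, E) x₀).target) :
    Function.Bijective (chartDeriv (E := E) x₀ q) := by
  have h := isInvertible_mfderivWithin_extChartAt_symm (I := 𝓘(ℝ, E)) hq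
  simp only [modelWithCornersSelf_coe, range_id, mfderivWithin_univ] at h
  exact h.bijective

theorem exists_chartVec {x₀ : M} (v : TangentBundle 𝓘(ℝ, E) M)
    (hv : v.1 ∈ (chartAt E x₀).source) :
    ∃ w : E, v = chartVec x₀ (extChartAt 𝓘(ℝ, E) x₀ v.1) w := by
  obtain ⟨x, v⟩ := v
  have hx : x ∈ (extChartAt 𝓘(ℝ, E) x₀).source := by rwa [extChartAt_source]
  obtain ⟨w, hw⟩ := (bijective_chartDeriv ((extChartAt 𝓘(ℝ, E) x₀).map_source hx)).2 v
  exact ⟨w, tangent_ext ((extChartAt 𝓘(ℝ, E) x₀).left_inv hx).symm _ _ hw.symm⟩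

theorem velocity_congr {γ γ' : ℝ → M} {t : ℝ} (h : γ =ᶠ[𝓝 t] γ') :
    velocity E γ t = velocity E γ' t := by
  refine tangent_ext h.eq_of_nhds _ _ ?_
  exact DFunLike.congr_fun h.mfderiv_eq (1 : ℝ)

theorem velocity_eq_chartVec {γ : ℝ → M} {t : ℝ} {x₀ : M} (hc : ContinuousAt γ t)
    (hx : γ t ∈ (chartAt E x₀).source) :
    velocity E γ t = chartVec x₀ (extChartAt 𝓘(ℝ, E) x₀ (γ t))
      (deriv (fun r => extChartAt 𝓘(ℝ, E) x₀ (γ r)) t) := by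
  have hx' : γ t ∈ (extChartAt 𝓘(ℝ, E) x₀).source := by rwa [extChartAt_source]
  have htgt := (extChartAt 𝓘(ℝ, E) x₀).map_source hx'
  have hev : γ =ᶠ[𝓝 t] (extChartAt 𝓘(ℝ, E) x₀).symm ∘ (fun r => extChartAt 𝓘(ℝ, E) x₀ (γ r)) := by
    have : ∀ᶠ r in 𝓝 t, γ r ∈ (extChartAt 𝓘(ℝ, E) x₀).source :=
      hc.eventually_mem ((isOpen_extChartAt_source x₀).mem_nhds hx')
    filter_upwards [this] with r hr
    exact ((extChartAt 𝓘(ℝ, E) x₀).left_inv hr).symm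
  have hsymm := mdifferentiableAt_chart_symm htgt
  by_cases hd : DifferentiableAt ℝ (fun r => extChartAt 𝓘(ℝ, E) x₀ (γ r)) t
  · rw [velocity_congr hev]
    refine tangent_ext rfl _ _ ?_
    refine (mfderiv_comp_apply t hsymm hd.mdifferentiableAt (1 : ℝ)).trans ?_
    rw [mfderiv_eq_fderiv]
    rfl
  -- Without differentiability both derivatives take the default value `0`, and the formula
  -- persists.
  · have hnd : ¬ MDifferentiableAt 𝓘(ℝ, ℝ) 𝓘(ℝ, E) γ t := fun h => hd
      (((mdifferentiableAt_extChartAt hx).comp t h).differentiableAt)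
    refine tangent_ext ((extChartAt 𝓘(ℝ, E) x₀).left_inv hx').symm _ _ ?_
    rw [deriv_zero_of_not_differentiableAt hd, mfderiv_zero_of_not_mdifferentiableAt hnd]
    exact (map_zero (chartDeriv x₀ _)).symm

theorem lagrangian_velocity {γ : ℝ → M} {t : ℝ} {x₀ : M} (hc : ContinuousAt γ t)
    (hx : γ t ∈ (chartAt E x₀).source) :
    L (velocity E γ t) t = chartLagrangian L x₀ (extChartAt 𝓘(ℝ, E) x₀ (γ t))
      (deriv (fun r => extChartAt 𝓘(ℝ, E) x₀ (γ r)) t) t := by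
  rw [velocity_eq_chartVec hc hx]; rfl

namespace IsPeriodicTonelli

theorem continuous (hL : IsPeriodicTonelli L) :
    Continuous (fun p : TangentBundle 𝓘(ℝ, E) M × ℝ => L p.1 p.2) :=
  hL.smooth.continuous

theorem continuousOn_chartLagrangian (hL : IsPeriodicTonelli L) (x₀ : M) :
    ContinuousOn (fun p : E × E × ℝ => chartLagrangian L x₀ p.1 p.2.1 p.2.2)
      ((extChartAt 𝓘(ℝ, E) x₀).target ×ˢ univ) := by
  refine hL.continuous.comp_continuousOn
    (f := fun p : E × E × ℝ => (chartVec x₀ p.1 p.2.1, p.2.2)) ?_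
  refine ContinuousOn.prodMk ?_ (by fun_prop)
  exact (continuousOn_chartVec x₀).comp (f := fun p : E × E × ℝ => (p.1, p.2.1)) (by fun_prop)
    fun p hp => ⟨hp.1, mem_univ _⟩

theorem add_int (hL : IsPeriodicTonelli L) (v : TangentBundle 𝓘(ℝ, E) M) (t : ℝ) (n : ℤ) :
    L v (t + n) = L v t := by
  have h : Function.Periodic (L v) 1 := hL.periodic v
  simpa using h.int_mul n t

theorem fract (hL : IsPeriodicTonelli L) (v : TangentBundle 𝓘(ℝ, E) M) (t : ℝ) :
    L v (Int.fract t) = L v t := by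
  conv_rhs => rw [← Int.fract_add_floor t, hL.add_int]

/-- The inclusion of the fibre over `x` into `TM` is linear in the trivialization at `x`, hence
smooth. -/
theorem contDiff_fiber (hL : IsPeriodicTonelli L) (x : M) (t : ℝ) :
    ContDiff ℝ ∞ (fiberLagrangian L x t) := by
  rw [← contMDiff_iff_contDiff]
  refine hL.smooth.comp
    (f := fun v : E => ((⟨x, v⟩ : TangentBundle 𝓘(ℝ, E) M), t)) ?_
  refine ContMDiff.prodMk ?_ contMDiff_const
  intro v
  refine Bundle.contMDiffAt_totalSpace.2 ?_
  refine ⟨contMDiffAt_const, ?_⟩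
  let e := trivializationAt E (TangentSpace 𝓘(ℝ, E) (M := M)) x
  let A : E →L[ℝ] E := e.continuousLinearMapAt ℝ x
  refine A.contDiff.contMDiff.contMDiffAt.congr_of_eventuallyEq (Eventually.of_forall fun w => ?_)
  exact (e.continuousLinearMapAt_apply_of_mem (R := ℝ)
    (FiberBundle.mem_baseSet_trivializationAt' x) w).symm

theorem hasDerivAt_line (hL : IsPeriodicTonelli L) (x : M) (t : ℝ) (v w : E) (s : ℝ) :
    HasDerivAt (fun r : ℝ => fiberLagrangian L x t (v + r • w))
      (fderiv ℝ (fiberLagrangian L x t) (v + s • w) w) s := by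
  have h1 : HasDerivAt (fun r : ℝ => v + r • w) w s := by
    simpa using ((hasDerivAt_id s).smul_const w).const_add v
  exact ((hL.contDiff_fiber x t).differentiable (by simp) _).hasFDerivAt.comp_hasDerivAt s h1

theorem convexOn_line (hL : IsPeriodicTonelli L) (x : M) (t : ℝ) (v w : E) :
    ConvexOn ℝ univ (fun r : ℝ => fiberLagrangian L x t (v + r • w)) := by
  have hd : deriv (fun r : ℝ => fiberLagrangian L x t (v + r • w)) =
      fun s => fderiv ℝ (fiberLagrangian L x t) (v + s • w) w :=
    funext fun s => (hL.hasDerivAt_line x t v w s).deriv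
  have hd2 : ∀ s, HasDerivAt (fun s : ℝ => fderiv ℝ (fiberLagrangian L x t) (v + s • w) w)
      (fderiv ℝ (fderiv ℝ (fiberLagrangian L x t)) (v + s • w) w w) s := fun s => by
    have h1 : HasDerivAt (fun r : ℝ => v + r • w) w s := by
      simpa using ((hasDerivAt_id s).smul_const w).const_add v
    have h2 : ContDiff ℝ 1 (fderiv ℝ (fiberLagrangian L x t)) :=
      (hL.contDiff_fiber x t).fderiv_right (by norm_cast)
    have h3 := (h2.differentiable (by simp) (v + s • w)).hasFDerivAt.comp_hasDerivAt s h1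
    exact h3.clm_apply (hasDerivAt_const s w) |>.congr_deriv (by simp)
  refine convexOn_of_deriv2_nonneg' convex_univ
    (fun s _ => (hL.hasDerivAt_line x t v w s).differentiableAt.differentiableWithinAt) ?_ ?_
  · rw [hd]; exact fun s _ => (hd2 s).differentiableAt.differentiableWithinAt
  · intro s _
    rw [Function.iterate_succ, Function.iterate_one, Function.comp, hd, (hd2 s).deriv]
    rcases eq_or_ne w 0 with rfl | hw
    · simp
    · exact (hL.convex x t _ w hw).le

theorem chartLagrangian_convex (hL : IsPeriodicTonelli L) (x₀ : M) (q : E) (t : ℝ) (v w : E)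
    {r : ℝ} (h0 : 0 ≤ r) (h1 : r ≤ 1) :
    chartLagrangian L x₀ q (v + r • w) t ≤
      (1 - r) * chartLagrangian L x₀ q v t + r * chartLagrangian L x₀ q (v + w) t := by
  have h := (hL.convexOn_line ((extChartAt 𝓘(ℝ, E) x₀).symm q) t
    (chartDeriv x₀ q v)
    (chartDeriv x₀ q w)).2 (mem_univ 0) (mem_univ 1)
    (sub_nonneg.2 h1) h0 (by ring)
  simp only [smul_eq_mul, mul_zero, mul_one, zero_add, zero_smul, add_zero, one_smul] at h
  simp only [chartLagrangian_eq_fiber]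
  rw [map_add, map_add, map_smul]
  exact h

theorem exists_subgradient (hL : IsPeriodicTonelli L) (x₀ : M) (q : E) (t : ℝ) (v : E) :
    ∃ p : E →L[ℝ] ℝ, ∀ w, chartLagrangian L x₀ q v t + p w ≤
      chartLagrangian L x₀ q (v + w) t := by
  refine ⟨(fderiv ℝ (fiberLagrangian L ((extChartAt 𝓘(ℝ, E) x₀).symm q) t)
    (chartDeriv x₀ q v)).comp
    (chartDeriv x₀ q), fun w => ?_⟩
  have h := (hL.convexOn_line ((extChartAt 𝓘(ℝ, E) x₀).symm q) t
    (chartDeriv x₀ q v)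
    (chartDeriv x₀ q w)).le_slope_of_hasDerivAt
      (mem_univ 0) (mem_univ 1) one_pos (hL.hasDerivAt_line _ _ _ _ 0)
  simp only [slope_def_field, zero_smul, add_zero, one_smul, sub_zero, div_one] at h
  simp only [chartLagrangian_eq_fiber]
  rw [map_add]
  exact (le_sub_iff_add_le').1 h

/-- Near a point, the Lagrangian lies above the supporting affine function of its fibre at that
point, up to an error growing at most linearly with the velocity. -/
theorem exists_affine_minorant [FiniteDimensional ℝ E] (hL : IsPeriodicTonelli L) {x₀ : M} {q₀ : E}
    (hq : q₀ ∈ (extChartAt 𝓘(ℝ, E) x₀).target) (w₀ : E) (t₀ : ℝ) :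
    ∃ p : E →L[ℝ] ℝ, ∀ ε > 0, ∃ δ > 0, ∀ q τ, ‖q - q₀‖ < δ → |τ - t₀| < δ →
      ∀ v, chartLagrangian L x₀ q₀ w₀ t₀ + p (v - w₀) - ε * (1 + ‖v - w₀‖) ≤
        chartLagrangian L x₀ q v τ := by
  obtain ⟨p, hp⟩ := hL.exists_subgradient x₀ q₀ t₀ w₀
  refine ⟨p, fun ε hε => ?_⟩
  -- By compactness of the unit ball around `w₀`, the Lagrangian varies there by less than `ε / 2`
  -- when position and time move slightly. This settles `‖v - w₀‖ ≤ 1`.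
  have key : ∀ᶠ z in 𝓝 (q₀, t₀), ∀ v ∈ Metric.closedBall w₀ 1,
      |chartLagrangian L x₀ z.1 v z.2 - chartLagrangian L x₀ q₀ v t₀| < ε / 2 := by
    refine (isCompact_closedBall w₀ 1).eventually_forall_of_forall_eventually
      (P := fun (z : E × ℝ) v =>
        |chartLagrangian L x₀ z.1 v z.2 - chartLagrangian L x₀ q₀ v t₀| < ε / 2)
      fun v _ => ?_
    have hopen : IsOpen ((extChartAt 𝓘(ℝ, E) x₀).target ×ˢ (univ : Set (E × ℝ))) :=
      (isOpen_chart_target x₀).prod isOpen_univ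
    have hcont : ∀ t, ContinuousAt (fun p : E × E × ℝ => chartLagrangian L x₀ p.1 p.2.1 p.2.2)
        (q₀, v, t) := fun t =>
      (hL.continuousOn_chartLagrangian x₀).continuousAt (hopen.mem_nhds ⟨hq, mem_univ _⟩)
    have c1 : ContinuousAt (fun z : (E × ℝ) × E => chartLagrangian L x₀ z.1.1 z.2 z.1.2)
        ((q₀, t₀), v) :=
      ContinuousAt.comp (f := fun z : (E × ℝ) × E => (z.1.1, z.2, z.1.2))
        (x := ((q₀, t₀), v)) (hcont t₀) (by fun_prop)
    have c2 : ContinuousAt (fun z : (E × ℝ) × E => chartLagrangian L x₀ q₀ z.2 t₀)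
        ((q₀, t₀), v) :=
      ContinuousAt.comp (f := fun z : (E × ℝ) × E => (q₀, z.2, t₀))
        (x := ((q₀, t₀), v)) (hcont t₀) (by fun_prop)
    have c3 := (c1.sub c2).abs
    refine c3.eventually_lt_const ?_
    simpa using half_pos hε
  obtain ⟨δ, hδ, hball⟩ := Metric.eventually_nhds_iff.1 key
  refine ⟨δ, hδ, fun q τ hq' hτ v => ?_⟩
  have hb := @hball (q, τ) (by
    rw [Prod.dist_eq, dist_eq_norm, Real.dist_eq]; exact max_lt hq' hτ)
  simp only at hb
  rcases le_or_gt ‖v - w₀‖ 1 with hv | hv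
  · have h1 := abs_lt.1 (hb v (by rwa [Metric.mem_closedBall, dist_eq_norm]))
    have h2 := hp (v - w₀)
    rw [add_sub_cancel] at h2
    have h3 : ε ≤ ε * (1 + ‖v - w₀‖) := by nlinarith [norm_nonneg (v - w₀)]
    linarith [h1.1]
  -- Far from `w₀`, convexity on the segment from `w₀` to `v` bounds the value at `v` from below by
  -- extrapolating the values at `w₀` and at distance `1` from it. Their errors of `ε / 2` are
  -- multiplied by `r - 1` and `r`, so they sum to at most `ε * r`.
  · set r := ‖v - w₀‖ with hr
    have hr0 : 0 < r := one_pos.trans hv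
    have h1 := abs_lt.1 (hb (w₀ + r⁻¹ • (v - w₀)) (by
      rw [Metric.mem_closedBall, dist_eq_norm, add_sub_cancel_left, norm_smul, norm_inv, norm_norm,
        inv_mul_cancel₀ hr0.ne']))
    have h2 := hp (r⁻¹ • (v - w₀))
    rw [map_smul, smul_eq_mul] at h2
    have h3 := hL.chartLagrangian_convex x₀ q τ w₀ (v - w₀) (inv_nonneg.2 hr0.le)
      (inv_le_one_of_one_le₀ hv.le)
    rw [add_sub_cancel] at h3
    have h4 := abs_lt.1 (hb w₀ (by simp))
    have h5 : r * (chartLagrangian L x₀ q₀ w₀ t₀ + r⁻¹ * p (v - w₀)) ≤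
        r * ((1 - r⁻¹) * chartLagrangian L x₀ q w₀ τ + r⁻¹ * chartLagrangian L x₀ q v τ + ε / 2) :=
      mul_le_mul_of_nonneg_left (by linarith [h1.1]) hr0.le
    have h6 : r * r⁻¹ = 1 := mul_inv_cancel₀ hr0.ne'
    have h7 : r * (chartLagrangian L x₀ q₀ w₀ t₀ + r⁻¹ * p (v - w₀)) =
        r * chartLagrangian L x₀ q₀ w₀ t₀ + p (v - w₀) := by
      linear_combination p (v - w₀) * h6
    have h8 : r * ((1 - r⁻¹) * chartLagrangian L x₀ q w₀ τ + r⁻¹ * chartLagrangian L x₀ q v τ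
        + ε / 2) = (r - 1) * chartLagrangian L x₀ q w₀ τ + chartLagrangian L x₀ q v τ
        + r * (ε / 2) := by
      linear_combination (chartLagrangian L x₀ q v τ - chartLagrangian L x₀ q w₀ τ) * h6
    rw [h7, h8] at h5
    have h9 : (r - 1) * chartLagrangian L x₀ q w₀ τ ≤
        (r - 1) * (chartLagrangian L x₀ q₀ w₀ t₀ + ε / 2) :=
      mul_le_mul_of_nonneg_left (by linarith [h4.2]) (by linarith)
    nlinarith

end IsPeriodicTonelli

end Chart

/-- A property of intervals that is additive and holds for all short intervals holds for every
compact interval. -/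
theorem interval_induction {P : ℝ → ℝ → Prop} {a b : ℝ} (hab : a ≤ b)
    (hadd : ∀ c d e, a ≤ c → c ≤ d → d ≤ e → e ≤ b → P c d → P d e → P c e)
    (hloc : ∀ t ∈ Icc a b, ∃ δ > 0, ∀ c d, a ≤ c → c ≤ d → d ≤ b → |c - t| < δ → |d - t| < δ →
      P c d) : P a b := by
  choose! δ hδ hP using hloc
  obtain ⟨t, ht0, hmono, ⟨m, hm⟩, hsub⟩ := exists_monotone_Icc_subset_open_cover_Icc hab
    (c := fun s : Icc a b => {r : Icc a b | |(r : ℝ) - s| < δ s})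
    (fun s => isOpen_lt (by fun_prop) continuous_const)
    (fun r _ => mem_iUnion.2 ⟨r, by simpa using hδ r r.2⟩)
  have hstep : ∀ n, P (t n) (t (n + 1)) := fun n => by
    obtain ⟨s, hs⟩ := hsub n
    have hle : t n ≤ t (n + 1) := hmono n.le_succ
    exact hP s s.2 _ _ (t n).2.1 hle (t (n + 1)).2.2 (hs ⟨le_rfl, hle⟩) (hs ⟨hle, le_rfl⟩)
  have hall : ∀ n, P (t 0) (t n) := fun n => by
    induction n with
    | zero =>
      have := hδ _ (t 0).2
      exact hP _ (t 0).2 _ _ (t 0).2.1 le_rfl (t 0).2.2 (by simpa using this) (by simpa using this)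
    | succ n ih =>
      exact hadd _ _ _ (t 0).2.1 (hmono n.zero_le) (hmono n.le_succ) (t (n + 1)).2.2 ih (hstep n)
  have := hall m
  rwa [ht0, hm m le_rfl] at this

/-! ### Uniform bounds in charts and measurability along curves -/

section Chart

variable {E : Type*} [NormedAddCommGroup E] [NormedSpace ℝ E] [FiniteDimensional ℝ E]
  {M : Type*} [TopologicalSpace M] [ChartedSpace E M] [IsManifold 𝓘(ℝ, E) ∞ M]
  {L : TangentBundle 𝓘(ℝ, E) M → ℝ → ℝ}

theorem continuous_metric (g : Bundle.ContMDiffRiemannianMetric 𝓘(ℝ, E) ∞ E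
      (fun x : M => TangentSpace 𝓘(ℝ, E) x)) :
    Continuous (fun v : TangentBundle 𝓘(ℝ, E) M => g.inner v.1 v.2 v.2) := by
  have hb : Continuous (fun v : TangentBundle 𝓘(ℝ, E) M => v.1) :=
    FiberBundle.continuous_proj E (TangentSpace 𝓘(ℝ, E) (M := M))
  have : Continuous (fun v : TangentBundle 𝓘(ℝ, E) M =>
      Bundle.TotalSpace.mk' ℝ (E := Bundle.Trivial M ℝ) v.1 (g.inner v.1 v.2 v.2)) :=
    (g.contMDiff.continuous.comp hb).clm_bundle_apply₂ (F₁ := E) (F₂ := E)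
      (E₁ := TangentSpace 𝓘(ℝ, E) (M := M)) (E₂ := TangentSpace 𝓘(ℝ, E) (M := M))
      (b := fun v : TangentBundle 𝓘(ℝ, E) M => v.1) (v := fun v : TangentBundle 𝓘(ℝ, E) M => v.2)
      (w := fun v : TangentBundle 𝓘(ℝ, E) M => v.2) continuous_id continuous_id
  rw [continuous_iff_continuousAt] at this ⊢
  intro v
  exact ((FiberBundle.continuousAt_totalSpace ℝ _).1 (this v)).2

namespace IsPeriodicTonelli

theorem chartLagrangian_fract (hL : IsPeriodicTonelli L) (x₀ : M) (q w : E) (t : ℝ) :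
    chartLagrangian L x₀ q w (Int.fract t) = chartLagrangian L x₀ q w t :=
  hL.fract _ t

/-- Periodicity confines the time to `[0, 1]`, so this is continuity on a compact set. -/
theorem bounded_on_compact (hL : IsPeriodicTonelli L) {x₀ : M} {K : Set E} (hK : IsCompact K)
    (hKt : K ⊆ (extChartAt 𝓘(ℝ, E) x₀).target) (R : ℝ) :
    ∃ C > 0, ∀ q ∈ K, ∀ w : E, ‖w‖ ≤ R → ∀ t, |chartLagrangian L x₀ q w t| ≤ C := by
  have hc : IsCompact (K ×ˢ (Metric.closedBall (0 : E) R ×ˢ Icc (0 : ℝ) 1)) :=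
    hK.prod ((isCompact_closedBall _ _).prod isCompact_Icc)
  obtain ⟨C, hC⟩ := hc.exists_bound_of_continuousOn ((hL.continuousOn_chartLagrangian x₀).mono
    (fun p hp => ⟨hKt hp.1, mem_univ _⟩))
  refine ⟨max C 1, by positivity, fun q hq w hw t => ?_⟩
  rw [← hL.chartLagrangian_fract]
  exact (hC (q, w, Int.fract t) ⟨hq, by simpa using hw, Int.fract_nonneg t,
    (Int.fract_lt_one t).le⟩).trans (le_max_left _ _)

/-- Over a compact set of positions the Riemannian norm dominates a multiple of the norm of `E`, so
superlinearity can be read in coordinates; the remaining bounded velocities go into the constant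
`R`. -/
theorem superlinear_chart (hL : IsPeriodicTonelli L) {x₀ : M} {S : Set E} (hS : IsCompact S)
    (hSt : S ⊆ (extChartAt 𝓘(ℝ, E) x₀).target) (K : ℝ) :
    ∃ R > 0, ∀ q ∈ S, ∀ (w : E) (t : ℝ), K * ‖w‖ ≤ chartLagrangian L x₀ q w t + R := by
  obtain ⟨g, hg⟩ := hL.superlinear
  let G : E × E → ℝ := fun p => g.inner (chartVec x₀ p.1 p.2).1 (chartVec x₀ p.1 p.2).2
    (chartVec x₀ p.1 p.2).2
  have hGc : ContinuousOn G ((extChartAt 𝓘(ℝ, E) x₀).target ×ˢ univ) :=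
    (continuous_metric g).comp_continuousOn (continuousOn_chartVec x₀)
  have hGpos : ∀ q ∈ S, ∀ w : E, w ≠ 0 → 0 < G (q, w) := fun q hq w hw => by
    refine g.pos _ _ fun h0 => hw ((bijective_chartDeriv (hSt hq)).1 ?_)
    rw [map_zero]
    exact h0
  have hGsmul : ∀ (q w : E) (r : ℝ), G (q, r • w) = r ^ 2 * G (q, w) := fun q w r => by
    have hB : ∀ (B : E →L[ℝ] E →L[ℝ] ℝ) (v : E), B (r • v) (r • v) = r ^ 2 * B v v := fun B v => by
      simp only [map_smul, smul_apply, smul_eq_mul]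
      ring
    let B : E →L[ℝ] E →L[ℝ] ℝ := g.inner ((extChartAt 𝓘(ℝ, E) x₀).symm q)
    have h2 : G (q, r • w) = B (chartDeriv x₀ q (r • w)) (chartDeriv x₀ q (r • w)) := rfl
    rw [h2, map_smul, hB]
    rfl
  -- The constant is the minimum of the Riemannian norm on `S` times the unit sphere, extended by
  -- homogeneity. That set is empty when `S` is empty or `E` is trivial.
  have hlow : ∃ a > 0, ∀ q ∈ S, ∀ w : E, a * ‖w‖ ≤ √(G (q, w)) := by
    rcases (S ×ˢ Metric.sphere (0 : E) 1).eq_empty_or_nonempty with he | hne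
    · refine ⟨1, one_pos, fun q hq w => ?_⟩
      rcases eq_or_ne w 0 with rfl | hw
      · simp
      · exfalso
        have : (q, ‖w‖⁻¹ • w) ∈ S ×ˢ Metric.sphere (0 : E) 1 :=
          ⟨hq, by simp [norm_smul, norm_ne_zero_iff.2 hw]⟩
        rw [he] at this
        exact this
    · obtain ⟨p, hp, hmin⟩ := (hS.prod (isCompact_sphere (0 : E) 1)).exists_isMinOn hne
        (hGc.mono fun p hp => ⟨hSt hp.1, mem_univ _⟩)
      have hp0 : 0 < G p := hGpos p.1 hp.1 p.2 (by
        have := hp.2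
        rw [mem_sphere_zero_iff_norm] at this
        exact norm_ne_zero_iff.1 (by rw [this]; exact one_ne_zero))
      refine ⟨√(G p), Real.sqrt_pos.2 hp0, fun q hq w => ?_⟩
      rcases eq_or_ne w 0 with rfl | hw
      · simp
      · have hm : G p ≤ G (q, ‖w‖⁻¹ • w) := isMinOn_iff.1 hmin (q, ‖w‖⁻¹ • w)
          ⟨hq, by simp [norm_smul, norm_ne_zero_iff.2 hw]⟩
        have hw' : 0 < ‖w‖ := norm_pos_iff.2 hw
        rw [hGsmul, inv_pow, ← div_eq_inv_mul, le_div_iff₀ (by positivity)] at hm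
        refine Real.le_sqrt_of_sq_le ?_
        rw [mul_pow, Real.sq_sqrt hp0.le]
        exact hm
  obtain ⟨a, ha, hlow⟩ := hlow
  obtain ⟨R', hR'⟩ := hg (|K| / a)
  obtain ⟨C, hC0, hC⟩ := hL.bounded_on_compact hS hSt (|R'| / a)
  refine ⟨|K| * (|R'| / a) + C, by positivity, fun q hq w t => ?_⟩
  have hKle : K * ‖w‖ ≤ |K| * ‖w‖ := by gcongr; exact le_abs_self K
  rcases le_or_gt R' (√(G (q, w))) with h | h
  · have h1 : |K| / a * √(G (q, w)) ≤ chartLagrangian L x₀ q w t :=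
      hR' (chartVec x₀ q w).1 (chartVec x₀ q w).2 t h
    have h2 : |K| * ‖w‖ ≤ |K| / a * √(G (q, w)) := by
      calc |K| * ‖w‖ = |K| / a * (a * ‖w‖) := by field_simp
        _ ≤ _ := by gcongr; exact hlow q hq w
    have : 0 ≤ |K| * (|R'| / a) := by positivity
    linarith
  · have hw : ‖w‖ ≤ |R'| / a := by
      rw [le_div_iff₀ ha, mul_comm]
      exact (hlow q hq w).trans (h.le.trans (le_abs_self _))
    have h1 := (abs_le.1 (hC q hq w hw t)).1
    have h2 : |K| * ‖w‖ ≤ |K| * (|R'| / a) := by gcongr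
    linarith

/-- Superlinearity with slope `0` is a lower bound over a chart ball, and finitely many such balls
cover `M`. -/
theorem exists_lower_bound [CompactSpace M] (hL : IsPeriodicTonelli L) :
    ∃ C > 0, ∀ v t, -C ≤ L v t := by
  have key : ∃ C > 0, ∀ v : TangentBundle 𝓘(ℝ, E) M, v.1 ∈ (univ : Set M) → ∀ t, -C ≤ L v t := by
    refine isCompact_univ.induction_on (p := fun s : Set M =>
      ∃ C > 0, ∀ v : TangentBundle 𝓘(ℝ, E) M, v.1 ∈ s → ∀ t, -C ≤ L v t)
      ⟨1, one_pos, fun v hv => hv.elim⟩ ?_ ?_ ?_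
    · rintro s t hst ⟨C, hC0, hC⟩
      exact ⟨C, hC0, fun v hv => hC v (hst hv)⟩
    · rintro s t ⟨C, hC0, hC⟩ ⟨C', hC0', hC'⟩
      refine ⟨max C C', lt_max_of_lt_left hC0, fun v hv r => ?_⟩
      rcases hv with hv | hv
      · exact (neg_le_neg (le_max_left _ _)).trans (hC v hv r)
      · exact (neg_le_neg (le_max_right _ _)).trans (hC' v hv r)
    · intro x _
      obtain ⟨r, hr, hball⟩ := Metric.nhds_basis_closedBall.mem_iff.1
        ((isOpen_chart_target (E := E) x).mem_nhds (mem_extChartAt_target x))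
      obtain ⟨R, hR0, hR⟩ := hL.superlinear_chart
        (isCompact_closedBall (extChartAt 𝓘(ℝ, E) x x) r) hball 0
      refine ⟨(chartAt E x).source ∩
        extChartAt 𝓘(ℝ, E) x ⁻¹' Metric.closedBall (extChartAt 𝓘(ℝ, E) x x) r, ?_, R, hR0, ?_⟩
      · rw [nhdsWithin_univ]
        exact inter_mem ((chartAt E x).open_source.mem_nhds (mem_chart_source E x))
          ((continuousAt_extChartAt x).preimage_mem_nhds (Metric.closedBall_mem_nhds _ hr))
      · intro v hv t
        obtain ⟨w, hw⟩ := exists_chartVec v hv.1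
        have := hR _ hv.2 w t
        rw [hw, ← chartLagrangian_eq (L := L)]
        linarith
  obtain ⟨C, hC0, hC⟩ := key
  exact ⟨C, hC0, fun v t => hC v (mem_univ _) t⟩

theorem aestronglyMeasurable_chart (hL : IsPeriodicTonelli L) {x₀ : M} {q : ℝ → E} {c d : ℝ}
    (hq : ContinuousOn q (Ioo c d)) (hqt : ∀ t ∈ Ioo c d, q t ∈ (extChartAt 𝓘(ℝ, E) x₀).target) :
    AEStronglyMeasurable (fun t => chartLagrangian L x₀ (q t) (deriv q t) t)
      (volume.restrict (Ioo c d)) := by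
  classical
  borelize E
  -- The chart Lagrangian is known to be continuous only over the chart target; extension by `0`
  -- makes it a measurable function on the whole space.
  have hm : Measurable (((extChartAt 𝓘(ℝ, E) x₀).target ×ˢ (univ : Set (E × ℝ))).piecewise
      (fun p : E × E × ℝ => chartLagrangian L x₀ p.1 p.2.1 p.2.2) (fun _ => 0)) :=
    (hL.continuousOn_chartLagrangian x₀).measurable_piecewise continuousOn_const
      (((isOpen_chart_target x₀).prod isOpen_univ).measurableSet)
  have hqm : AEMeasurable q (volume.restrict (Ioo c d)) := hq.aemeasurable measurableSet_Ioo
  have h1 : AEMeasurable (fun t => (q t, deriv q t, t)) (volume.restrict (Ioo c d)) :=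
    hqm.prodMk ((measurable_deriv q).aemeasurable.prodMk measurable_id.aemeasurable)
  refine ((hm.comp_aemeasurable h1).congr ?_).aestronglyMeasurable
  refine (ae_restrict_iff' measurableSet_Ioo).2 (Eventually.of_forall fun t ht => ?_)
  exact piecewise_eq_of_mem _ _ _ ⟨hqt t ht, mem_univ _⟩

end IsPeriodicTonelli

/-- The Lagrangian along a curve. -/
def lagrangianAlong (L : TangentBundle 𝓘(ℝ, E) M → ℝ → ℝ) (γ : ℝ → M) (t : ℝ) : ℝ :=
  L (velocity E γ t) t

theorem exists_short_chart {γ : ℝ → M} {a b : ℝ} (hγ : ContinuousOn γ (Icc a b)) {t : ℝ}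
    (ht : t ∈ Icc a b) {U : Set M} (hU : U ∈ 𝓝 (γ t)) :
    ∃ δ > 0, ∀ c d, a ≤ c → c ≤ d → d ≤ b → |c - t| < δ → |d - t| < δ →
      MapsTo γ (Icc c d) U := by
  obtain ⟨δ, hδ, h⟩ := Metric.mem_nhdsWithin_iff.1 (hγ t ht hU)
  refine ⟨δ, hδ, fun c d hac _ hdb hc hd r hr => ?_⟩
  refine h ⟨?_, hac.trans hr.1, hr.2.trans hdb⟩
  rw [Metric.mem_ball, Real.dist_eq, abs_lt]
  rw [abs_lt] at hc hd
  constructor <;> linarith [hr.1, hr.2, hc.1, hd.2]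

theorem continuousAt_of_mem_Ioo {γ : ℝ → M} {a b t : ℝ} (hγ : ContinuousOn γ (Icc a b))
    (ht : t ∈ Ioo a b) : ContinuousAt γ t :=
  hγ.continuousAt (Icc_mem_nhds ht.1 ht.2)

theorem IsPeriodicTonelli.aestronglyMeasurable_along (hL : IsPeriodicTonelli L) {γ : ℝ → M}
    {a b : ℝ} (hab : a ≤ b) (hγ : ContinuousOn γ (Icc a b)) :
    AEStronglyMeasurable (lagrangianAlong L γ) (volume.restrict (Ioc a b)) := by
  refine interval_induction (P := fun c d =>
    AEStronglyMeasurable (lagrangianAlong L γ) (volume.restrict (Ioc c d))) hab ?_ ?_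
  · intro c d e _ hcd hde _ h1 h2
    rw [← Ioc_union_Ioc_eq_Ioc hcd hde]
    exact aestronglyMeasurable_union_iff.2 ⟨h1, h2⟩
  · intro t ht
    obtain ⟨δ, hδ, h⟩ := exists_short_chart hγ ht
      ((chartAt E (γ t)).open_source.mem_nhds (mem_chart_source E (γ t)))
    refine ⟨δ, hδ, fun c d hac hcd hdb hc hd => ?_⟩
    have hmaps := h c d hac hcd hdb hc hd
    have hcont : ContinuousOn γ (Icc c d) := hγ.mono (Icc_subset_Icc hac hdb)
    rw [restrict_Ioc_eq_restrict_Icc, ← restrict_Ioo_eq_restrict_Icc]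
    refine (hL.aestronglyMeasurable_chart (x₀ := γ t)
      (q := fun r => extChartAt 𝓘(ℝ, E) (γ t) (γ r)) (c := c) (d := d) ?_ ?_).congr ?_
    · refine (continuousOn_extChartAt (γ t)).comp (hcont.mono Ioo_subset_Icc_self) fun r hr => ?_
      rw [extChartAt_source]
      exact hmaps (Ioo_subset_Icc_self hr)
    · intro r hr
      refine (extChartAt 𝓘(ℝ, E) (γ t)).map_source ?_
      rw [extChartAt_source]
      exact hmaps (Ioo_subset_Icc_self hr)
    · refine (ae_restrict_iff' measurableSet_Ioo).2 (Eventually.of_forall fun r hr => ?_)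
      exact (lagrangian_velocity (continuousAt_of_mem_Ioo hcont hr)
        (hmaps (Ioo_subset_Icc_self hr))).symm

end Chart

/-! ### Curves of finite action: gluing, time translation, connecting points -/

section Curves

variable {E : Type*} [NormedAddCommGroup E] [NormedSpace ℝ E] [FiniteDimensional ℝ E]
  {M : Type*} [TopologicalSpace M] [ChartedSpace E M] [IsManifold 𝓘(ℝ, E) ∞ M]
  {L : TangentBundle 𝓘(ℝ, E) M → ℝ → ℝ}

/-- Absolutely continuous curves of finite action. -/
structure Admissible (L : TangentBundle 𝓘(ℝ, E) M → ℝ → ℝ) (γ : ℝ → M) (a b : ℝ) : Prop where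
  le : a ≤ b
  ac : IsACCurve E γ a b
  integrable : IntervalIntegrable (lagrangianAlong L γ) volume a b

theorem IsACCurve.mono {γ : ℝ → M} {a b c d : ℝ} (h : IsACCurve E γ a b) (hac : a ≤ c)
    (hdb : d ≤ b) : IsACCurve E γ c d :=
  ⟨h.1.mono (Icc_subset_Icc hac hdb), fun x₀ c' d' h1 h2 h3 h4 =>
    h.2 x₀ c' d' (hac.trans h1) h2 (h3.trans hdb) h4⟩

theorem Admissible.mono {γ : ℝ → M} {a b c d : ℝ} (h : Admissible L γ a b) (hac : a ≤ c)
    (hcd : c ≤ d) (hdb : d ≤ b) : Admissible L γ c d :=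
  ⟨hcd, h.ac.mono hac hdb, h.integrable.mono_set (by
    rw [uIcc_of_le hcd, uIcc_of_le (hac.trans (hcd.trans hdb))]
    exact Icc_subset_Icc hac hdb)⟩

theorem Admissible.integral_add {γ : ℝ → M} {a b c : ℝ} (h : Admissible L γ a c) (hab : a ≤ b)
    (hbc : b ≤ c) : (∫ t in a..b, lagrangianAlong L γ t) + ∫ t in b..c, lagrangianAlong L γ t =
      ∫ t in a..c, lagrangianAlong L γ t :=
  intervalIntegral.integral_add_adjacent_intervals (h.mono le_rfl hab hbc).integrable
    (h.mono hab hbc le_rfl).integrable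

theorem IsACCurve.union {γ : ℝ → M} {a b c : ℝ} (hab : a ≤ b) (hbc : b ≤ c)
    (h1 : IsACCurve E γ a b) (h2 : IsACCurve E γ b c) : IsACCurve E γ a c := by
  refine ⟨?_, fun x₀ c' d' hc' hcd hd' hmaps => ?_⟩
  · rw [← Icc_union_Icc_eq_Icc hab hbc]
    exact h1.1.union_of_isClosed h2.1 isClosed_Icc isClosed_Icc
  · rcases le_total d' b with h | h
    · exact h1.2 x₀ c' d' hc' hcd h hmaps
    rcases le_total b c' with h' | h'
    · exact h2.2 x₀ c' d' h' hcd hd' hmaps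
    · exact ac_union h' h (h1.2 x₀ c' b hc' h' le_rfl (hmaps.mono_left (Icc_subset_Icc_right h)))
        (h2.2 x₀ b d' le_rfl h hd' (hmaps.mono_left (Icc_subset_Icc_left h')))

theorem Admissible.union {γ : ℝ → M} {a b c : ℝ} (h1 : Admissible L γ a b)
    (h2 : Admissible L γ b c) : Admissible L γ a c :=
  ⟨h1.le.trans h2.le, h1.ac.union h1.le h2.le h2.ac, h1.integrable.trans h2.integrable⟩

theorem IsACCurve.congr {γ γ' : ℝ → M} {a b : ℝ} (h : IsACCurve E γ a b)
    (heq : EqOn γ γ' (Icc a b)) : IsACCurve E γ' a b := by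
  refine ⟨h.1.congr heq.symm, fun x₀ c d hac hcd hdb hmaps => ?_⟩
  have hsub : Icc c d ⊆ Icc a b := Icc_subset_Icc hac hdb
  refine ac_of_dist_le (C := 1) (h.2 x₀ c d hac hcd hdb fun t ht => ?_) fun s hs t ht => ?_
  · rw [heq (hsub ht)]; exact hmaps ht
  · rw [uIcc_of_le hcd] at hs ht
    simp only [heq (hsub hs), heq (hsub ht), one_mul, le_refl]

theorem lagrangianAlong_congr {γ γ' : ℝ → M} {a b : ℝ} (heq : EqOn γ γ' (Icc a b)) :
    EqOn (lagrangianAlong L γ) (lagrangianAlong L γ') (Ioo a b) := fun t ht => by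
  unfold lagrangianAlong
  rw [velocity_congr (heq.eventuallyEq_of_mem (Icc_mem_nhds ht.1 ht.2))]

theorem Admissible.congr {γ γ' : ℝ → M} {a b : ℝ} (h : Admissible L γ a b)
    (heq : EqOn γ γ' (Icc a b)) : Admissible L γ' a b := by
  refine ⟨h.le, h.ac.congr heq, ?_⟩
  refine h.integrable.congr_uIoo ?_
  rw [uIoo_of_le h.le]
  exact lagrangianAlong_congr heq

theorem integral_congr_curve {γ γ' : ℝ → M} {a b : ℝ} (hab : a ≤ b)
    (heq : EqOn γ γ' (Icc a b)) :
    ∫ t in a..b, lagrangianAlong L γ t = ∫ t in a..b, lagrangianAlong L γ' t := by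
  refine intervalIntegral.integral_congr_uIoo ?_
  rw [uIoo_of_le hab]
  exact lagrangianAlong_congr heq

theorem velocity_comp_sub (γ : ℝ → M) (r t : ℝ) :
    velocity E (fun τ => γ (τ - r)) t = velocity E γ (t - r) := by
  have hsub : ∀ (r t : ℝ), MDifferentiableAt 𝓘(ℝ, ℝ) 𝓘(ℝ, ℝ) (fun τ : ℝ => τ - r) t := fun r t =>
    (differentiableAt_id.sub_const r).mdifferentiableAt
  refine tangent_ext rfl _ _ ?_
  by_cases h : MDifferentiableAt 𝓘(ℝ, ℝ) 𝓘(ℝ, E) γ (t - r)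
  · refine (mfderiv_comp_apply (f := fun τ : ℝ => τ - r) (g := γ) t h (hsub r t) (1 : ℝ)).trans ?_
    rw [mfderiv_eq_fderiv]
    have : (fderiv ℝ (fun τ : ℝ => τ - r) t) 1 = 1 := by
      rw [fderiv_apply_one_eq_deriv]; simp
    exact congrArg (mfderiv 𝓘(ℝ, ℝ) 𝓘(ℝ, E) γ (t - r)) this
  · have h' : ¬ MDifferentiableAt 𝓘(ℝ, ℝ) 𝓘(ℝ, E) (fun τ => γ (τ - r)) t := fun hd => h (by
      have e : t = (t - r) - (-r) := by ring
      rw [e] at hd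
      have := MDifferentiableAt.comp (f := fun τ : ℝ => τ - (-r)) (t - r) hd (hsub (-r) (t - r))
      simpa [Function.comp_def] using this)
    rw [mfderiv_zero_of_not_mdifferentiableAt h, mfderiv_zero_of_not_mdifferentiableAt h']
    rfl

theorem IsPeriodicTonelli.lagrangianAlong_comp_sub (hL : IsPeriodicTonelli L) (γ : ℝ → M) (n : ℤ)
    (t : ℝ) : lagrangianAlong L (fun τ => γ (τ - n)) t = lagrangianAlong L γ (t - n) := by
  unfold lagrangianAlong
  rw [velocity_comp_sub]
  have := hL.add_int (velocity E γ (t - n)) (t - n) n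
  rwa [sub_add_cancel] at this

theorem IsPeriodicTonelli.admissible_comp_sub (hL : IsPeriodicTonelli L) {γ : ℝ → M} {a b : ℝ}
    (h : Admissible L γ a b) (n : ℤ) :
    Admissible L (fun τ => γ (τ - n)) (a + n) (b + n) ∧
      ∫ t in (a + n)..(b + n), lagrangianAlong L (fun τ => γ (τ - n)) t =
        ∫ t in a..b, lagrangianAlong L γ t := by
  have hfun : lagrangianAlong L (fun τ => γ (τ - n)) = fun t => lagrangianAlong L γ (t - n) :=
    funext fun t => hL.lagrangianAlong_comp_sub γ n t
  have hmaps : ∀ c d : ℝ, MapsTo (fun τ : ℝ => τ - n) (Icc (c + n) (d + n)) (Icc c d) :=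
    fun c d t ht => ⟨by linarith [ht.1], by linarith [ht.2]⟩
  refine ⟨⟨by linarith [h.le], ⟨h.ac.1.comp (by fun_prop) (hmaps a b),
    fun x₀ c d hac hcd hdb hm => ?_⟩, ?_⟩, ?_⟩
  · have := ac_comp_sub (n : ℝ) (h.ac.2 x₀ (c - n) (d - n) (by linarith) (by linarith) (by linarith)
      fun t ht => by
        have := @hm (t + n) ⟨by linarith [ht.1], by linarith [ht.2]⟩
        simpa using this)
    simpa using this
  · rw [hfun]
    exact h.integrable.comp_sub_right n
  · rw [hfun, intervalIntegral.integral_comp_sub_right]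
    simp

/-- Some curve from `x` at time `s` to `y` at time `t` has action at most `A`. -/
def Connects (L : TangentBundle 𝓘(ℝ, E) M → ℝ → ℝ) (x : M) (s : ℝ) (y : M) (t A : ℝ) : Prop :=
  ∃ γ : ℝ → M, Admissible L γ s t ∧ γ s = x ∧ γ t = y ∧ ∫ τ in s..t, lagrangianAlong L γ τ ≤ A

theorem Connects.le {x y : M} {s t A : ℝ} (h : Connects L x s y t A) : s ≤ t :=
  h.choose_spec.1.le

theorem Connects.mono {x y : M} {s t A B : ℝ} (h : Connects L x s y t A) (hAB : A ≤ B) :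
    Connects L x s y t B :=
  let ⟨γ, h1, h2, h3, h4⟩ := h
  ⟨γ, h1, h2, h3, h4.trans hAB⟩

theorem Admissible.connects {γ : ℝ → M} {s t : ℝ} (h : Admissible L γ s t) :
    Connects L (γ s) s (γ t) t (∫ τ in s..t, lagrangianAlong L γ τ) :=
  ⟨γ, h, rfl, rfl, le_rfl⟩

theorem Connects.trans {x y z : M} {s t r A B : ℝ} (h1 : Connects L x s y t A)
    (h2 : Connects L y t z r B) : Connects L x s z r (A + B) := by
  classical
  obtain ⟨γ₁, a1, rfl, b1, c1⟩ := h1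
  obtain ⟨γ₂, a2, b2, rfl, c2⟩ := h2
  let γ : ℝ → M := fun τ => if τ ≤ t then γ₁ τ else γ₂ τ
  have e1 : EqOn γ₁ γ (Icc s t) := fun τ hτ => (if_pos hτ.2).symm
  have e2 : EqOn γ₂ γ (Icc t r) := fun τ hτ => by
    rcases hτ.1.eq_or_lt with h | h
    · subst h
      simp [γ, b1, b2]
    · exact (if_neg (not_le.2 h)).symm
  have hu := (a1.congr e1).union (a2.congr e2)
  refine ⟨γ, hu, (e1 ⟨le_rfl, a1.le⟩).symm, (e2 ⟨a2.le, le_rfl⟩).symm, ?_⟩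
  rw [← hu.integral_add a1.le a2.le, ← integral_congr_curve a1.le e1,
    ← integral_congr_curve a2.le e2]
  exact add_le_add c1 c2

theorem IsPeriodicTonelli.connects_add_int (hL : IsPeriodicTonelli L) {x y : M} {s t A : ℝ}
    (h : Connects L x s y t A) (n : ℤ) : Connects L x (s + n) y (t + n) A := by
  obtain ⟨γ, a, b, c, d⟩ := h
  obtain ⟨e, f⟩ := hL.admissible_comp_sub a n
  exact ⟨_, e, by simpa using b, by simpa using c, f.trans_le d⟩

/-- Segments in a chart. -/
theorem IsPeriodicTonelli.connects_segment (hL : IsPeriodicTonelli L) {x₀ : M} {S : Set E}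
    (hS : Convex ℝ S) (hSt : S ⊆ (extChartAt 𝓘(ℝ, E) x₀).target) {q₁ q₂ : E} (h1 : q₁ ∈ S)
    (h2 : q₂ ∈ S) {s t : ℝ} (hst : s < t) {C R : ℝ} (hR : ‖q₂ - q₁‖ ≤ R * (t - s))
    (hC : ∀ q ∈ S, ∀ w : E, ‖w‖ ≤ R → ∀ r, |chartLagrangian L x₀ q w r| ≤ C) :
    Connects L ((extChartAt 𝓘(ℝ, E) x₀).symm q₁) s ((extChartAt 𝓘(ℝ, E) x₀).symm q₂) t
      (C * (t - s)) := by
  have hts : 0 < t - s := sub_pos.2 hst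
  set w : E := (t - s)⁻¹ • (q₂ - q₁) with hw
  have hwR : ‖w‖ ≤ R := by
    rw [hw, norm_smul, norm_inv, Real.norm_of_nonneg hts.le, inv_mul_le_iff₀ hts, mul_comm]
    exact hR
  let l : ℝ → E := fun τ => q₁ + (τ - s) • w
  have hl : ContDiff ℝ ∞ l := by fun_prop
  have hls : l s = q₁ := by simp [l]
  have hlt : l t = q₂ := by simp [l, w, smul_smul, mul_inv_cancel₀ hts.ne']
  have hlS : ∀ τ ∈ Icc s t, l τ ∈ S := fun τ hτ => by
    have : l τ = q₁ + ((τ - s) / (t - s)) • (q₂ - q₁) := by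
      simp [l, w, smul_smul, div_eq_mul_inv]
    rw [this]
    exact hS.add_smul_sub_mem h1 h2 ⟨div_nonneg (by linarith [hτ.1]) hts.le,
      (div_le_one hts).2 (by linarith [hτ.2])⟩
  let γ : ℝ → M := fun τ => (extChartAt 𝓘(ℝ, E) x₀).symm (l τ)
  have hγs : ∀ τ ∈ Icc s t, γ τ ∈ (chartAt E x₀).source := fun τ hτ =>
    chart_symm_mem (hSt (hlS τ hτ))
  have hγc : ContinuousOn γ (Icc s t) :=
    (continuousOn_extChartAt_symm x₀).comp hl.continuous.continuousOn fun τ hτ => hSt (hlS τ hτ)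
  have hac : IsACCurve E γ s t := by
    refine ⟨hγc, fun x₁ c d hsc hcd hdt hmaps => ?_⟩
    refine ContDiffOn.absolutelyContinuousOnInterval fun τ hτ => ?_
    rw [uIcc_of_le hcd] at hτ
    have hτ' : τ ∈ Icc s t := ⟨hsc.trans hτ.1, hτ.2.trans hdt⟩
    have a1 : ContMDiffAt 𝓘(ℝ, E) 𝓘(ℝ, E) 1 (extChartAt 𝓘(ℝ, E) x₀).symm (l τ) :=
      (contMDiffOn_extChartAt_symm (n := 1) x₀).contMDiffAt
        ((isOpen_chart_target x₀).mem_nhds (hSt (hlS τ hτ')))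
    have a2 : ContMDiffAt 𝓘(ℝ, E) 𝓘(ℝ, E) 1 (extChartAt 𝓘(ℝ, E) x₁) (γ τ) :=
      contMDiffAt_extChartAt' (hmaps hτ)
    have a3 : ContMDiffAt 𝓘(ℝ, ℝ) 𝓘(ℝ, E) 1 l τ := (hl.of_le (by simp)).contMDiff.contMDiffAt
    have a4 := ContMDiffAt.comp (f := γ) τ a2 (ContMDiffAt.comp (f := l) τ a1 a3)
    exact (contMDiffAt_iff_contDiffAt.1 a4).contDiffWithinAt
  have hval : ∀ τ ∈ Ioo s t, |lagrangianAlong L γ τ| ≤ C := fun τ hτ => by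
    have hτ' := Ioo_subset_Icc_self hτ
    have hright : ∀ r ∈ Icc s t, extChartAt 𝓘(ℝ, E) x₀ (γ r) = l r := fun r hr =>
      (extChartAt 𝓘(ℝ, E) x₀).right_inv (hSt (hlS r hr))
    have hd : deriv (fun r => extChartAt 𝓘(ℝ, E) x₀ (γ r)) τ = w := by
      have e : (fun r => extChartAt 𝓘(ℝ, E) x₀ (γ r)) =ᶠ[𝓝 τ] l := by
        filter_upwards [Icc_mem_nhds hτ.1 hτ.2] with r hr using hright r hr
      rw [e.deriv_eq]
      have : HasDerivAt l w τ := by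
        have h := (((hasDerivAt_id τ).sub_const s).smul_const w).const_add q₁
        rwa [one_smul] at h
      exact this.deriv
    unfold lagrangianAlong
    rw [lagrangian_velocity (L := L) (continuousAt_of_mem_Ioo hγc hτ) (hγs τ hτ'), hd, hright τ hτ']
    exact hC _ (hlS τ hτ') _ hwR _
  have hint : IntervalIntegrable (lagrangianAlong L γ) volume s t := by
    rw [intervalIntegrable_iff_integrableOn_Ioo_of_le hst.le]
    refine IntegrableOn.of_bound (by simp) ?_ C ?_
    · exact (hL.aestronglyMeasurable_along hst.le hγc).mono_measure
        (Measure.restrict_mono Ioo_subset_Ioc_self le_rfl)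
    · exact (ae_restrict_iff' measurableSet_Ioo).2 (Eventually.of_forall hval)
  refine ⟨γ, ⟨hst.le, hac, hint⟩, by simp [γ, hls], by simp [γ, hlt], ?_⟩
  calc ∫ τ in s..t, lagrangianAlong L γ τ ≤ ∫ _ in s..t, C :=
        intervalIntegral.integral_mono_on_of_le_Ioo hst.le hint intervalIntegrable_const
          fun τ hτ => (abs_le.1 (hval τ hτ)).2
    _ = C * (t - s) := by rw [intervalIntegral.integral_const, smul_eq_mul, mul_comm]

theorem exists_chart_ball (x : M) :
    ∃ r > 0, Metric.closedBall (extChartAt 𝓘(ℝ, E) x x) r ⊆ (extChartAt 𝓘(ℝ, E) x).target :=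
  Metric.nhds_basis_closedBall.mem_iff.1
    ((isOpen_chart_target (E := E) x).mem_nhds (mem_extChartAt_target x))

/-- Points of `M` that can be joined with uniformly bounded action, uniformly for durations in any
compact subset of `(0, ∞)`. -/
def UniformlyConnected (L : TangentBundle 𝓘(ℝ, E) M → ℝ → ℝ) (U V : Set M) : Prop :=
  ∀ T₁ T₂ : ℝ, 0 < T₁ → ∃ C, ∀ x ∈ U, ∀ y ∈ V, ∀ s t, s + T₁ ≤ t → t ≤ s + T₂ →
    Connects L x s y t C

theorem UniformlyConnected.trans {U V W : Set M} (h1 : UniformlyConnected L U V)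
    (h2 : UniformlyConnected L V W) (hV : V.Nonempty) : UniformlyConnected L U W := by
  intro T₁ T₂ hT
  obtain ⟨C₁, hC₁⟩ := h1 (T₁ / 2) (T₂ / 2) (by positivity)
  obtain ⟨C₂, hC₂⟩ := h2 (T₁ / 2) (T₂ / 2) (by positivity)
  obtain ⟨y, hy⟩ := hV
  refine ⟨C₁ + C₂, fun x hx z hz s t h h' => ?_⟩
  exact (hC₁ x hx y hy s ((s + t) / 2) (by linarith) (by linarith)).trans
    (hC₂ y hy z hz ((s + t) / 2) t (by linarith) (by linarith))

/-- Two points of a coordinate ball of radius `r` are joined by a segment of speed at most `2 * r /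
T₁`, on which the Lagrangian is bounded. -/
theorem IsPeriodicTonelli.exists_nhds_uniformlyConnected (hL : IsPeriodicTonelli L) (x : M) :
    ∃ U ∈ 𝓝 x, UniformlyConnected L U U := by
  obtain ⟨r, hr, hball⟩ := exists_chart_ball (E := E) x
  refine ⟨(chartAt E x).source ∩
    extChartAt 𝓘(ℝ, E) x ⁻¹' Metric.closedBall (extChartAt 𝓘(ℝ, E) x x) r, ?_, ?_⟩
  · exact inter_mem ((chartAt E x).open_source.mem_nhds (mem_chart_source E x))
      ((continuousAt_extChartAt x).preimage_mem_nhds (Metric.closedBall_mem_nhds _ hr))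
  · intro T₁ T₂ hT
    obtain ⟨C, hC0, hC⟩ := hL.bounded_on_compact (isCompact_closedBall _ r) hball (2 * r / T₁)
    refine ⟨C * T₂, fun y hy z hz s t h1 h2 => ?_⟩
    have hseg := hL.connects_segment (convex_closedBall _ r) hball hy.2 hz.2
      (show s < t by linarith) (R := 2 * r / T₁) ?_ hC
    · rw [(extChartAt 𝓘(ℝ, E) x).left_inv (by rw [extChartAt_source]; exact hy.1),
        (extChartAt 𝓘(ℝ, E) x).left_inv (by rw [extChartAt_source]; exact hz.1)] at hseg
      exact hseg.mono (by gcongr; linarith)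
    · have hy' := hy.2
      have hz' := hz.2
      simp only [mem_preimage, Metric.mem_closedBall] at hy' hz'
      rw [← dist_eq_norm]
      have := dist_triangle_right (extChartAt 𝓘(ℝ, E) x z) (extChartAt 𝓘(ℝ, E) x y)
        (extChartAt 𝓘(ℝ, E) x x)
      calc _ ≤ 2 * r := by linarith
        _ = 2 * r / T₁ * T₁ := by field_simp
        _ ≤ _ := by gcongr; linarith

theorem UniformlyConnected.mono {U V U' V' : Set M} (h : UniformlyConnected L U V) (hU : U' ⊆ U)
    (hV : V' ⊆ V) : UniformlyConnected L U' V' := fun T₁ T₂ hT =>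
  let ⟨C, hC⟩ := h T₁ T₂ hT
  ⟨C, fun x hx y hy => hC x (hU hx) y (hV hy)⟩

theorem UniformlyConnected.union_left {U U' V : Set M} (h : UniformlyConnected L U V)
    (h' : UniformlyConnected L U' V) : UniformlyConnected L (U ∪ U') V := fun T₁ T₂ hT => by
  obtain ⟨C, hC⟩ := h T₁ T₂ hT
  obtain ⟨C', hC'⟩ := h' T₁ T₂ hT
  refine ⟨max C C', fun x hx y hy s t h1 h2 => ?_⟩
  rcases hx with hx | hx
  · exact (hC x hx y hy s t h1 h2).mono (le_max_left _ _)
  · exact (hC' x hx y hy s t h1 h2).mono (le_max_right _ _)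

theorem UniformlyConnected.union_right {U V V' : Set M} (h : UniformlyConnected L U V)
    (h' : UniformlyConnected L U V') : UniformlyConnected L U (V ∪ V') := fun T₁ T₂ hT => by
  obtain ⟨C, hC⟩ := h T₁ T₂ hT
  obtain ⟨C', hC'⟩ := h' T₁ T₂ hT
  refine ⟨max C C', fun x hx y hy s t h1 h2 => ?_⟩
  rcases hy with hy | hy
  · exact (hC x hx y hy s t h1 h2).mono (le_max_left _ _)
  · exact (hC' x hx y hy s t h1 h2).mono (le_max_right _ _)

/-- The points uniformly connected from `x` form a clopen set, by concatenation with short chart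
segments. -/
theorem IsPeriodicTonelli.uniformlyConnected_singleton [PreconnectedSpace M]
    (hL : IsPeriodicTonelli L) (x y : M) : UniformlyConnected L {x} {y} := by
  have hopen : ∀ x : M, IsOpen {y | UniformlyConnected L {x} {y}} := fun x => by
    rw [isOpen_iff_mem_nhds]
    intro y hy
    obtain ⟨U, hU, hUU⟩ := hL.exists_nhds_uniformlyConnected y
    filter_upwards [hU] with z hz
    exact UniformlyConnected.trans hy (hUU.mono (singleton_subset_iff.2 (mem_of_mem_nhds hU))
      (singleton_subset_iff.2 hz)) (singleton_nonempty y)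
  have hclosed : IsClosed {y | UniformlyConnected L {x} {y}} := by
    rw [← isOpen_compl_iff, isOpen_iff_mem_nhds]
    intro y hy
    obtain ⟨U, hU, hUU⟩ := hL.exists_nhds_uniformlyConnected y
    filter_upwards [hU] with z hz hz'
    exact hy (UniformlyConnected.trans hz' (hUU.mono (singleton_subset_iff.2 hz)
      (singleton_subset_iff.2 (mem_of_mem_nhds hU))) (singleton_nonempty z))
  have huniv := IsClopen.eq_univ ⟨hclosed, hopen x⟩ ⟨x, by
    obtain ⟨U, hU, hUU⟩ := hL.exists_nhds_uniformlyConnected x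
    exact hUU.mono (singleton_subset_iff.2 (mem_of_mem_nhds hU))
      (singleton_subset_iff.2 (mem_of_mem_nhds hU))⟩
  have : y ∈ (univ : Set M) := mem_univ y
  rwa [← huniv] at this

theorem IsPeriodicTonelli.uniformlyConnected [CompactSpace M] [PreconnectedSpace M]
    (hL : IsPeriodicTonelli L) : UniformlyConnected L (univ : Set M) univ := by
  have hpt : ∀ y : M, UniformlyConnected L univ {y} := fun y =>
    isCompact_univ.induction_on (p := fun U => UniformlyConnected L U {y})
      (fun _ _ _ => ⟨0, fun x hx => hx.elim⟩) (fun s t hst h => h.mono hst Subset.rfl)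
      (fun s t h h' => h.union_left h') fun x _ => by
        obtain ⟨U, hU, hUU⟩ := hL.exists_nhds_uniformlyConnected x
        exact ⟨U, by rwa [nhdsWithin_univ], (hUU.mono Subset.rfl (singleton_subset_iff.2
          (mem_of_mem_nhds hU))).trans (hL.uniformlyConnected_singleton x y) (singleton_nonempty x)⟩
  refine isCompact_univ.induction_on (p := fun V => UniformlyConnected L univ V)
      (fun _ _ _ => ⟨0, fun x hx y hy => hy.elim⟩) (fun s t hst h => h.mono Subset.rfl hst)
      (fun s t h h' => h.union_right h') fun y _ => ?_
  obtain ⟨U, hU, hUU⟩ := hL.exists_nhds_uniformlyConnected y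
  exact ⟨U, by rwa [nhdsWithin_univ], (hpt y).trans (hUU.mono (singleton_subset_iff.2
    (mem_of_mem_nhds hU)) Subset.rfl) (singleton_nonempty y)⟩

end Curves

/-- A curve which is confined to a closed subset of an open set as long as it stays in the open set
never leaves it. -/
theorem confined_of_closed_subset_open {X : Type*} [TopologicalSpace X] {γ : ℝ → X} {c d t₀ : ℝ}
    (hγ : ContinuousOn γ (Icc c d)) (ht₀ : t₀ ∈ Icc c d) {V S : Set X} (hV : IsOpen V)
    (hS : IsClosed S) (hSV : S ⊆ V) (h0 : γ t₀ ∈ V)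
    (h : ∀ τ ∈ Icc c d, (∀ r ∈ uIcc t₀ τ, γ r ∈ V) → γ τ ∈ S) :
    ∀ τ ∈ Icc c d, γ τ ∈ S := by
  suffices H : ∀ τ ∈ Icc c d, γ τ ∈ V from fun τ hτ => h τ hτ fun r hr =>
    H r (uIcc_subset_Icc ht₀ hτ hr)
  intro τ hτ
  by_contra hbad
  -- The affine parametrization from `t₀` to `τ` treats later and earlier times together.
  let l : ℝ → ℝ := fun s => t₀ + s * (τ - t₀)
  have hlu : ∀ s ∈ Icc (0 : ℝ) 1, ∀ s' ∈ Icc (0 : ℝ) s, l s' ∈ uIcc t₀ (l s) := by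
    intro s hs s' hs'
    rcases le_total t₀ τ with hle | hle
    · have h1 : s' * (τ - t₀) ≤ s * (τ - t₀) :=
        mul_le_mul_of_nonneg_right hs'.2 (sub_nonneg.2 hle)
      have h2 := mul_nonneg hs'.1 (sub_nonneg.2 hle)
      exact mem_uIcc.2 (Or.inl ⟨by simp only [l]; linarith, by simp only [l]; linarith⟩)
    · have h1 : s * (τ - t₀) ≤ s' * (τ - t₀) :=
        mul_le_mul_of_nonpos_right hs'.2 (sub_nonpos.2 hle)
      have h2 := mul_nonpos_of_nonneg_of_nonpos hs'.1 (sub_nonpos.2 hle)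
      exact mem_uIcc.2 (Or.inr ⟨by simp only [l]; linarith, by simp only [l]; linarith⟩)
  have hl1 : l 1 = τ := by simp [l]
  have hl0 : l 0 = t₀ := by simp [l]
  have hlm : MapsTo l (Icc 0 1) (Icc c d) := fun s hs => by
    have := hlu 1 ⟨zero_le_one, le_rfl⟩ s hs
    rw [hl1] at this
    exact uIcc_subset_Icc ht₀ hτ this
  have hσ : ContinuousOn (γ ∘ l) (Icc 0 1) := hγ.comp (by fun_prop) hlm
  have hB : IsCompact (Icc (0 : ℝ) 1 ∩ (γ ∘ l) ⁻¹' Vᶜ) :=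
    isCompact_Icc.of_isClosed_subset
      (hσ.preimage_isClosed_of_isClosed isClosed_Icc hV.isClosed_compl) inter_subset_left
  -- At the first exit parameter the curve is a limit of points of the closed set `S ⊆ V`, so it has
  -- not left `V`.
  obtain ⟨m, ⟨hm, hmV⟩, hmin⟩ := hB.exists_isLeast
    ⟨1, ⟨zero_le_one, le_rfl⟩, by simp only [mem_preimage, Function.comp, hl1]; exact hbad⟩
  have hm0 : 0 < m := hm.1.lt_of_ne fun h0' => hmV (by
    simp only [Function.comp, ← h0', hl0]; exact h0)
  have hlt : ∀ s ∈ Ico 0 m, γ (l s) ∈ V := fun s hs => by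
    by_contra hn
    exact absurd (hmin ⟨⟨hs.1, hs.2.le.trans hm.2⟩, hn⟩) (not_le.2 hs.2)
  have hin : ∀ s ∈ Ico 0 m, γ (l s) ∈ S := fun s hs => by
    have hs1 : s ∈ Icc (0 : ℝ) 1 := ⟨hs.1, hs.2.le.trans hm.2⟩
    refine h _ (hlm hs1) fun r hr => ?_
    rcases eq_or_ne (l s) t₀ with he | hne
    · rw [he, uIcc_self, mem_singleton_iff] at hr
      rw [hr]; exact h0
    · have hne' : s * (τ - t₀) ≠ 0 := fun h0' => hne (by simp only [l, h0', add_zero])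
      have hs0 : 0 < s := hs.1.lt_of_ne fun h0' => hne' (by rw [← h0', zero_mul])
      have hne2 : τ - t₀ ≠ 0 := right_ne_zero_of_mul hne'
      have hr' : r = l ((r - t₀) / (τ - t₀)) := by simp only [l]; field_simp; ring
      rw [hr']
      refine hlt _ ?_
      rw [mem_uIcc] at hr
      rcases lt_or_gt_of_ne hne2 with hneg | hpos
      · have hls : l s ≤ t₀ := by
          simp only [l]; nlinarith
        have hr2 : l s ≤ r ∧ r ≤ t₀ := by
          rcases hr with hr | hr
          · exact ⟨by linarith [hr.1, hr.2], by linarith [hr.1, hr.2]⟩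
          · exact hr
        refine ⟨div_nonneg_of_nonpos (by linarith) hneg.le, lt_of_le_of_lt ?_ hs.2⟩
        rw [div_le_iff_of_neg hneg]
        simp only [l] at hr2
        linarith
      · have hls : t₀ ≤ l s := by
          simp only [l]; nlinarith
        have hr2 : t₀ ≤ r ∧ r ≤ l s := by
          rcases hr with hr | hr
          · exact hr
          · exact ⟨by linarith [hr.1, hr.2], by linarith [hr.1, hr.2]⟩
        refine ⟨div_nonneg (by linarith) hpos.le, lt_of_le_of_lt ?_ hs.2⟩
        rw [div_le_iff₀ hpos]
        simp only [l] at hr2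
        linarith
  refine hmV (hSV (?_ : (γ ∘ l) m ∈ S))
  have htend : Tendsto (γ ∘ l) (𝓝[Ico 0 m] m) (𝓝 ((γ ∘ l) m)) :=
    (hσ m hm).mono fun s hs => ⟨hs.1, hs.2.le.trans hm.2⟩
  have : (𝓝[Ico 0 m] m).NeBot := by
    rw [← mem_closure_iff_nhdsWithin_neBot, closure_Ico hm0.ne]
    exact ⟨hm0.le, le_rfl⟩
  exact hS.mem_of_tendsto htend (eventually_mem_nhdsWithin.mono hin)

/-! ### Confinement of curves of bounded action -/

section Tonelli

variable {E : Type*} [NormedAddCommGroup E] [NormedSpace ℝ E] [FiniteDimensional ℝ E]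
  {M : Type*} [TopologicalSpace M] [ChartedSpace E M] [IsManifold 𝓘(ℝ, E) ∞ M]
  {L : TangentBundle 𝓘(ℝ, E) M → ℝ → ℝ}

/-- Chart increments are controlled by the action. -/
theorem Admissible.chart_sub_le {γ : ℝ → M} {c d : ℝ} (h : Admissible L γ c d) {x₀ : M}
    (hmaps : MapsTo γ (Icc c d) (chartAt E x₀).source) {K R : ℝ} (hK : 0 < K)
    (hR : ∀ τ ∈ Icc c d, ∀ (w : E), K * ‖w‖ ≤
      chartLagrangian L x₀ (extChartAt 𝓘(ℝ, E) x₀ (γ τ)) w τ + R) :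
    K * ‖extChartAt 𝓘(ℝ, E) x₀ (γ d) - extChartAt 𝓘(ℝ, E) x₀ (γ c)‖ ≤
      (∫ τ in c..d, lagrangianAlong L γ τ) + R * (d - c) := by
  have hac := h.ac.2 x₀ c d le_rfl h.le le_rfl hmaps
  have hint : IntervalIntegrable (fun τ => K⁻¹ * (lagrangianAlong L γ τ + R)) volume c d :=
    (h.integrable.add intervalIntegrable_const).const_mul _
  have := ac_norm_sub_le h.le hac hint fun τ hτ => by
    have h1 := hR τ (Ioo_subset_Icc_self hτ)
      (deriv (fun r => extChartAt 𝓘(ℝ, E) x₀ (γ r)) τ)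
    rw [← lagrangian_velocity (L := L) (continuousAt_of_mem_Ioo h.ac.1 hτ)
      (hmaps (Ioo_subset_Icc_self hτ))] at h1
    rw [← div_eq_inv_mul, le_div_iff₀ hK, mul_comm]
    exact h1
  rw [intervalIntegral.integral_const_mul, ← div_eq_inv_mul, le_div_iff₀ hK,
    intervalIntegral.integral_add h.integrable intervalIntegrable_const,
    intervalIntegral.integral_const, smul_eq_mul, mul_comm] at this
  linarith

theorem Admissible.integral_ge {γ : ℝ → M} {c d : ℝ} (h : Admissible L γ c d) {C : ℝ}
    (hC : ∀ v t, -C ≤ L v t) : -C * (d - c) ≤ ∫ τ in c..d, lagrangianAlong L γ τ := by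
  have := intervalIntegral.integral_mono_on h.le (intervalIntegrable_const (c := -C)) h.integrable
    fun τ _ => hC _ _
  rw [intervalIntegral.integral_const, smul_eq_mul] at this
  linarith

/-- The discarded pieces have action at least `-C` times their length, so a bound on the whole
action also bounds that of subintervals. -/
theorem Admissible.integral_sub_le {γ : ℝ → M} {c d u v : ℝ} (h : Admissible L γ c d) {C : ℝ}
    (hC : ∀ v t, -C ≤ L v t) (hcu : c ≤ u) (huv : u ≤ v) (hvd : v ≤ d) :
    ∫ τ in u..v, lagrangianAlong L γ τ ≤
      (∫ τ in c..d, lagrangianAlong L γ τ) + C * ((d - c) - (v - u)) := by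
  have h1 := h.integral_add (hcu.trans huv) hvd
  have h2 := (h.mono le_rfl (hcu.trans huv) hvd).integral_add hcu huv
  have h3 := (h.mono le_rfl hcu (huv.trans hvd)).integral_ge hC
  have h4 := (h.mono (hcu.trans huv) hvd le_rfl).integral_ge hC
  linarith

/-- The part of `M` with coordinates in the closed ball `closedBall q r` of the chart at `x₀`. -/
def chartBall (x₀ : M) (q : E) (r : ℝ) : Set M :=
  (chartAt E x₀).source ∩ extChartAt 𝓘(ℝ, E) x₀ ⁻¹' Metric.closedBall q r

theorem exists_closedBall_subset {x x₀ : M} (hx : x ∈ (chartAt E x₀).source) :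
    ∃ r > 0, Metric.closedBall (extChartAt 𝓘(ℝ, E) x₀ x) r ⊆ (extChartAt 𝓘(ℝ, E) x₀).target :=
  Metric.nhds_basis_closedBall.mem_iff.1 ((isOpen_chart_target x₀).mem_nhds
    ((extChartAt 𝓘(ℝ, E) x₀).map_source (by rwa [extChartAt_source])))

theorem isClosed_chartBall [T2Space M] {x₀ : M} {q : E} {r : ℝ}
    (hr : Metric.closedBall q r ⊆ (extChartAt 𝓘(ℝ, E) x₀).target) :
    IsClosed (chartBall x₀ q r) := by
  have : chartBall x₀ q r = (extChartAt 𝓘(ℝ, E) x₀).symm '' Metric.closedBall q r := by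
    ext x
    constructor
    · rintro ⟨h1, h2⟩
      exact ⟨_, h2, (extChartAt 𝓘(ℝ, E) x₀).left_inv (by rwa [extChartAt_source])⟩
    · rintro ⟨w, hw, rfl⟩
      refine ⟨chart_symm_mem (hr hw), ?_⟩
      rw [mem_preimage, (extChartAt 𝓘(ℝ, E) x₀).right_inv (hr hw)]
      exact hw
  rw [this]
  exact ((isCompact_closedBall q r).image_of_continuousOn
    ((continuousOn_extChartAt_symm x₀).mono hr)).isClosed

theorem chartBall_mem_nhds {x₀ x : M} (hx : x ∈ (chartAt E x₀).source) {r : ℝ} (hr : 0 < r) :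
    chartBall x₀ (extChartAt 𝓘(ℝ, E) x₀ x) r ∈ 𝓝 x :=
  inter_mem ((chartAt E x₀).open_source.mem_nhds hx)
    ((continuousAt_extChartAt' (by rwa [extChartAt_source])).preimage_mem_nhds
      (Metric.closedBall_mem_nhds _ hr))

theorem chartBall_mono {x₀ : M} {q : E} {r r' : ℝ} (h : r ≤ r') :
    chartBall x₀ q r ⊆ chartBall x₀ q r' :=
  inter_subset_inter_right _ (preimage_mono (Metric.closedBall_subset_closedBall h))

/-- Curves of bounded action do not leave a coordinate ball in a short time. -/
theorem IsPeriodicTonelli.exists_confined [T2Space M] [CompactSpace M] (hL : IsPeriodicTonelli L)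
    {x₀ : M} {q₀ : E} {r : ℝ} (hr : 0 < r)
    (hball : Metric.closedBall q₀ r ⊆ (extChartAt 𝓘(ℝ, E) x₀).target) (A : ℝ) :
    ∃ δ > 0, ∀ γ c d, Admissible L γ c d → d - c ≤ δ →
      ∫ τ in c..d, lagrangianAlong L γ τ ≤ A → ∀ t₀ ∈ Icc c d, γ t₀ ∈ chartBall x₀ q₀ (r / 2) →
      MapsTo γ (Icc c d) (chartBall x₀ q₀ r) := by
  obtain ⟨C, hC0, hC⟩ := hL.exists_lower_bound
  -- `K` and the duration `1 / (C + R)` are chosen so that `K` times a coordinate increment is at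
  -- most `A + 1 ≤ K * (r / 4)`. A curve meeting the ball of radius `r / 2` then stays in the ball
  -- of radius `3 / 4 * r`, strictly inside the open ball where the estimate applies.
  set K := 4 * (|A| + 1) / r with hKdef
  have hK : 0 < K := by positivity
  obtain ⟨R, hR0, hR⟩ := hL.superlinear_chart (isCompact_closedBall q₀ r) hball K
  refine ⟨1 / (C + R), by positivity, fun γ c d hγ hdc hA t₀ ht₀ h0 => ?_⟩
  have hr34 : Metric.closedBall q₀ (3 / 4 * r) ⊆ Metric.ball q₀ r :=
    Metric.closedBall_subset_ball (by linarith)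
  have hV : IsOpen ((chartAt E x₀).source ∩ extChartAt 𝓘(ℝ, E) x₀ ⁻¹' Metric.ball q₀ r) := by
    have := isOpen_extChartAt_preimage (I := 𝓘(ℝ, E)) x₀ (Metric.isOpen_ball (x := q₀) (ε := r))
    exact this
  have hVball : (chartAt E x₀).source ∩ extChartAt 𝓘(ℝ, E) x₀ ⁻¹' Metric.ball q₀ r ⊆
      chartBall x₀ q₀ r :=
    inter_subset_inter_right _ (preimage_mono Metric.ball_subset_closedBall)
  have hincr : ∀ u v, c ≤ u → u ≤ v → v ≤ d → (∀ τ ∈ Icc u v, γ τ ∈ (chartAt E x₀).source ∩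
      extChartAt 𝓘(ℝ, E) x₀ ⁻¹' Metric.ball q₀ r) →
      ‖extChartAt 𝓘(ℝ, E) x₀ (γ v) - extChartAt 𝓘(ℝ, E) x₀ (γ u)‖ ≤ r / 4 := by
    intro u v hcu huv hvd hin
    have h1 := (hγ.mono hcu huv hvd).chart_sub_le (fun τ hτ => (hin τ hτ).1) hK
      fun τ hτ w => hR _ (Metric.ball_subset_closedBall (hin τ hτ).2) w τ
    have h2 := hγ.integral_sub_le hC hcu huv hvd
    have h3 : (C + R) * (d - c) ≤ 1 := by
      rw [le_div_iff₀ (by positivity)] at hdc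
      linarith
    have h4 : R * (v - u) ≤ R * (d - c) := by gcongr
    have h5 : 0 ≤ C * (v - u) := mul_nonneg hC0.le (sub_nonneg.2 huv)
    have h6 : K * ‖extChartAt 𝓘(ℝ, E) x₀ (γ v) - extChartAt 𝓘(ℝ, E) x₀ (γ u)‖ ≤ K * (r / 4) := by
      have : K * (r / 4) = |A| + 1 := by rw [hKdef]; field_simp
      rw [this]
      have := le_abs_self A
      nlinarith
    exact le_of_mul_le_mul_left h6 hK
  have := confined_of_closed_subset_open hγ.ac.1 ht₀ hV
    (isClosed_chartBall (x₀ := x₀) (q := q₀) (r := 3 / 4 * r)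
      (hr34.trans (Metric.ball_subset_closedBall.trans hball)))
    (inter_subset_inter_right _ (preimage_mono hr34))
    ⟨h0.1, hr34 (Metric.closedBall_subset_closedBall (by linarith) h0.2)⟩ ?_
  · exact fun τ hτ => chartBall_mono (by linarith) (this τ hτ)
  · intro τ hτ hin
    refine ⟨(hin τ right_mem_uIcc).1, ?_⟩
    have h0' := h0.2
    simp only [mem_preimage, Metric.mem_closedBall, dist_eq_norm] at h0' ⊢
    have key : ‖extChartAt 𝓘(ℝ, E) x₀ (γ τ) - extChartAt 𝓘(ℝ, E) x₀ (γ t₀)‖ ≤ r / 4 := by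
      rcases le_total t₀ τ with hle | hle
      · exact hincr t₀ τ ht₀.1 hle hτ.2 (by rwa [uIcc_of_le hle] at hin)
      · rw [norm_sub_rev]
        exact hincr τ t₀ hτ.1 hle ht₀.2 (by rwa [uIcc_of_ge hle] at hin)
    calc _ ≤ ‖extChartAt 𝓘(ℝ, E) x₀ (γ τ) - extChartAt 𝓘(ℝ, E) x₀ (γ t₀)‖ +
          ‖extChartAt 𝓘(ℝ, E) x₀ (γ t₀) - q₀‖ := norm_sub_le_norm_sub_add_norm_sub _ _ _
      _ ≤ _ := by linarith

theorem IsACCurve.ae_mdifferentiableAt {γ : ℝ → M} {a b : ℝ} (hab : a ≤ b)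
    (h : IsACCurve E γ a b) :
    ∀ᵐ t : ℝ, t ∈ Ioo a b → MDifferentiableAt 𝓘(ℝ, ℝ) 𝓘(ℝ, E) γ t := by
  refine interval_induction (P := fun c d =>
    ∀ᵐ t : ℝ, t ∈ Ioo c d → MDifferentiableAt 𝓘(ℝ, ℝ) 𝓘(ℝ, E) γ t) hab ?_ ?_
  · intro c d e _ _ _ _ h1 h2
    have h3 : ∀ᵐ t : ℝ, t ≠ d := by simp [ae_iff, measure_singleton]
    filter_upwards [h1, h2, h3] with t t1 t2 t3 ht
    rcases lt_or_gt_of_ne t3 with hlt | hlt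
    · exact t1 ⟨ht.1, hlt⟩
    · exact t2 ⟨hlt, ht.2⟩
  · intro t ht
    obtain ⟨δ, hδ, hmaps⟩ := exists_short_chart h.1 ht
      ((chartAt E (γ t)).open_source.mem_nhds (mem_chart_source E (γ t)))
    refine ⟨δ, hδ, fun c d hac hcd hdb hc hd => ?_⟩
    have hm := hmaps c d hac hcd hdb hc hd
    filter_upwards [ac_ae_differentiableAt (h.2 (γ t) c d hac hcd hdb hm)] with s hs hmem
    rw [uIcc_of_le hcd] at hs
    have hsd := hs (Ioo_subset_Icc_self hmem)
    have hsrc : ∀ r ∈ Icc c d, γ r ∈ (extChartAt 𝓘(ℝ, E) (γ t)).source := fun r hr => by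
      rw [extChartAt_source]; exact hm hr
    have hsymm := mdifferentiableAt_chart_symm
      ((extChartAt 𝓘(ℝ, E) (γ t)).map_source (hsrc s (Ioo_subset_Icc_self hmem)))
    refine (MDifferentiableAt.comp (f := fun r => extChartAt 𝓘(ℝ, E) (γ t) (γ r)) s hsymm
      hsd.mdifferentiableAt).congr_of_eventuallyEq ?_
    filter_upwards [Icc_mem_nhds hmem.1 hmem.2] with r hr
    exact ((extChartAt 𝓘(ℝ, E) (γ t)).left_inv (hsrc r hr)).symm

theorem differentiableAt_chart {γ : ℝ → M} {t : ℝ} {x₀ : M}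
    (h : MDifferentiableAt 𝓘(ℝ, ℝ) 𝓘(ℝ, E) γ t) (hx : γ t ∈ (chartAt E x₀).source) :
    DifferentiableAt ℝ (fun τ => extChartAt 𝓘(ℝ, E) x₀ (γ τ)) t :=
  ((mdifferentiableAt_extChartAt hx).comp t h).differentiableAt

end Tonelli

/-! ### Lower semicontinuity of the action -/

section Tonelli

variable {E : Type*} [NormedAddCommGroup E] [NormedSpace ℝ E] [FiniteDimensional ℝ E]
  {M : Type*} [TopologicalSpace M] [ChartedSpace E M] [IsManifold 𝓘(ℝ, E) ∞ M]
  {L : TangentBundle 𝓘(ℝ, E) M → ℝ → ℝ}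

/-- `γ` is the pointwise limit along `U` of curves `γs i` of action at most `A`. -/
structure IsBoundedLimit {ι : Type*} (L : TangentBundle 𝓘(ℝ, E) M → ℝ → ℝ) (U : Filter ι)
    (γs : ι → ℝ → M) (γ : ℝ → M) (a b A : ℝ) : Prop where
  le : a ≤ b
  adm : ∀ᶠ i in U, Admissible L (γs i) a b
  bound : ∀ᶠ i in U, ∫ τ in a..b, lagrangianAlong L (γs i) τ ≤ A
  lim : ∀ t ∈ Icc a b, Tendsto (fun i => γs i t) U (𝓝 (γ t))

namespace IsBoundedLimit

variable [CompactSpace M] [T2Space M] {ι : Type*} {U : Filter ι} [U.NeBot] {γs : ι → ℝ → M}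
  {γ : ℝ → M} {a b A : ℝ}

/-- Convergence at the single time `t₀` puts the curves in the half ball there, and the action bound
keeps them in the full ball nearby, with `δ` independent of `i`. This equicontinuity replaces
uniform convergence. -/
theorem exists_confined (hL : IsPeriodicTonelli L) (h : IsBoundedLimit L U γs γ a b A) {t₀ : ℝ}
    (ht₀ : t₀ ∈ Icc a b) {x₀ : M} (hx : γ t₀ ∈ (chartAt E x₀).source) {r : ℝ} (hr : 0 < r)
    (hball : Metric.closedBall (extChartAt 𝓘(ℝ, E) x₀ (γ t₀)) r ⊆
      (extChartAt 𝓘(ℝ, E) x₀).target) :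
    ∃ δ > 0, (∀ᶠ i in U, ∀ τ ∈ Icc a b, |τ - t₀| < δ →
        γs i τ ∈ chartBall x₀ (extChartAt 𝓘(ℝ, E) x₀ (γ t₀)) r) ∧
      ∀ τ ∈ Icc a b, |τ - t₀| < δ → γ τ ∈ chartBall x₀ (extChartAt 𝓘(ℝ, E) x₀ (γ t₀)) r := by
  obtain ⟨C, hC0, hC⟩ := hL.exists_lower_bound
  obtain ⟨δ, hδ, hconf⟩ := hL.exists_confined hr hball (A + C * (b - a))
  have hev : ∀ᶠ i in U, ∀ τ ∈ Icc a b, |τ - t₀| < δ / 2 →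
      γs i τ ∈ chartBall x₀ (extChartAt 𝓘(ℝ, E) x₀ (γ t₀)) r := by
    filter_upwards [h.adm, h.bound, (h.lim t₀ ht₀).eventually_mem
      (chartBall_mem_nhds hx (half_pos hr))] with i h1 h2 h3 τ hτ hτ'
    have hac : a ≤ max a (t₀ - δ / 2) := le_max_left _ _
    have hdb : min b (t₀ + δ / 2) ≤ b := min_le_left _ _
    have hct : max a (t₀ - δ / 2) ≤ t₀ := max_le ht₀.1 (by linarith)
    have htd : t₀ ≤ min b (t₀ + δ / 2) := le_min ht₀.2 (by linarith)
    have hsub := h1.integral_sub_le hC hac (hct.trans htd) hdb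
    have hle : 0 ≤ C * (min b (t₀ + δ / 2) - max a (t₀ - δ / 2)) :=
      mul_nonneg hC0.le (by linarith)
    refine hconf (γs i) _ _ (h1.mono hac (hct.trans htd) hdb) ?_ ?_ t₀ ⟨hct, htd⟩ h3 ⟨?_, ?_⟩
    · have := min_le_right b (t₀ + δ / 2)
      have := le_max_right a (t₀ - δ / 2)
      linarith
    · linarith
    · exact max_le hτ.1 (by linarith [(abs_lt.1 hτ').1])
    · exact le_min hτ.2 (by linarith [(abs_lt.1 hτ').2])
  refine ⟨δ / 2, by positivity, hev, fun τ hτ hτ' => ?_⟩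
  exact (isClosed_chartBall hball).mem_of_tendsto (h.lim τ hτ) (hev.mono fun i hi => hi τ hτ hτ')

theorem continuousOn (hL : IsPeriodicTonelli L) (h : IsBoundedLimit L U γs γ a b A) :
    ContinuousOn γ (Icc a b) := by
  intro t₀ ht₀
  refine tendsto_def.2 fun N hN => ?_
  have hx := mem_chart_source E (γ t₀)
  have hN' : (extChartAt 𝓘(ℝ, E) (γ t₀)).symm ⁻¹' N ∈ 𝓝 (extChartAt 𝓘(ℝ, E) (γ t₀) (γ t₀)) := by
    refine (continuousAt_extChartAt_symm (γ t₀)).preimage_mem_nhds ?_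
    rwa [extChartAt_to_inv]
  obtain ⟨r, hr, hball⟩ := Metric.nhds_basis_closedBall.mem_iff.1
    (inter_mem hN' ((isOpen_chart_target (E := E) (γ t₀)).mem_nhds (mem_extChartAt_target (γ t₀))))
  obtain ⟨δ, hδ, -, hconf⟩ := h.exists_confined hL ht₀ hx hr (hball.trans inter_subset_right)
  refine Metric.mem_nhdsWithin_iff.2 ⟨δ, hδ, fun τ hτ => ?_⟩
  have hm := hconf τ hτ.2 (by simpa [Real.dist_eq] using hτ.1)
  have := (hball hm.2).1
  rwa [mem_preimage, (extChartAt 𝓘(ℝ, E) (γ t₀)).left_inv (by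
    rw [extChartAt_source]; exact hm.1)] at this

theorem tendsto_chart (h : IsBoundedLimit L U γs γ a b A) {τ : ℝ} (hτ : τ ∈ Icc a b) {x₀ : M}
    (hx : γ τ ∈ (chartAt E x₀).source) :
    Tendsto (fun i => extChartAt 𝓘(ℝ, E) x₀ (γs i τ)) U (𝓝 (extChartAt 𝓘(ℝ, E) x₀ (γ τ))) :=
  (continuousAt_extChartAt' (by rwa [extChartAt_source])).tendsto.comp (h.lim τ hτ)

theorem isACCurve (hL : IsPeriodicTonelli L) (h : IsBoundedLimit L U γs γ a b A) :
    IsACCurve E γ a b := by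
  refine ⟨h.continuousOn hL, fun x₀ c d hac hcd hdb hmaps => ?_⟩
  obtain ⟨C, hC0, hC⟩ := hL.exists_lower_bound
  refine interval_induction (P := fun c' d' => AbsolutelyContinuousOnInterval
    (fun τ => extChartAt 𝓘(ℝ, E) x₀ (γ τ)) c' d') hcd
    (fun c' d' e' _ h1 h2 _ h3 h4 => ac_union h1 h2 h3 h4) ?_
  intro t₀ ht₀
  have ht₀' : t₀ ∈ Icc a b := ⟨hac.trans ht₀.1, ht₀.2.trans hdb⟩
  have hx := hmaps ht₀
  obtain ⟨r, hr, hball⟩ := exists_closedBall_subset hx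
  obtain ⟨δ, hδ, hconf, -⟩ := h.exists_confined hL ht₀' hx hr hball
  refine ⟨δ, hδ, fun c' d' hcc' hcd' hdd' hc' hd' => ?_⟩
  have hac' : a ≤ c' := hac.trans hcc'
  have hdb' : d' ≤ b := hdd'.trans hdb
  have hnear : ∀ τ ∈ Icc c' d', τ ∈ Icc a b ∧ |τ - t₀| < δ := fun τ hτ => by
    refine ⟨⟨hac'.trans hτ.1, hτ.2.trans hdb'⟩, ?_⟩
    rw [abs_lt] at hc' hd' ⊢
    constructor <;> linarith [hτ.1, hτ.2, hc'.1, hd'.2]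
  have hint : ∀ i s t, Admissible L (γs i) s t →
      ∫ τ in s..t, (lagrangianAlong L (γs i) τ + C) =
        (∫ τ in s..t, lagrangianAlong L (γs i) τ) + C * (t - s) := fun i s t hi => by
    rw [intervalIntegral.integral_add hi.integrable intervalIntegrable_const,
      intervalIntegral.integral_const, smul_eq_mul, mul_comm C]
  refine ac_of_tendsto (U := U) (fs := fun i τ => extChartAt 𝓘(ℝ, E) x₀ (γs i τ))
    (gs := fun i τ => lagrangianAlong L (γs i) τ + C) (A := A + C * (b - a)) hcd' ?_ ?_ ?_ ?_ ?_
  · exact fun t ht => h.tendsto_chart (hnear t ht).1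
      (hmaps ⟨hcc'.trans ht.1, ht.2.trans hdd'⟩)
  · filter_upwards [h.adm] with i hi
    exact (hi.mono hac' hcd' hdb').integrable.add intervalIntegrable_const
  · exact Eventually.of_forall fun i t _ => by
      have := hC (velocity E (γs i) t) t
      unfold lagrangianAlong
      linarith
  · filter_upwards [h.adm, h.bound] with i hi hi'
    rw [hint i _ _ (hi.mono hac' hcd' hdb')]
    have := hi.integral_sub_le hC hac' hcd' hdb'
    linarith
  -- Superlinearity with arbitrarily large slope `K` is the equi-integrability of the velocities.
  · intro K hK
    obtain ⟨R, hR0, hR⟩ := hL.superlinear_chart (isCompact_closedBall _ r) hball K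
    refine ⟨R, hR0, ?_⟩
    filter_upwards [h.adm, hconf] with i hi hci s hs t ht hst
    have hsub : ∀ τ ∈ Icc s t, γs i τ ∈ chartBall x₀ (extChartAt 𝓘(ℝ, E) x₀ (γ t₀)) r :=
      fun τ hτ => by
        obtain ⟨h1, h2⟩ := hnear τ ⟨hs.1.trans hτ.1, hτ.2.trans ht.2⟩
        exact hci τ h1 h2
    have hadm := hi.mono (hac'.trans hs.1) hst (ht.2.trans hdb')
    have := hadm.chart_sub_le (fun τ hτ => (hsub τ hτ).1) hK
      (fun τ hτ w => hR _ (hsub τ hτ).2 w τ)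
    rw [hint i _ _ hadm, dist_comm, dist_eq_norm]
    have h5 : 0 ≤ C * (t - s) := mul_nonneg hC0.le (sub_nonneg.2 hst)
    linarith

/-- The limit of the actions of the curves, as a function of the final time, has at almost every
time a derivative which is at least the Lagrangian along the limit curve. -/
theorem lagrangian_le_deriv (hL : IsPeriodicTonelli L) (h : IsBoundedLimit L U γs γ a b A)
    {F : ℝ → ℝ} {C F' : ℝ} (hF : ∀ t ∈ Icc a b, Tendsto
      (fun i => (∫ τ in a..t, lagrangianAlong L (γs i) τ) + C * (t - a)) U (𝓝 (F t)))
    {t : ℝ} (ht : t ∈ Ioo a b) (hF' : HasDerivAt F F' t)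
    (hγ : MDifferentiableAt 𝓘(ℝ, ℝ) 𝓘(ℝ, E) γ t) :
    lagrangianAlong L γ t + C ≤ F' := by
  have htI := Ioo_subset_Icc_self ht
  have hx := mem_chart_source E (γ t)
  set φ := extChartAt 𝓘(ℝ, E) (γ t) with hφ
  have hqd := (differentiableAt_chart hγ hx).hasDerivAt
  set w₀ := deriv (fun τ => φ (γ τ)) t with hw₀
  set ℓ₀ := chartLagrangian L (γ t) (φ (γ t)) w₀ t with hℓ₀
  have hval : lagrangianAlong L γ t = ℓ₀ :=
    lagrangian_velocity (continuousAt_of_mem_Ioo (h.continuousOn hL) ht) hx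
  obtain ⟨r₀, hr₀, hball⟩ := exists_closedBall_subset (E := E) hx
  obtain ⟨R, hR0, hR⟩ := hL.superlinear_chart (isCompact_closedBall _ r₀) hball 1
  obtain ⟨p, hp⟩ := hL.exists_affine_minorant (mem_extChartAt_target (γ t)) w₀ t
  have key : ∀ ε > 0, ℓ₀ - ε * (1 + R + ‖w₀‖) ≤ (1 + ε) * (F' - C) := by
    intro ε hε
    obtain ⟨δ₁, hδ₁, hmin⟩ := hp ε hε
    have hrpos : 0 < min r₀ (δ₁ / 2) := by positivity
    obtain ⟨δ₂, hδ₂, hconf, -⟩ := h.exists_confined hL htI hx hrpos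
      ((Metric.closedBall_subset_closedBall (min_le_left _ _)).trans hball)
    have hineq : ∀ s ∈ Ioo 0 (min (min δ₁ δ₂) (b - t)),
        s * (ℓ₀ - p w₀ - ε * (1 + R + ‖w₀‖)) + p (φ (γ (t + s)) - φ (γ t)) ≤
          (1 + ε) * (F (t + s) - F t - C * s) := by
      intro s hs
      have hs0 := hs.1
      have hs1 : s < δ₁ := hs.2.trans_le ((min_le_left _ _).trans (min_le_left _ _))
      have hs2 : s < δ₂ := hs.2.trans_le ((min_le_left _ _).trans (min_le_right _ _))
      have hs3 : s < b - t := hs.2.trans_le (min_le_right _ _)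
      have hts : t + s ∈ Icc a b := ⟨by linarith [ht.1], by linarith⟩
      have hev : ∀ᶠ i in U, s * (ℓ₀ - p w₀ - ε * (1 + R + ‖w₀‖)) +
          p (φ (γs i (t + s)) - φ (γs i t)) ≤
          (1 + ε) * (((∫ τ in a..(t + s), lagrangianAlong L (γs i) τ) + C * (t + s - a)) -
            ((∫ τ in a..t, lagrangianAlong L (γs i) τ) + C * (t - a)) - C * s) := by
        filter_upwards [h.adm, hconf] with i hi hci
        have hle : t ≤ t + s := by linarith
        have hadm : Admissible L (γs i) t (t + s) := hi.mono ht.1.le hle hts.2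
        have hin : ∀ τ ∈ Icc t (t + s), γs i τ ∈ chartBall (γ t) (φ (γ t)) (min r₀ (δ₁ / 2)) :=
          fun τ hτ => hci τ ⟨ht.1.le.trans hτ.1, hτ.2.trans hts.2⟩ (by
            rw [abs_of_nonneg (sub_nonneg.2 hτ.1)]; linarith [hτ.2])
        have hmaps : MapsTo (γs i) (Icc t (t + s)) (chartAt E (γ t)).source :=
          fun τ hτ => (hin τ hτ).1
        have hac := hadm.ac.2 (γ t) t (t + s) le_rfl hle le_rfl hmaps
        obtain ⟨hpi, hpv⟩ := ac_clm_deriv hac p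
        have hadd := (hi.mono le_rfl hts.1 hts.2).integral_add ht.1.le hle
        -- Integrating the minorant turns its linear part into `p` of a coordinate increment, which
        -- passes to the pointwise limit although the velocities need not converge.
        have hmono : ∫ τ in t..(t + s), ((ℓ₀ - p w₀ - ε * (1 + R + ‖w₀‖)) +
            p (deriv (fun r => φ (γs i r)) τ)) ≤
            ∫ τ in t..(t + s), (1 + ε) * lagrangianAlong L (γs i) τ := by
          refine intervalIntegral.integral_mono_on_of_le_Ioo hle
            (intervalIntegrable_const.add hpi) (hadm.integrable.const_mul _) fun τ hτ => ?_
          have hτ' := Ioo_subset_Icc_self hτ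
          have hq := (hin τ hτ').2
          rw [mem_preimage, Metric.mem_closedBall, dist_eq_norm] at hq
          set v := deriv (fun r => φ (γs i r)) τ with hv
          have hlag : lagrangianAlong L (γs i) τ =
              chartLagrangian L (γ t) (φ (γs i τ)) v τ :=
            lagrangian_velocity (continuousAt_of_mem_Ioo hadm.ac.1 hτ) (hmaps hτ')
          have h1 := hmin (φ (γs i τ)) τ
            (hq.trans_lt ((min_le_right _ _).trans_lt (by linarith)))
            (by rw [abs_of_pos (sub_pos.2 hτ.1)]; linarith [hτ.2]) v
          have h2 := hR (φ (γs i τ)) (by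
            rw [Metric.mem_closedBall, dist_eq_norm]
            exact hq.trans (min_le_left _ _)) v τ
          rw [← hlag] at h1 h2
          have h3 : ε * ‖v - w₀‖ ≤ ε * (lagrangianAlong L (γs i) τ + R + ‖w₀‖) := by
            gcongr
            exact (norm_sub_le _ _).trans (by linarith)
          rw [map_sub] at h1
          linarith
        rw [intervalIntegral.integral_add intervalIntegrable_const hpi, hpv,
          intervalIntegral.integral_const, intervalIntegral.integral_const_mul, smul_eq_mul,
          add_sub_cancel_left] at hmono
        calc _ ≤ (1 + ε) * ∫ τ in t..(t + s), lagrangianAlong L (γs i) τ := hmono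
          _ = _ := by rw [← hadd]; ring
      have hsrc : γ (t + s) ∈ (chartAt E (γ t)).source :=
        ((isClosed_chartBall ((Metric.closedBall_subset_closedBall
          (min_le_left _ _)).trans hball)).mem_of_tendsto (h.lim _ hts) (hconf.mono fun i hi =>
            hi _ hts (by rw [add_sub_cancel_left, abs_of_pos hs0]; exact hs2))).1
      have hl : Tendsto (fun i => s * (ℓ₀ - p w₀ - ε * (1 + R + ‖w₀‖)) +
          p (φ (γs i (t + s)) - φ (γs i t))) U
          (𝓝 (s * (ℓ₀ - p w₀ - ε * (1 + R + ‖w₀‖)) + p (φ (γ (t + s)) - φ (γ t)))) :=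
        tendsto_const_nhds.add ((p.continuous.tendsto _).comp
          ((h.tendsto_chart hts hsrc).sub (h.tendsto_chart htI hx)))
      exact le_of_tendsto_of_tendsto hl
        ((((hF _ hts).sub (hF t htI)).sub tendsto_const_nhds).const_mul (1 + ε)) hev
    have hpos : 0 < min (min δ₁ δ₂) (b - t) := by
      have := sub_pos.2 ht.2
      positivity
    -- After division by `s`, the increment of the limit curve tends to `w₀`, and `p w₀` cancels.
    have hFt := hF'.tendsto_slope_zero_right
    have hqt := (p.continuous.tendsto _).comp hqd.tendsto_slope_zero_right
    have hlim1 : Tendsto (fun s : ℝ => (ℓ₀ - p w₀ - ε * (1 + R + ‖w₀‖)) +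
        p (s⁻¹ • (φ (γ (t + s)) - φ (γ t)))) (𝓝[>] 0)
        (𝓝 ((ℓ₀ - p w₀ - ε * (1 + R + ‖w₀‖)) + p w₀)) := tendsto_const_nhds.add hqt
    have hlim2 : Tendsto (fun s : ℝ => (1 + ε) * (s⁻¹ • (F (t + s) - F t) - C)) (𝓝[>] 0)
        (𝓝 ((1 + ε) * (F' - C))) := (hFt.sub tendsto_const_nhds).const_mul _
    have := le_of_tendsto_of_tendsto hlim1 hlim2 (by
      filter_upwards [Ioo_mem_nhdsGT hpos] with s hs
      have hs0 := hs.1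
      have h1 := mul_le_mul_of_nonneg_left (hineq s hs) (inv_pos.2 hs0).le
      rw [map_smul, smul_eq_mul, smul_eq_mul]
      have e1 : s⁻¹ * (s * (ℓ₀ - p w₀ - ε * (1 + R + ‖w₀‖)) + p (φ (γ (t + s)) - φ (γ t))) =
          (ℓ₀ - p w₀ - ε * (1 + R + ‖w₀‖)) + s⁻¹ * p (φ (γ (t + s)) - φ (γ t)) := by
        rw [mul_add, inv_mul_cancel_left₀ hs0.ne']
      have e2 : s⁻¹ * ((1 + ε) * (F (t + s) - F t - C * s)) =
          (1 + ε) * (s⁻¹ * (F (t + s) - F t) - C) := by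
        field_simp
      rwa [e1, e2] at h1)
    linarith
  rw [hval]
  have hlim1 : Tendsto (fun ε : ℝ => ℓ₀ - ε * (1 + R + ‖w₀‖)) (𝓝[>] 0)
      (𝓝 (ℓ₀ - 0 * (1 + R + ‖w₀‖))) :=
    (Continuous.tendsto (by fun_prop) 0).mono_left nhdsWithin_le_nhds
  have hlim2 : Tendsto (fun ε : ℝ => (1 + ε) * (F' - C)) (𝓝[>] 0) (𝓝 ((1 + 0) * (F' - C))) :=
    (Continuous.tendsto (by fun_prop) 0).mono_left nhdsWithin_le_nhds
  have := le_of_tendsto_of_tendsto hlim1 hlim2 (eventually_mem_nhdsWithin.mono fun ε hε => key ε hε)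
  linarith

end IsBoundedLimit

/-- Tonelli's theorem: lower semicontinuity of the action along pointwise limits. -/
theorem IsBoundedLimit.admissible [CompactSpace M] [T2Space M] {ι : Type*} {U : Ultrafilter ι}
    {γs : ι → ℝ → M} {γ : ℝ → M} {a b A : ℝ} (hL : IsPeriodicTonelli L)
    (h : IsBoundedLimit L (U : Filter ι) γs γ a b A) :
    Admissible L γ a b ∧ ∫ τ in a..b, lagrangianAlong L γ τ ≤ A := by
  obtain ⟨C, hC0, hC⟩ := hL.exists_lower_bound
  have hab := h.le
  -- Since `L + C ≥ 0`, these functions are nondecreasing in `t`. The ultrafilter gives a limit at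
  -- every time without extracting subsequences.
  let I : ι → ℝ → ℝ := fun i t => (∫ τ in a..t, lagrangianAlong L (γs i) τ) + C * (t - a)
  have hImono : ∀ᶠ i in (U : Filter ι), ∀ s ∈ Icc a b, ∀ t ∈ Icc a b, s ≤ t → I i s ≤ I i t := by
    filter_upwards [h.adm] with i hi s hs t ht hst
    have h1 := (hi.mono le_rfl ht.1 ht.2).integral_add hs.1 hst
    have h2 := (hi.mono hs.1 hst ht.2).integral_ge hC
    simp only [I]
    linarith
  have hIa : ∀ i, I i a = 0 := fun i => by simp [I]
  have hIb : ∀ᶠ i in (U : Filter ι), I i b ≤ A + C * (b - a) := by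
    filter_upwards [h.bound] with i hi
    simp only [I]
    linarith
  have hex : ∀ t ∈ Icc a b, ∃ y, Tendsto (fun i => I i t) (U : Filter ι) (𝓝 y) := by
    intro t ht
    have hmem : ∀ᶠ i in (U : Filter ι), I i t ∈ Icc 0 (A + C * (b - a)) := by
      filter_upwards [hImono, hIb] with i h1 h2
      refine ⟨?_, (h1 t ht b ⟨hab, le_rfl⟩ ht.2).trans h2⟩
      rw [← hIa i]
      exact h1 a ⟨le_rfl, hab⟩ t ht ht.1
    obtain ⟨y, -, hy⟩ := isCompact_Icc.ultrafilter_le_nhds (U.map fun i => I i t)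
      (by rw [le_principal_iff]; exact hmem)
    exact ⟨y, hy⟩
  choose! F hF using hex
  have hFmono : MonotoneOn F (uIcc a b) := by
    rw [uIcc_of_le hab]
    intro s hs t ht hst
    exact le_of_tendsto_of_tendsto (hF s hs) (hF t ht)
      (hImono.mono fun i hi => hi s hs t ht hst)
  have hFa : F a = 0 := tendsto_nhds_unique (hF a ⟨le_rfl, hab⟩) (by
    simp only [hIa]; exact tendsto_const_nhds)
  have hFb : F b ≤ A + C * (b - a) := le_of_tendsto (hF b ⟨hab, le_rfl⟩) hIb
  have hac := h.isACCurve hL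
  have hae : ∀ᵐ t : ℝ, t ∈ Ioo a b → lagrangianAlong L γ t + C ≤ deriv F t := by
    filter_upwards [hac.ae_mdifferentiableAt hab, hFmono.ae_differentiableWithinAt_of_mem]
      with t h1 h2 ht
    have h3 := h2 (by rw [uIcc_of_le hab]; exact Ioo_subset_Icc_self ht)
    rw [uIcc_of_le hab] at h3
    exact h.lagrangian_le_deriv hL hF ht
      (h3.differentiableAt (Icc_mem_nhds ht.1 ht.2)).hasDerivAt (h1 ht)
  have hFi := hFmono.intervalIntegrable_deriv
  -- Only an inequality is available, since the monotone limit `F` may have a singular part; this is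
  -- where action can be lost in the limit.
  have hFint : ∫ t in a..b, deriv F t ≤ A + C * (b - a) := by
    have h1 := hFmono.intervalIntegral_deriv_mem_uIcc
    rw [uIcc_of_le (sub_nonneg.2 (hFmono left_mem_uIcc right_mem_uIcc hab)), hFa] at h1
    linarith [h1.2]
  have hae' : ∀ᵐ t ∂volume.restrict (uIoc a b), ‖lagrangianAlong L γ t + C‖ ≤ deriv F t := by
    rw [uIoc_of_le hab, restrict_Ioc_eq_restrict_Icc, ← restrict_Ioo_eq_restrict_Icc,
      ae_restrict_iff' measurableSet_Ioo]
    filter_upwards [hae] with t ht hmem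
    rw [Real.norm_of_nonneg (by
      have := hC (velocity E γ t) t
      unfold lagrangianAlong
      linarith)]
    exact ht hmem
  have hint' : IntervalIntegrable (fun t => lagrangianAlong L γ t + C) volume a b := by
    refine hFi.mono_fun' ?_ hae'
    rw [uIoc_of_le hab]
    exact (hL.aestronglyMeasurable_along hab hac.1).add aestronglyMeasurable_const
  have hint : IntervalIntegrable (lagrangianAlong L γ) volume a b := by
    simpa using hint'.sub (intervalIntegrable_const (c := C))
  refine ⟨⟨hab, hac, hint⟩, ?_⟩
  have h1 : ∫ t in a..b, (lagrangianAlong L γ t + C) ≤ ∫ t in a..b, deriv F t := by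
    rw [intervalIntegral.integral_of_le hab, intervalIntegral.integral_of_le hab]
    rw [uIoc_of_le hab] at hae'
    refine integral_mono_ae ((intervalIntegrable_iff_integrableOn_Ioc_of_le hab).1 hint')
      ((intervalIntegrable_iff_integrableOn_Ioc_of_le hab).1 hFi) ?_
    filter_upwards [hae'] with t ht
    exact (le_abs_self _).trans ht
  rw [intervalIntegral.integral_add hint intervalIntegrable_const,
    intervalIntegral.integral_const, smul_eq_mul, mul_comm] at h1
  linarith

end Tonelli

/-! ### The critical value, bounds on critical actions, and the barrier -/

section Critical

variable {E : Type*} [NormedAddCommGroup E] [NormedSpace ℝ E] [FiniteDimensional ℝ E]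
  {M : Type*} [TopologicalSpace M] [ChartedSpace E M] [IsManifold 𝓘(ℝ, E) ∞ M]
  {L : TangentBundle 𝓘(ℝ, E) M → ℝ → ℝ}

theorem Admissible.action_eq {γ : ℝ → M} {a b : ℝ} (h : Admissible L γ a b) (k : ℝ) :
    action L k γ a b = (((∫ τ in a..b, lagrangianAlong L γ τ) + k * (b - a) : ℝ) : EReal) := by
  have hi : IntervalIntegrable (fun τ => L (velocity E γ τ) τ + k) volume a b :=
    h.integrable.add intervalIntegrable_const
  rw [action, if_pos hi]
  congr 1
  have := intervalIntegral.integral_add h.integrable (intervalIntegrable_const (c := k))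
  rw [intervalIntegral.integral_const, smul_eq_mul, mul_comm] at this
  exact this

theorem admissible_of_action_ne_top {γ : ℝ → M} {a b k : ℝ} (hab : a ≤ b)
    (hac : IsACCurve E γ a b) (h : action L k γ a b ≠ ⊤) : Admissible L γ a b := by
  refine ⟨hab, hac, ?_⟩
  by_contra hn
  refine h (if_neg fun hi => hn ?_)
  have := hi.sub (intervalIntegrable_const (c := k))
  simp only [add_sub_cancel_right] at this
  exact this

/-- Curves of infinite action impose no condition, so only real inequalities remain. -/
theorem closed_nonneg_iff {k : ℝ} :
    (∀ (γ : ℝ → M) (a b : ℝ), IsClosedCurve E γ a b → 0 ≤ action L k γ a b) ↔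
      ∀ (x : M) (s : ℝ) (m : ℕ) (A : ℝ), Connects L x s x (s + m) A → 0 ≤ A + k * m := by
  constructor
  · rintro h x s m A ⟨γ, hγ, h1, h2, h3⟩
    have := h γ s (s + m) ⟨hγ.le, hγ.ac, h1.trans h2.symm, m, by simp⟩
    rw [hγ.action_eq, add_sub_cancel_left] at this
    have := EReal.coe_nonneg.1 this
    linarith
  · rintro h γ a b ⟨hab, hac, heq, m, hm⟩
    by_cases htop : action L k γ a b = ⊤
    · rw [htop]; exact le_top
    have hγ := admissible_of_action_ne_top hab hac htop
    have hm0 : 0 ≤ m := by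
      have : (0 : ℝ) ≤ m := by rw [← hm]; linarith
      exact_mod_cast this
    lift m to ℕ using hm0
    have hb : b = a + m := by
      have : ((m : ℤ) : ℝ) = (m : ℝ) := by simp
      linarith
    subst hb
    rw [hγ.action_eq, add_sub_cancel_left]
    have := hγ.connects
    rw [← heq] at this
    exact EReal.coe_nonneg.2 (h _ _ _ _ this)

/-- The values `k` for which closed curves have nonnegative `(L+k)`-action. -/
def nonnegativeLevels (L : TangentBundle 𝓘(ℝ, E) M → ℝ → ℝ) : Set ℝ :=
  {k : ℝ | ∀ (x : M) (s : ℝ) (m : ℕ) (A : ℝ), Connects L x s x (s + m) A → 0 ≤ A + k * m}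

theorem criticalValue_eq : criticalValue L = sInf (nonnegativeLevels L) := by
  unfold criticalValue nonnegativeLevels
  simp only [closed_nonneg_iff]

namespace IsPeriodicTonelli

section

variable [CompactSpace M] [ConnectedSpace M]

theorem nonnegativeLevels_nonempty (hL : IsPeriodicTonelli L) :
    (nonnegativeLevels L).Nonempty := by
  obtain ⟨C, hC0, hC⟩ := hL.exists_lower_bound
  refine ⟨C, fun x s m A ⟨γ, hγ, _, _, hA⟩ => ?_⟩
  have := hγ.integral_ge hC
  rw [add_sub_cancel_left] at this
  linarith

theorem nonnegativeLevels_bddBelow (hL : IsPeriodicTonelli L) :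
    BddBelow (nonnegativeLevels L) := by
  obtain ⟨C, hC⟩ := hL.uniformlyConnected 1 1 one_pos
  obtain ⟨x⟩ := (inferInstance : Nonempty M)
  refine ⟨-C, fun k hk => ?_⟩
  have := hk x 0 1 C (hC x (mem_univ _) x (mem_univ _) _ _ (by simp) (by simp))
  simp only [Nat.cast_one, mul_one] at this
  linarith

/-- The condition is closed and monotone in `k`, hence it holds at the infimum itself. -/
theorem closed_nonneg (hL : IsPeriodicTonelli L) {x : M} {s : ℝ} {m : ℕ} {A : ℝ}
    (h : Connects L x s x (s + m) A) : 0 ≤ A + criticalValue L * m := by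
  have key : ∀ ε > 0, 0 ≤ A + (criticalValue L + ε) * m := fun ε hε => by
    obtain ⟨k, hk, hlt⟩ := exists_lt_of_csInf_lt hL.nonnegativeLevels_nonempty
      (show sInf (nonnegativeLevels L) < criticalValue L + ε by rw [criticalValue_eq]; linarith)
    have h1 := hk x s m A h
    have : k * m ≤ (criticalValue L + ε) * m := by gcongr
    linarith
  have hlim : Tendsto (fun ε : ℝ => A + (criticalValue L + ε) * m) (𝓝[>] 0)
      (𝓝 (A + (criticalValue L + 0) * m)) :=
    (Continuous.tendsto (by fun_prop) 0).mono_left nhdsWithin_le_nhds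
  have := ge_of_tendsto hlim (eventually_mem_nhdsWithin.mono fun ε hε => key ε hε)
  simpa using this

theorem criticalValue_le (hL : IsPeriodicTonelli L) {k : ℝ} (hk : k ∈ nonnegativeLevels L) :
    criticalValue L ≤ k := by
  rw [criticalValue_eq]
  exact csInf_le hL.nonnegativeLevels_bddBelow hk

/-- The critical action of curves is bounded from below. -/
theorem exists_critical_lower_bound (hL : IsPeriodicTonelli L) :
    ∃ C > 0, ∀ (x y : M) (s t A : ℝ), Connects L x s y t A →
      -C ≤ A + criticalValue L * (t - s) := by
  obtain ⟨C₁, hC₁⟩ := hL.uniformlyConnected 1 2 one_pos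
  set c := criticalValue L with hc
  refine ⟨|C₁| + 2 * |c| + 1, by positivity, fun x y s t A h => ?_⟩
  have hts : 0 ≤ t - s := sub_nonneg.2 h.le
  -- The extra unit gives the closing arc, of duration `m - (t - s)`, a length in `[1, 2)`.
  set m : ℕ := ⌈t - s⌉₊ + 1 with hm
  have h1 : t - s ≤ ⌈t - s⌉₊ := Nat.le_ceil _
  have h2 : (⌈t - s⌉₊ : ℝ) < t - s + 1 := Nat.ceil_lt_add_one hts
  have hmr : (m : ℝ) = ⌈t - s⌉₊ + 1 := by rw [hm]; push_cast; ring
  have h3 := h.trans (hC₁ y (mem_univ _) x (mem_univ _) t (s + m) (by linarith) (by linarith))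
  have h4 := hL.closed_nonneg h3
  rw [← hc] at h4
  have h5 : c * (m - (t - s)) ≤ 2 * |c| := by
    calc c * (m - (t - s)) ≤ |c| * (m - (t - s)) := by
          gcongr
          · linarith
          · exact le_abs_self c
      _ ≤ |c| * 2 := by gcongr; linarith
      _ = _ := by ring
  have := le_abs_self C₁
  linarith

theorem connects_iterate (hL : IsPeriodicTonelli L) {x : M} {s A : ℝ} {m : ℕ}
    (h : Connects L x s x (s + m) A) (j : ℕ) :
    Connects L x s x (s + ((j + 1 : ℕ) * m : ℝ)) ((j + 1 : ℕ) * A) := by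
  induction j with
  | zero => simpa using h
  | succ j ih =>
    have h1 := hL.connects_add_int h (((j + 1) * m : ℕ) : ℤ)
    have e1 : s + (((j + 1) * m : ℕ) : ℤ) = s + ((j + 1 : ℕ) * m : ℝ) := by push_cast; ring
    have e2 : s + m + (((j + 1) * m : ℕ) : ℤ) = s + ((j + 1 + 1 : ℕ) * m : ℝ) := by
      push_cast; ring
    rw [e1, e2] at h1
    have h2 := ih.trans h1
    have e3 : ((j + 1 : ℕ) : ℝ) * A + A = ((j + 1 + 1 : ℕ) : ℝ) * A := by push_cast; ring
    rwa [e3] at h2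

theorem sum_pieces {γ : ℝ → M} {s B : ℝ} {n : ℕ} (j : ℕ)
    (hγ : Admissible L γ s (s + j * n))
    (hB : ∀ (x y : M) (r A : ℝ), Connects L x r y (r + n) A → B ≤ A) :
    j * B ≤ ∫ τ in s..(s + j * n), lagrangianAlong L γ τ := by
  induction j with
  | zero => simp
  | succ j ih =>
    have hn : (0 : ℝ) ≤ n := Nat.cast_nonneg n
    have h0 : s ≤ s + j * n := by have : (0 : ℝ) ≤ j * n := by positivity
                                  linarith
    have h1 : s + j * n + n = s + (j + 1 : ℕ) * n := by push_cast; ring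
    rw [← h1] at hγ ⊢
    have h2 : s + j * n ≤ s + j * n + n := by linarith
    have h3 := ih (hγ.mono le_rfl h0 h2)
    have h4 := hB _ _ _ _ (hγ.mono h0 h2 le_rfl).connects
    rw [← hγ.integral_add h0 h2]
    push_cast
    linarith

/-- Otherwise every piece of duration `n` has `(L+c)`-action above `1`, which leaves room to lower
the critical value by `1 / n`. -/
theorem exists_connects_critical (hL : IsPeriodicTonelli L) {n : ℕ} (hn : 0 < n) :
    ∃ (x y : M) (s : ℝ), Connects L x s y (s + n) (1 - criticalValue L * n) := by
  by_contra hcon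
  push Not at hcon
  have hn' : (0 : ℝ) < n := by exact_mod_cast hn
  set c := criticalValue L with hc
  have hB : ∀ (x y : M) (r A : ℝ), Connects L x r y (r + n) A → 1 - c * n ≤ A :=
    fun x y r A h => le_of_lt (not_le.1 fun hle => hcon x y r (h.mono hle))
  have hmem : c - 1 / n ∈ nonnegativeLevels L := by
    intro x s m A h
    -- A closed curve of period `m` run `n` times has duration `m * n` and splits into `m` pieces of
    -- duration `n`, whence `m * (1 - c * n) ≤ n * A`.
    obtain ⟨γ, hγ, -, -, hA⟩ := hL.connects_iterate h (n - 1)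
    rw [Nat.sub_add_cancel hn] at hγ hA
    rw [mul_comm (n : ℝ) (m : ℝ)] at hγ hA
    have h1 := (sum_pieces m hγ hB).trans hA
    have h2 : (m : ℝ) * (1 - c * n) = n * (m * (1 / n) - c * m) := by field_simp
    rw [h2] at h1
    have := le_of_mul_le_mul_left h1 hn'
    linarith
  have h1 := hL.criticalValue_le hmem
  have : 0 < 1 / (n : ℝ) := by positivity
  linarith

/-- Any two points are joined by curves of bounded critical action, for all long durations. -/
theorem exists_critical_upper_bound (hL : IsPeriodicTonelli L) :
    ∃ C > 0, ∀ (x y : M) (s t : ℝ), s + 3 ≤ t →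
      Connects L x s y t (C - criticalValue L * (t - s)) := by
  obtain ⟨C₁, hC₁⟩ := hL.uniformlyConnected (1 / 2) (5 / 2) (by norm_num)
  set c := criticalValue L with hc
  refine ⟨2 * |C₁| + 1 + 3 * |c|, by positivity, fun x y s t hst => ?_⟩
  obtain ⟨N, hN⟩ : ∃ N : ℕ, N = ⌊t - s⌋₊ := ⟨_, rfl⟩
  have hN1 : (N : ℝ) ≤ t - s := by rw [hN]; exact Nat.floor_le (by linarith)
  have hN2 : t - s < N + 1 := by rw [hN]; exact Nat.lt_floor_add_one _
  have hN3 : 3 ≤ N := by rw [hN]; exact Nat.le_floor (by norm_num; linarith)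
  obtain ⟨n, rfl⟩ : ∃ n, N = n + 2 := ⟨N - 2, by omega⟩
  push_cast at hN1 hN2
  obtain ⟨x', y', s', h'⟩ := hL.exists_connects_critical (n := n) (by omega)
  -- With `n = ⌊t - s⌋ - 2`, the translated middle curve starts in `[s + 1/2, s + 3/2)`; both
  -- connecting arcs then have durations in `[1/2, 5/2]`.
  have hz := hL.connects_add_int h' ⌈s + 1 / 2 - s'⌉
  have hz1 := Int.le_ceil (s + 1 / 2 - s')
  have hz2 := Int.ceil_lt_add_one (s + 1 / 2 - s')
  set z : ℝ := (⌈s + 1 / 2 - s'⌉ : ℝ)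
  have a1 := hC₁ x (mem_univ _) x' (mem_univ _) s (s' + z) (by linarith) (by linarith)
  have a2 := hC₁ y' (mem_univ _) y (mem_univ _) (s' + n + z) t (by linarith) (by linarith)
  refine ((a1.trans hz).trans a2).mono ?_
  have h5 : c * (t - s - n) ≤ 3 * |c| := by
    calc c * (t - s - n) ≤ |c| * (t - s - n) := by
          gcongr
          · linarith
          · exact le_abs_self c
      _ ≤ |c| * 3 := by gcongr; linarith
      _ = _ := by ring
  rw [← hc]
  have := le_abs_self C₁
  linarith

end

theorem actionPotentialN_le (k : ℝ) {x y : M} {s t A : ℝ} {n : ℕ} (hn : ⌊t - s⌋ = (n : ℤ))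
    (h : Connects L x s y t A) :
    actionPotentialN L k n (x, (s : UnitAddCircle)) (y, (t : UnitAddCircle)) ≤
      ((A + k * (t - s) : ℝ) : EReal) := by
  obtain ⟨γ, hγ, h1, h2, h3⟩ := h
  have hj : Joins E (x, (s : UnitAddCircle)) (y, (t : UnitAddCircle)) n γ s t :=
    ⟨hγ.le, hγ.ac, h1, h2, rfl, rfl, hn⟩
  have hle : actionPotentialN L k n (x, (s : UnitAddCircle)) (y, (t : UnitAddCircle)) ≤
      action L k γ s t := sInf_le ⟨γ, s, t, hj, rfl⟩
  refine hle.trans ?_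
  rw [hγ.action_eq]
  exact EReal.coe_le_coe_iff.2 (by linarith)

theorem exists_int_of_coe_eq {a b : ℝ} (h : (a : UnitAddCircle) = b) : ∃ n : ℤ, a = b + n := by
  rw [← sub_eq_zero, ← AddCircle.coe_sub, AddCircle.coe_eq_zero_iff] at h
  obtain ⟨n, hn⟩ := h
  exact ⟨n, by simp at hn; linarith⟩

/-- The endpoint classes determine `b - a` modulo `1` and the integer part fixes it, so `[a, b]` is
an integer translate of `[s, t]`. -/
theorem exists_connects_of_joins (hL : IsPeriodicTonelli L) {k : ℝ} {x y : M} {s t a b : ℝ}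
    {γ : ℝ → M} {n : ℕ} (hn : ⌊t - s⌋ = (n : ℤ))
    (h : Joins E (x, (s : UnitAddCircle)) (y, (t : UnitAddCircle)) n γ a b)
    (htop : action L k γ a b ≠ ⊤) :
    ∃ A, Connects L x s y t A ∧ action L k γ a b = ((A + k * (t - s) : ℝ) : EReal) := by
  obtain ⟨hab, hac, h1, h2, h3, h4, h5⟩ := h
  have hγ := admissible_of_action_ne_top hab hac htop
  obtain ⟨z, hz⟩ := exists_int_of_coe_eq h3
  obtain ⟨z', hz'⟩ := exists_int_of_coe_eq h4
  have hzz : z' = z := by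
    have : b - a = t - s + ((z' - z : ℤ) : ℝ) := by rw [hz, hz']; push_cast; ring
    rw [this, Int.floor_add_intCast, hn] at h5
    omega
  subst hzz
  have hc := hL.connects_add_int hγ.connects (-z')
  have e1 : a + ((-z' : ℤ) : ℝ) = s := by rw [hz]; push_cast; ring
  have e2 : b + ((-z' : ℤ) : ℝ) = t := by rw [hz']; push_cast; ring
  rw [e1, e2, h1, h2] at hc
  refine ⟨_, hc, ?_⟩
  rw [hγ.action_eq, hz, hz']
  congr 2
  ring

theorem le_actionPotentialN (hL : IsPeriodicTonelli L) {k : ℝ} {x y : M} {s t : ℝ} {n : ℕ}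
    (hn : ⌊t - s⌋ = (n : ℤ)) {B : ℝ}
    (h : ∀ A, Connects L x s y t A → B ≤ A + k * (t - s)) :
    (B : EReal) ≤ actionPotentialN L k n (x, (s : UnitAddCircle)) (y, (t : UnitAddCircle)) := by
  refine le_sInf ?_
  rintro _ ⟨γ, a, b, hj, rfl⟩
  by_cases htop : action L k γ a b = ⊤
  · rw [htop]; exact le_top
  obtain ⟨A, hA, heq⟩ := hL.exists_connects_of_joins hn hj htop
  rw [heq]
  exact EReal.coe_le_coe_iff.2 (h A hA)

theorem exists_connects_of_lt (hL : IsPeriodicTonelli L) {k : ℝ} {x y : M} {s t : ℝ} {n : ℕ}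
    (hn : ⌊t - s⌋ = (n : ℤ)) {B : ℝ}
    (h : actionPotentialN L k n (x, (s : UnitAddCircle)) (y, (t : UnitAddCircle)) < B) :
    ∃ A, Connects L x s y t A ∧ A + k * (t - s) < B := by
  obtain ⟨_, ⟨γ, a, b, hj, rfl⟩, hlt⟩ := sInf_lt_iff.1 h
  obtain ⟨A, hA, heq⟩ := hL.exists_connects_of_joins hn hj hlt.ne_top
  rw [heq] at hlt
  exact ⟨A, hA, EReal.coe_lt_coe_iff.1 hlt⟩

section

variable [CompactSpace M] [ConnectedSpace M]

theorem peierls_bounds (hL : IsPeriodicTonelli L) (P Q : M × UnitAddCircle) :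
    peierlsBarrier L (criticalValue L) P Q ≠ ⊤ ∧ peierlsBarrier L (criticalValue L) P Q ≠ ⊥ := by
  obtain ⟨x, σ⟩ := P
  obtain ⟨y, τ⟩ := Q
  induction σ using QuotientAddGroup.induction_on with | H s => ?_
  induction τ using QuotientAddGroup.induction_on with | H t' => ?_
  obtain ⟨t, ht, hst⟩ : ∃ t : ℝ, (t : UnitAddCircle) = t' ∧ ⌊t - s⌋ = 0 :=
    ⟨t' - ⌊t' - s⌋, by
      have h := AddCircle.coe_sub (p := (1 : ℝ)) t' ((⌊t' - s⌋ : ℤ) : ℝ)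
      rw [h]
      have h0 : (((⌊t' - s⌋ : ℤ) : ℝ) : UnitAddCircle) = 0 :=
        (AddCircle.coe_eq_zero_iff 1).2 ⟨⌊t' - s⌋, by simp⟩
      rw [h0, sub_zero], by
      rw [sub_right_comm, Int.floor_sub_intCast, sub_self]⟩
  have hfl : ∀ n : ℕ, ⌊(t + n) - s⌋ = (n : ℤ) := fun n => by
    rw [add_sub_right_comm, Int.floor_add_natCast, hst, zero_add]
  have hcoe : ∀ n : ℕ, ((t + n : ℝ) : UnitAddCircle) = t' := fun n => by
    rw [AddCircle.coe_add, ht]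
    have h0 : ((n : ℝ) : UnitAddCircle) = 0 := (AddCircle.coe_eq_zero_iff 1).2 ⟨n, by simp⟩
    rw [h0, add_zero]
  have ht0 : s ≤ t := by
    have := Int.floor_le (t - s)
    rw [hst] at this
    push_cast at this
    linarith
  constructor
  · obtain ⟨C, -, hC⟩ := hL.exists_critical_upper_bound
    refine ne_top_of_le_ne_top (EReal.coe_ne_top C) ?_
    refine liminf_le_of_frequently_le' (Eventually.frequently ?_)
    filter_upwards [eventually_ge_atTop 3] with n hn
    have hn' : (3 : ℝ) ≤ n := by exact_mod_cast hn
    have := actionPotentialN_le (criticalValue L) (hfl n)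
      (hC x y s (t + n) (by linarith))
    rw [hcoe] at this
    simpa using this
  · obtain ⟨C, -, hC⟩ := hL.exists_critical_lower_bound
    refine ne_bot_of_le_ne_bot (EReal.coe_ne_bot (-C)) ?_
    refine le_liminf_of_le (by isBoundedDefault) (Eventually.of_forall fun n => ?_)
    have := hL.le_actionPotentialN (k := criticalValue L) (hfl n) (B := -C)
      (fun A hA => hC x y s (t + n) A hA)
    rwa [hcoe] at this

end

end IsPeriodicTonelli

/-- The real-valued Peierls barrier at the critical value, between points of `M × ℝ`. -/
def barrier (L : TangentBundle 𝓘(ℝ, E) M → ℝ → ℝ) (x : M) (s : ℝ) (y : M) (t : ℝ) : ℝ :=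
  (peierlsBarrier L (criticalValue L) (x, (s : UnitAddCircle)) (y, (t : UnitAddCircle))).toReal

namespace IsPeriodicTonelli

variable [CompactSpace M] [ConnectedSpace M]

theorem coe_barrier (hL : IsPeriodicTonelli L) (x : M) (s : ℝ) (y : M) (t : ℝ) :
    (barrier L x s y t : EReal) =
      peierlsBarrier L (criticalValue L) (x, (s : UnitAddCircle)) (y, (t : UnitAddCircle)) :=
  EReal.coe_toReal (hL.peierls_bounds _ _).1 (hL.peierls_bounds _ _).2

theorem coe_add_natCast (t : ℝ) (m : ℕ) : ((t + m : ℝ) : UnitAddCircle) = t := by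
  rw [AddCircle.coe_add]
  have h0 : ((m : ℝ) : UnitAddCircle) = 0 := (AddCircle.coe_eq_zero_iff 1).2 ⟨m, by simp⟩
  rw [h0, add_zero]

/-- The barrier is a limit of critical actions along long durations. -/
theorem exists_connects_lt_barrier (hL : IsPeriodicTonelli L) (x : M) (s : ℝ) (y : M) (t : ℝ)
    {ε : ℝ} (hε : 0 < ε) (N : ℕ) : ∃ m : ℕ, N ≤ m ∧ ∃ A, Connects L x s y (t + m) A ∧
      A + criticalValue L * (t + m - s) < barrier L x s y t + ε := by
  have hlt : peierlsBarrier L (criticalValue L) (x, (s : UnitAddCircle)) (y, (t : UnitAddCircle)) <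
      ((barrier L x s y t + ε : ℝ) : EReal) := by
    rw [← hL.coe_barrier]
    exact EReal.coe_lt_coe_iff.2 (by linarith)
  have hfr := frequently_lt_of_liminf_lt (by isBoundedDefault) hlt
  -- The index `n` is the integer part of the duration `t + m - s`, so `n` and `m` differ by `⌊t -
  -- s⌋`; the margin `natAbs` ensures `N ≤ m`.
  obtain ⟨n, hn, hn'⟩ := (hfr.and_eventually
    (eventually_ge_atTop (N + ⌊t - s⌋.natAbs))).exists
  have hm : 0 ≤ (n : ℤ) - ⌊t - s⌋ - N := by omega
  obtain ⟨m, hm'⟩ : ∃ m : ℕ, (m : ℤ) = n - ⌊t - s⌋ := ⟨((n : ℤ) - ⌊t - s⌋).toNat, by omega⟩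
  have hfl : ⌊(t + m) - s⌋ = (n : ℤ) := by
    rw [add_sub_right_comm, Int.floor_add_natCast]
    omega
  rw [← coe_add_natCast t m] at hn
  obtain ⟨A, hA, hA'⟩ := hL.exists_connects_of_lt hfl hn
  exact ⟨m, by omega, A, hA, hA'⟩

/-- The barrier is asymptotically a lower bound of critical actions along long durations. -/
theorem barrier_lt_of_connects (hL : IsPeriodicTonelli L) (x : M) (s : ℝ) (y : M) (t : ℝ)
    {ε : ℝ} (hε : 0 < ε) : ∃ N : ℕ, ∀ m : ℕ, N ≤ m → ∀ A, Connects L x s y (t + m) A →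
      barrier L x s y t - ε < A + criticalValue L * (t + m - s) := by
  have hlt : ((barrier L x s y t - ε : ℝ) : EReal) <
      peierlsBarrier L (criticalValue L) (x, (s : UnitAddCircle)) (y, (t : UnitAddCircle)) := by
    rw [← hL.coe_barrier]
    exact EReal.coe_lt_coe_iff.2 (by linarith)
  obtain ⟨N, hN⟩ := eventually_atTop.1 (eventually_lt_of_lt_liminf hlt (by isBoundedDefault))
  refine ⟨N + ⌊t - s⌋.natAbs, fun m hm A hA => ?_⟩
  obtain ⟨n, hn⟩ : ∃ n : ℕ, (n : ℤ) = m + ⌊t - s⌋ := ⟨((m : ℤ) + ⌊t - s⌋).toNat, by omega⟩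
  have hfl : ⌊(t + m) - s⌋ = (n : ℤ) := by
    rw [add_sub_right_comm, Int.floor_add_natCast]
    omega
  have h1 := hN n (by omega)
  have h2 := actionPotentialN_le (criticalValue L) hfl hA
  rw [coe_add_natCast] at h2
  exact EReal.coe_lt_coe_iff.1 (h1.trans_le h2)

/-- An integer translate of the given curve extends a long, almost optimal curve from `z` to `x` to
a long curve ending at `y`. -/
theorem barrier_sub_le_right (hL : IsPeriodicTonelli L) (z : M) (σ : ℝ) {x y : M} {s t A : ℝ}
    (h : Connects L x s y t A) :
    barrier L z σ y t - barrier L z σ x s ≤ A + criticalValue L * (t - s) := by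
  refine le_of_forall_pos_le_add fun ε hε => ?_
  obtain ⟨N, hN⟩ := hL.barrier_lt_of_connects z σ y t (half_pos hε)
  obtain ⟨m, hm, B, hB, hB'⟩ := hL.exists_connects_lt_barrier z σ x s (half_pos hε) N
  have h1 := hL.connects_add_int h m
  have h2 := hN m hm _ (hB.trans h1)
  linarith

theorem barrier_sub_le_left (hL : IsPeriodicTonelli L) (z : M) (σ : ℝ) {x y : M} {s t A : ℝ}
    (h : Connects L x s y t A) :
    barrier L x s z σ - barrier L y t z σ ≤ A + criticalValue L * (t - s) := by
  refine le_of_forall_pos_le_add fun ε hε => ?_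
  obtain ⟨N, hN⟩ := hL.barrier_lt_of_connects x s z σ (half_pos hε)
  obtain ⟨m, hm, B, hB, hB'⟩ := hL.exists_connects_lt_barrier y t z σ (half_pos hε) N
  have h2 := hN m hm _ (h.trans hB)
  linarith

theorem isDominated_of_connects {u : M × UnitAddCircle → ℝ}
    (h : ∀ (x y : M) (s t A : ℝ), Connects L x s y t A →
      u (y, (t : UnitAddCircle)) - u (x, (s : UnitAddCircle)) ≤
        A + criticalValue L * (t - s)) : IsDominated L u := by
  rintro ⟨x, σ⟩ ⟨y, τ⟩
  induction σ using QuotientAddGroup.induction_on with | H s => ?_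
  induction τ using QuotientAddGroup.induction_on with | H t' => ?_
  refine le_iInf fun n => ?_
  refine le_sInf ?_
  rintro _ ⟨γ, a, b, ⟨hab, hac, h1, h2, h3, h4, h5⟩, rfl⟩
  by_cases htop : action L (criticalValue L) γ a b = ⊤
  · rw [htop]; exact le_top
  have hγ := admissible_of_action_ne_top hab hac htop
  rw [hγ.action_eq]
  have := h _ _ _ _ _ hγ.connects
  rw [h1, h2, h3, h4] at this
  exact EReal.coe_le_coe_iff.2 this

end IsPeriodicTonelli

end Critical

/-! ### Calibrated curves and weak KAM solutions -/

section Calibration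

variable {E : Type*} [NormedAddCommGroup E] [NormedSpace ℝ E] [FiniteDimensional ℝ E]
  {M : Type*} [TopologicalSpace M] [ChartedSpace E M] [IsManifold 𝓘(ℝ, E) ∞ M]
  {L : TangentBundle 𝓘(ℝ, E) M → ℝ → ℝ}

namespace IsPeriodicTonelli

/-- At a time of differentiability of a pointwise limit of curves, the curves can be joined to the
limit curve in a short time at a proportional cost. -/
theorem connects_limit (hL : IsPeriodicTonelli L) {ι : Type*} {U : Filter ι} {γs : ι → ℝ → M}
    {γ : ℝ → M} {t : ℝ} (hγ : MDifferentiableAt 𝓘(ℝ, ℝ) 𝓘(ℝ, E) γ t)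
    (hlim : ∀ τ, Tendsto (fun i => γs i τ) U (𝓝 (γ τ))) :
    ∃ C > 0, ∃ δ₀ > 0, ∀ δ ∈ Ioo 0 δ₀,
      (∀ᶠ i in U, Connects L (γs i (t - δ)) (t - δ) (γ t) t (C * δ)) ∧
      ∀ᶠ i in U, Connects L (γ t) t (γs i (t + δ)) (t + δ) (C * δ) := by
  have hx := mem_chart_source E (γ t)
  -- Differentiability puts `γ (t ± δ)` within `K * δ` of `γ t` in the chart. Approximating curves
  -- are then eventually within `(K + 1) * δ`, and a segment of speed at most `K + 1` costs at most
  -- `C * δ`.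
  obtain ⟨K, hK, hbig⟩ := (differentiableAt_chart hγ hx).isBigO_sub.exists_pos
  obtain ⟨r, hr, hball⟩ := exists_closedBall_subset (E := E) hx
  obtain ⟨C, hC0, hC⟩ := hL.bounded_on_compact (isCompact_closedBall _ r) hball (K + 1)
  have hev := hbig.bound.and (hγ.continuousAt.eventually_mem
    ((chartAt E (γ t)).open_source.mem_nhds hx))
  obtain ⟨δ₁, hδ₁, hnear⟩ := Metric.eventually_nhds_iff.1 hev
  have key : ∀ τ δ, 0 < δ → (K + 1) * δ ≤ r → |τ - t| = δ → δ < δ₁ → ∀ᶠ i in U,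
      γs i τ ∈ (chartAt E (γ t)).source ∧
      ‖extChartAt 𝓘(ℝ, E) (γ t) (γs i τ) - extChartAt 𝓘(ℝ, E) (γ t) (γ t)‖ < (K + 1) * δ := by
    intro τ δ hδ _ hτ hlt
    obtain ⟨h1, h2⟩ := hnear (show dist τ t < δ₁ by rwa [Real.dist_eq, hτ])
    have h3 : Tendsto (fun i => ‖extChartAt 𝓘(ℝ, E) (γ t) (γs i τ) -
        extChartAt 𝓘(ℝ, E) (γ t) (γ t)‖) U
        (𝓝 ‖extChartAt 𝓘(ℝ, E) (γ t) (γ τ) - extChartAt 𝓘(ℝ, E) (γ t) (γ t)‖) :=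
      (((continuousAt_extChartAt' (by rwa [extChartAt_source])).tendsto.comp
        (hlim τ)).sub_const _).norm
    rw [Real.norm_eq_abs, hτ] at h1
    exact ((hlim τ).eventually_mem ((chartAt E (γ t)).open_source.mem_nhds h2)).and
      (h3.eventually_lt_const (h1.trans_lt (by linarith)))
  refine ⟨C, hC0, min δ₁ (r / (K + 1)), by positivity, fun δ hδ => ?_⟩
  have hδr : (K + 1) * δ ≤ r := by
    have := hδ.2.le.trans (min_le_right _ _)
    rw [le_div_iff₀ (by positivity)] at this
    linarith
  have hδ1 : δ < δ₁ := hδ.2.trans_le (min_le_left _ _)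
  have hcenter : extChartAt 𝓘(ℝ, E) (γ t) (γ t) ∈
      Metric.closedBall (extChartAt 𝓘(ℝ, E) (γ t) (γ t)) r := Metric.mem_closedBall_self hr.le
  constructor
  · filter_upwards [key (t - δ) δ hδ.1 hδr (by rw [sub_sub_cancel_left, abs_neg, abs_of_pos hδ.1])
      hδ1] with i hi
    have hmem : extChartAt 𝓘(ℝ, E) (γ t) (γs i (t - δ)) ∈
        Metric.closedBall (extChartAt 𝓘(ℝ, E) (γ t) (γ t)) r := by
      rw [Metric.mem_closedBall, dist_eq_norm]; exact hi.2.le.trans hδr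
    have := hL.connects_segment (convex_closedBall _ r) hball hmem hcenter
      (show t - δ < t by linarith [hδ.1]) (by
        rw [norm_sub_rev, sub_sub_cancel]; exact hi.2.le) hC
    rwa [(extChartAt 𝓘(ℝ, E) (γ t)).left_inv (by rw [extChartAt_source]; exact hi.1),
      (extChartAt 𝓘(ℝ, E) (γ t)).left_inv (by rw [extChartAt_source]; exact hx),
      sub_sub_cancel] at this
  · filter_upwards [key (t + δ) δ hδ.1 hδr (by rw [add_sub_cancel_left, abs_of_pos hδ.1])
      hδ1] with i hi
    have hmem : extChartAt 𝓘(ℝ, E) (γ t) (γs i (t + δ)) ∈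
        Metric.closedBall (extChartAt 𝓘(ℝ, E) (γ t) (γ t)) r := by
      rw [Metric.mem_closedBall, dist_eq_norm]; exact hi.2.le.trans hδr
    have := hL.connects_segment (convex_closedBall _ r) hball hcenter hmem
      (show t < t + δ by linarith [hδ.1]) (by
        rw [add_sub_cancel_left]; exact hi.2.le) hC
    rwa [(extChartAt 𝓘(ℝ, E) (γ t)).left_inv (by rw [extChartAt_source]; exact hx),
      (extChartAt 𝓘(ℝ, E) (γ t)).left_inv (by rw [extChartAt_source]; exact hi.1),
      add_sub_cancel_left] at this

variable [CompactSpace M] [T2Space M] [ConnectedSpace M]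

/-- Compactness yields a limit at every real time, although each curve will be controlled only on
its own interval. -/
theorem exists_ultralimit {ι : Type*} (U : Ultrafilter ι) (γs : ι → ℝ → M) :
    ∃ γ : ℝ → M, ∀ τ, Tendsto (fun i => γs i τ) (U : Filter ι) (𝓝 (γ τ)) := by
  have : ∀ τ, ∃ y, Tendsto (fun i => γs i τ) (U : Filter ι) (𝓝 y) := fun τ => by
    obtain ⟨y, -, hy⟩ := isCompact_univ.ultrafilter_le_nhds (U.map fun i => γs i τ) (by simp)
    exact ⟨y, hy⟩
  choose γ hγ using this
  exact ⟨γ, hγ⟩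

theorem le_of_forall_small {a b k δ₀ : ℝ} (hδ₀ : 0 < δ₀)
    (h : ∀ ε > 0, ∀ δ ∈ Ioo 0 δ₀, a ≤ b + ε + k * δ) : a ≤ b := by
  have hlim : Tendsto (fun δ : ℝ => b + δ + k * δ) (𝓝[>] 0) (𝓝 (b + 0 + k * 0)) :=
    (Continuous.tendsto (by fun_prop) 0).mono_left nhdsWithin_le_nhds
  have := ge_of_tendsto hlim (by
    filter_upwards [Ioo_mem_nhdsGT hδ₀] with δ hδ using h δ hδ.1 δ hδ)
  simpa using this

/-- Backward calibrated curves of the barrier. -/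
theorem exists_backward_calibrated (hL : IsPeriodicTonelli L) (z : M) (σ : ℝ) (x : M) (s : ℝ) :
    ∃ γ : ℝ → M, γ s = x ∧ ∀ t ≤ s, Admissible L γ t s ∧
      barrier L z σ x s - barrier L z σ (γ t) t =
        (∫ τ in t..s, lagrangianAlong L γ τ) + criticalValue L * (s - t) := by
  set c := criticalValue L with hc
  -- Almost optimal curves for the barrier are translated to end at the fixed time `s`, so that
  -- their starting times go to `-∞`.
  have hseq : ∀ j : ℕ, ∃ (m : ℕ) (γ : ℝ → M), j ≤ m ∧ Admissible L γ (σ - m) s ∧ γ (σ - m) = z ∧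
      γ s = x ∧ (∫ τ in (σ - m)..s, lagrangianAlong L γ τ) + c * (s + m - σ) <
        barrier L z σ x s + 1 / (j + 1) := by
    intro j
    obtain ⟨m, hm, A, hA, hlt⟩ := hL.exists_connects_lt_barrier z σ x s
      (ε := 1 / ((j : ℝ) + 1)) (by positivity) j
    have h1 := hL.connects_add_int hA (-(m : ℤ))
    have e1 : σ + ((-(m : ℤ) : ℤ) : ℝ) = σ - m := by push_cast; ring
    have e2 : s + m + ((-(m : ℤ) : ℤ) : ℝ) = s := by push_cast; ring
    rw [e1, e2] at h1
    obtain ⟨γ, a1, a2, a3, a4⟩ := h1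
    exact ⟨m, γ, hm, a1, a2, a3, by linarith⟩
  choose m γs hm hadm hz hx hact using hseq
  let U : Ultrafilter ℕ := hyperfilter ℕ
  have hU : (U : Filter ℕ) ≤ atTop := Nat.hyperfilter_le_atTop
  obtain ⟨γ, hlim⟩ := exists_ultralimit U γs
  have hγs : γ s = x := tendsto_nhds_unique (hlim s) (by simp only [hx]; exact tendsto_const_nhds)
  have hmt : ∀ (N : ℕ), ∀ᶠ j in (U : Filter ℕ), N ≤ m j := fun N =>
    hU (by filter_upwards [eventually_ge_atTop N] with j hj using hj.trans (hm j))
  have hat : ∀ t : ℝ, ∀ᶠ j in (U : Filter ℕ), σ - m j ≤ t := fun t => by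
    filter_upwards [hmt ⌈σ - t⌉₊] with j hj
    have h1 := Nat.le_ceil (σ - t)
    have h2 : (⌈σ - t⌉₊ : ℝ) ≤ m j := by exact_mod_cast hj
    linarith
  have hsmall : ∀ ε > 0, ∀ᶠ j : ℕ in (U : Filter ℕ), 1 / ((j : ℝ) + 1) < ε := fun ε hε =>
    hU (tendsto_one_div_add_atTop_nhds_zero_nat.eventually_lt_const hε)
  obtain ⟨C₁, hC₁, hlow⟩ := hL.exists_critical_lower_bound
  obtain ⟨C₀, hC₀, hL₀⟩ := hL.exists_lower_bound
  -- The action on `[t, s]` is the total minus that of the initial part, which is bounded below by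
  -- the critical lower bound.
  have hlimit : ∀ t ≤ s, ∃ A, IsBoundedLimit L (U : Filter ℕ) γs γ t s A := fun t ht => by
    refine ⟨barrier L z σ x s + 1 + C₁ - c * (s - t), ht, ?_, ?_, fun τ _ => hlim τ⟩
    · filter_upwards [hat t] with j hj using (hadm j).mono hj ht le_rfl
    · filter_upwards [hat t, hsmall 1 one_pos] with j hj hj'
      have h1 := (hadm j).integral_add hj ht
      have h2 := hlow _ _ _ _ _ ((hadm j).mono le_rfl hj ht).connects
      have h3 := hact j
      rw [← h1] at h3
      linarith
  have hγadm : ∀ t ≤ s, Admissible L γ t s := fun t ht => by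
    obtain ⟨A, hA⟩ := hlimit t ht
    exact (hA.admissible hL).1
  have hgood : ∀ t < s, MDifferentiableAt 𝓘(ℝ, ℝ) 𝓘(ℝ, E) γ t →
      (∫ τ in t..s, lagrangianAlong L γ τ) + c * (s - t) ≤
        barrier L z σ x s - barrier L z σ (γ t) t := by
    intro t ht hd
    obtain ⟨C, hC, δ₀, hδ₀, hconn⟩ := hL.connects_limit hd hlim
    refine le_of_forall_small (k := C + C₀) hδ₀ fun ε hε δ hδ => ?_
    have htδ : t - δ ≤ t := by linarith [hδ.1]
    -- The initial part up to `t - δ`, followed by the short arc to `γ t`, competes in the barrier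
    -- at `(γ t, t)`. Subtracting its lower bound from the nearly optimal total gives this sharp
    -- bound for the remainder.
    have hbd : IsBoundedLimit L (U : Filter ℕ) γs γ (t - δ) s
        (barrier L z σ x s - barrier L z σ (γ t) t - c * (s - t) + ε + C * δ) := by
      obtain ⟨A, hA⟩ := hlimit (t - δ) (htδ.trans ht.le)
      refine ⟨hA.le, hA.adm, ?_, hA.lim⟩
      obtain ⟨N, hN⟩ := hL.barrier_lt_of_connects z σ (γ t) t (half_pos hε)
      filter_upwards [hat (t - δ), hsmall (ε / 2) (half_pos hε), (hconn δ hδ).1, hmt N]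
        with j hj hj' hjc hjN
      have h1 := (hadm j).integral_add hj (htδ.trans ht.le)
      have h2 := ((hadm j).mono le_rfl hj (htδ.trans ht.le)).connects.trans hjc
      have h3 := hL.connects_add_int h2 (m j : ℤ)
      have e1 : σ - m j + ((m j : ℤ) : ℝ) = σ := by push_cast; ring
      have e2 : t + ((m j : ℤ) : ℝ) = t + m j := by push_cast; ring
      rw [e1, e2, hz j] at h3
      have h4 := hN (m j) hjN _ h3
      have h5 := hact j
      rw [← h1] at h5
      linarith
    have h6 := (hbd.admissible hL).2
    rw [← (hγadm (t - δ) (htδ.trans ht.le)).integral_add htδ ht.le] at h6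
    have h7 := ((hγadm (t - δ) (htδ.trans ht.le)).mono le_rfl htδ ht.le).integral_ge hL₀
    rw [sub_sub_cancel] at h7
    linarith
  refine ⟨γ, hγs, fun t ht => ⟨hγadm t ht, ?_⟩⟩
  -- At an earlier time of differentiability the inequality on `[t', s]` is available. Domination on
  -- `[t', t]` and `[t, s]` gives the reverse inequalities, whose sum is then sharp, so each is an
  -- equality.
  obtain ⟨t', ht', hd⟩ : ∃ t' ∈ Ioo (t - 1) t, MDifferentiableAt 𝓘(ℝ, ℝ) 𝓘(ℝ, E) γ t' := by
    have hae := ((hγadm (t - 1) (by linarith)).ac.mono le_rfl ht).ae_mdifferentiableAt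
      (by linarith)
    have : ∃ᵐ t' : ℝ, t' ∈ Ioo (t - 1) t := by
      rw [frequently_ae_mem_iff]
      simp
    obtain ⟨t', h1, h2⟩ := (this.and_eventually hae).exists
    exact ⟨t', h1, h2 h1⟩
  have ha := hγadm t' (ht'.2.le.trans ht)
  have h1 := hgood t' (ht'.2.trans_le ht) hd
  have h2 := ha.integral_add ht'.2.le ht
  have h3 := hL.barrier_sub_le_right z σ (ha.mono le_rfl ht'.2.le ht).connects
  have h4 := hL.barrier_sub_le_right z σ (ha.mono ht'.2.le ht le_rfl).connects
  rw [hγs] at h4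
  rw [← hc] at h3 h4
  linarith

/-- Forward calibrated curves of the barrier. -/
theorem exists_forward_calibrated (hL : IsPeriodicTonelli L) (z : M) (σ : ℝ) (x : M) (s : ℝ) :
    ∃ γ : ℝ → M, γ s = x ∧ ∀ t, s ≤ t → Admissible L γ s t ∧
      barrier L x s z σ - barrier L (γ t) t z σ =
        (∫ τ in s..t, lagrangianAlong L γ τ) + criticalValue L * (t - s) := by
  set c := criticalValue L with hc
  have hseq : ∀ j : ℕ, ∃ (m : ℕ) (γ : ℝ → M), j ≤ m ∧ Admissible L γ s (σ + m) ∧ γ (σ + m) = z ∧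
      γ s = x ∧ (∫ τ in s..(σ + m), lagrangianAlong L γ τ) + c * (σ + m - s) <
        barrier L x s z σ + 1 / (j + 1) := by
    intro j
    obtain ⟨m, hm, A, ⟨γ, a1, a2, a3, a4⟩, hlt⟩ := hL.exists_connects_lt_barrier x s z σ
      (ε := 1 / ((j : ℝ) + 1)) (by positivity) j
    exact ⟨m, γ, hm, a1, a3, a2, by linarith⟩
  choose m γs hm hadm hz hx hact using hseq
  let U : Ultrafilter ℕ := hyperfilter ℕ
  have hU : (U : Filter ℕ) ≤ atTop := Nat.hyperfilter_le_atTop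
  obtain ⟨γ, hlim⟩ := exists_ultralimit U γs
  have hγs : γ s = x := tendsto_nhds_unique (hlim s) (by simp only [hx]; exact tendsto_const_nhds)
  have hmt : ∀ (N : ℕ), ∀ᶠ j in (U : Filter ℕ), N ≤ m j := fun N =>
    hU (by filter_upwards [eventually_ge_atTop N] with j hj using hj.trans (hm j))
  have hat : ∀ t : ℝ, ∀ᶠ j in (U : Filter ℕ), t ≤ σ + m j := fun t => by
    filter_upwards [hmt ⌈t - σ⌉₊] with j hj
    have h1 := Nat.le_ceil (t - σ)
    have h2 : (⌈t - σ⌉₊ : ℝ) ≤ m j := by exact_mod_cast hj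
    linarith
  have hsmall : ∀ ε > 0, ∀ᶠ j : ℕ in (U : Filter ℕ), 1 / ((j : ℝ) + 1) < ε := fun ε hε =>
    hU (tendsto_one_div_add_atTop_nhds_zero_nat.eventually_lt_const hε)
  obtain ⟨C₁, hC₁, hlow⟩ := hL.exists_critical_lower_bound
  obtain ⟨C₀, hC₀, hL₀⟩ := hL.exists_lower_bound
  have hlimit : ∀ t, s ≤ t → ∃ A, IsBoundedLimit L (U : Filter ℕ) γs γ s t A := fun t ht => by
    refine ⟨barrier L x s z σ + 1 + C₁ - c * (t - s), ht, ?_, ?_, fun τ _ => hlim τ⟩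
    · filter_upwards [hat t] with j hj using (hadm j).mono le_rfl ht hj
    · filter_upwards [hat t, hsmall 1 one_pos] with j hj hj'
      have h1 := (hadm j).integral_add ht hj
      have h2 := hlow _ _ _ _ _ ((hadm j).mono ht hj le_rfl).connects
      have h3 := hact j
      rw [← h1] at h3
      linarith
  have hγadm : ∀ t, s ≤ t → Admissible L γ s t := fun t ht => by
    obtain ⟨A, hA⟩ := hlimit t ht
    exact (hA.admissible hL).1
  have hgood : ∀ t, s < t → MDifferentiableAt 𝓘(ℝ, ℝ) 𝓘(ℝ, E) γ t →
      (∫ τ in s..t, lagrangianAlong L γ τ) + c * (t - s) ≤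
        barrier L x s z σ - barrier L (γ t) t z σ := by
    intro t ht hd
    obtain ⟨C, hC, δ₀, hδ₀, hconn⟩ := hL.connects_limit hd hlim
    refine le_of_forall_small (k := C + C₀) hδ₀ fun ε hε δ hδ => ?_
    have htδ : t ≤ t + δ := by linarith [hδ.1]
    -- The final part after `t + δ`, preceded by a short arc from `γ t`, now competes in the barrier
    -- from `(γ t, t)` to `(z, σ)`.
    have hbd : IsBoundedLimit L (U : Filter ℕ) γs γ s (t + δ)
        (barrier L x s z σ - barrier L (γ t) t z σ - c * (t - s) + ε + C * δ) := by
      obtain ⟨A, hA⟩ := hlimit (t + δ) (ht.le.trans htδ)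
      refine ⟨hA.le, hA.adm, ?_, hA.lim⟩
      obtain ⟨N, hN⟩ := hL.barrier_lt_of_connects (γ t) t z σ (half_pos hε)
      filter_upwards [hat (t + δ), hsmall (ε / 2) (half_pos hε), (hconn δ hδ).2, hmt N]
        with j hj hj' hjc hjN
      have h1 := (hadm j).integral_add (ht.le.trans htδ) hj
      have h3 := hjc.trans ((hadm j).mono (ht.le.trans htδ) hj le_rfl).connects
      rw [hz j] at h3
      have h4 := hN (m j) hjN _ h3
      have h5 := hact j
      rw [← h1] at h5
      linarith
    have h6 := (hbd.admissible hL).2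
    rw [← (hγadm (t + δ) (ht.le.trans htδ)).integral_add ht.le htδ] at h6
    have h7 := ((hγadm (t + δ) (ht.le.trans htδ)).mono ht.le htδ le_rfl).integral_ge hL₀
    rw [add_sub_cancel_left] at h7
    linarith
  refine ⟨γ, hγs, fun t ht => ⟨hγadm t ht, ?_⟩⟩
  obtain ⟨t', ht', hd⟩ : ∃ t' ∈ Ioo t (t + 1), MDifferentiableAt 𝓘(ℝ, ℝ) 𝓘(ℝ, E) γ t' := by
    have hae := ((hγadm (t + 1) (by linarith)).ac.mono ht le_rfl).ae_mdifferentiableAt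
      (by linarith)
    have : ∃ᵐ t' : ℝ, t' ∈ Ioo t (t + 1) := by
      rw [frequently_ae_mem_iff]
      simp
    obtain ⟨t', h1, h2⟩ := (this.and_eventually hae).exists
    exact ⟨t', h1, h2 h1⟩
  have ha := hγadm t' (ht.trans ht'.1.le)
  have h1 := hgood t' (ht.trans_lt ht'.1) hd
  have h2 := ha.integral_add ht ht'.1.le
  have h3 := hL.barrier_sub_le_left z σ (ha.mono le_rfl ht ht'.1.le).connects
  have h4 := hL.barrier_sub_le_left z σ (ha.mono ht ht'.1.le le_rfl).connects
  rw [hγs] at h3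
  rw [← hc] at h3 h4
  linarith

theorem isBackwardWeakKAM_barrier (hL : IsPeriodicTonelli L) (z : M) (σ : UnitAddCircle) :
    IsBackwardWeakKAM L
      (fun P => (peierlsBarrier L (criticalValue L) (z, σ) P).toReal) := by
  induction σ using QuotientAddGroup.induction_on with | H σ => ?_
  refine ⟨isDominated_of_connects fun x y s t A h => hL.barrier_sub_le_right z σ h,
    fun x s => ?_⟩
  obtain ⟨γ, hγ, h⟩ := hL.exists_backward_calibrated z σ x s
  refine ⟨γ, hγ, fun t ht => ⟨(h t ht).1.ac, ?_⟩⟩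
  rw [(h t ht).1.action_eq]
  exact congrArg _ (h t ht).2

theorem isForwardWeakKAM_barrier (hL : IsPeriodicTonelli L) (z : M) (σ : UnitAddCircle) :
    IsForwardWeakKAM L
      (fun P => -(peierlsBarrier L (criticalValue L) P (z, σ)).toReal) := by
  induction σ using QuotientAddGroup.induction_on with | H σ => ?_
  refine ⟨isDominated_of_connects fun x y s t A h => ?_, fun x s => ?_⟩
  · have := hL.barrier_sub_le_left z σ h
    unfold barrier at this
    exact (neg_sub_neg _ _).trans_le this
  · obtain ⟨γ, hγ, h⟩ := hL.exists_forward_calibrated z σ x s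
    refine ⟨γ, hγ, fun t ht => ⟨(h t ht).1.ac, ?_⟩⟩
    rw [(h t ht).1.action_eq]
    exact congrArg _ ((neg_sub_neg _ _).trans (h t ht).2)

end IsPeriodicTonelli

end Calibration

end WeakKAM

end

/-! ### The lemma -/

theorem mainTheorem2
    {E : Type*} [NormedAddCommGroup E] [NormedSpace ℝ E] [FiniteDimensional ℝ E]
    {M : Type*} [TopologicalSpace M] [ChartedSpace E M] [IsManifold 𝓘(ℝ, E) ∞ M]
    [CompactSpace M] [T2Space M] [ConnectedSpace M]
    (L : TangentBundle 𝓘(ℝ, E) M → ℝ → ℝ) (hL : WeakKAM.IsPeriodicTonelli L) :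
    (∀ P Q : M × UnitAddCircle,
      WeakKAM.peierlsBarrier L (WeakKAM.criticalValue L) P Q ≠ ⊤ ∧
      WeakKAM.peierlsBarrier L (WeakKAM.criticalValue L) P Q ≠ ⊥) ∧
    (∀ (z : M) (σ : UnitAddCircle),
      WeakKAM.IsBackwardWeakKAM L
        (fun P => (WeakKAM.peierlsBarrier L (WeakKAM.criticalValue L) (z, σ) P).toReal) ∧
      WeakKAM.IsForwardWeakKAM L
        (fun P => -(WeakKAM.peierlsBarrier L (WeakKAM.criticalValue L) P (z, σ)).toReal)) ∧
    (∃ u : M × UnitAddCircle → ℝ, WeakKAM.IsBackwardWeakKAM L u) ∧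
    (∃ v : M × UnitAddCircle → ℝ, WeakKAM.IsForwardWeakKAM L v) := by
  obtain ⟨z⟩ := (inferInstance : Nonempty M)
  exact ⟨hL.peierls_bounds,
    fun z σ => ⟨hL.isBackwardWeakKAM_barrier z σ, hL.isForwardWeakKAM_barrier z σ⟩,
    ⟨_, hL.isBackwardWeakKAM_barrier z 0⟩, ⟨_, hL.isForwardWeakKAM_barrier z 0⟩⟩
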